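/- Let $I\subset[-1,1]$ be a nondegenerate closed interval and $g=(g_1,g_2):I\to\mathbb R^2$ a $C^3$ curve such that, for positive constants $b_0,b_1,b_2$ and all $\alpha\in I$, $$\|g\|_{C^3(I)}\le b_0,\qquad |g'(\alpha)|\ge b_1,\qquad |g_1'(\alpha)g_2''(\alpha)-g_2'(\alpha)g_1''(\alpha)|\ge b_2, \tag{1}$$ where $\|g\|_{C^3(I)}=\max_{k\le 3}\sup_I|g^{(k)}|$. Put $u_1(\alpha)=(g(\alpha),1)$, $u_2(\alpha)=(g'(\alpha),0)$, $u_3(\alpha)=u_1(\alpha)\times u_2(\alpha)$. The $(\delta,\lambda)$-plate $R^\alpha_{\delta,\lambda}$ at $\alpha$ associated to $g$ is the set of $\xi\in\mathbb R^3$ with $$\lambda/2\le|\langle u_1(\alpha),\xi\rangle|\le2\lambda,\quad |\langle u_2(\alpha),\xi-\xi_3u_1(\alpha)\rangle|\le\lambda\delta^{1/2},\quad |\langle u_3(\alpha),\xi\rangle|\le\lambda\delta .$$ A $C^\infty$ function $\phi:\mathbb R^3\to\mathbb C$ is an admissible bump function associated to $R^\alpha_{\delta,\lambda}$ if it is supported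 in $R^\alpha_{\delta,\lambda}$ and $$\big|\langle u_1(\alpha),\nabla\rangle^{n_1}\langle u_2(\alpha),\nabla\rangle^{n_2}\langle u_3(\alpha),\nabla\rangle^{n_3}\phi(\xi)\big|\le\lambda^{-n_1-n_2-n_3}\delta^{-n_2/2}\delta^{-n_3},\qquad 0\le n_1+n_2+n_3\le4 .$$ For $\lambda\ge1$, $\delta>0$, $\delta^{1/2}\le\theta$ and $0<\sigma\le\delta^{1/2}$, a finite collection $\mathcal R=\{R_\nu\}_{\nu=1}^N$ is a $(\delta,\lambda,\theta)$-plate family with separation $\sigma$ associated to $g$ if $R_\nu=R^{\alpha_\nu}_{\delta,\lambda}$ with $\alpha_\nu\in I$, $|\alpha_\nu-\alpha_{\nu'}|\ge\sigma$ for $\nu\ne\nu'$, and $\max_\nu\alpha_\nu-\min_\nu\alpha_\nu\le\theta$. **Proposition.** Let $2<p<\infty$. Assume that for every $\varepsilon>0$ there is $A(\varepsilon)$ such that for all $\delta,\lambda$, all $(\delta,\lambda,1)$-plate families $\mathcal R$ with separation $\sqrt\delta$ associated to the circle $\alpha\mapsto(\cos2\pi\alpha,\sin2\pi\alpha)$,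 $-\tfrac12\le\alpha\le\tfrac12$, all admissible bump functions $\phi_R$ associated to $R\in\mathcal R$, and all $f_R\in L^p(\mathbb R^3)$, $$\Big\|\sum_{R\in\mathcal R}\mathcal F^{-1}[\phi_R\widehat f_R]\Big\|_p\le A(\varepsilon)\,\delta^{\frac2p-\frac12-\varepsilon}\Big(\sum_{R\in\mathcal R}\|f_R\|_p^p\Big)^{1/p}.$$ Then for all $b_0,b_1,b_2>0$ and $\varepsilon>0$ there is a constant $C(\varepsilon)$, depending (for the given $p$) only on $\varepsilon,b_0,b_1,b_2$, such that for every $I$ and $g$ satisfying (1), all $0<\delta\le1$, $\lambda\ge1$, $\theta\ge\sqrt\delta$, $0<\sigma\le\sqrt\delta$, every $(\delta,\lambda,\theta)$-plate family $\mathcal R$ with separation $\sigma$ associated to $g$, all admissible bump functions $\phi_R$ associated to $R\in\mathcal R$, and all $f_R\in L^p(\mathbb R^3)$, $$\Big\|\sum_{R\in\mathcal R}\mathcal F^{-1}[\phi_R\widehat f_R]\Big\|_p\le C(\varepsilon)\,\delta^{1/2}\sigma^{-1}(\delta\theta^{-2})^{\frac2p-\frac12-\varepsilon}\Big(\sum_{R\in\mathcal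 R}\|f_R\|_p^p\Big)^{1/p}.$$ -/

import Mathlib

open MeasureTheory
open scoped ENNReal ContDiff SchwartzMap

noncomputable section

namespace ConePlates

/-- The Euclidean plane. -/
abbrev E2 : Type := EuclideanSpace ℝ (Fin 2)

/-- Euclidean three-space. -/
abbrev E3 : Type := EuclideanSpace ℝ (Fin 3)

/-- `I` is a (nondegenerate) closed subinterval of `[-1, 1]`. -/
def IsClosedSubinterval (I : Set ℝ) : Prop :=
  ∃ a b : ℝ, -1 ≤ a ∧ a < b ∧ b ≤ 1 ∧ I = Set.Icc a b

/-- The `k`-th derivative of the plane curve `g` on the interval `I`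
(one-sided at the endpoints of `I`). -/
def curveDeriv (I : Set ℝ) (g : ℝ → E2) (k : ℕ) (α : ℝ) : E2 :=
  iteratedDerivWithin k g I α

/-- The curve `g : I → ℝ²` is of class `C³` with `‖g‖_{C³(I)} ≤ b₀` (maximum of the sup norms of
the derivatives of order `0, …, 3`), `|g'| ≥ b₁` and `|g₁' g₂'' - g₂' g₁''| ≥ b₂` on `I`. -/
structure CurveAssumption (I : Set ℝ) (g : ℝ → E2) (b₀ b₁ b₂ : ℝ) : Prop where
  contDiffOn : ContDiffOn ℝ 3 g I
  norm_le : ∀ k ≤ 3, ∀ α ∈ I, ‖curveDeriv I g k α‖ ≤ b₀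
  speed_ge : ∀ α ∈ I, b₁ ≤ ‖curveDeriv I g 1 α‖
  curvature_ge : ∀ α ∈ I,
    b₂ ≤ |curveDeriv I g 1 α 0 * curveDeriv I g 2 α 1
          - curveDeriv I g 1 α 1 * curveDeriv I g 2 α 0|

/-- `u₁(α) = (g(α), 1)`. -/
def u₁ (g : ℝ → E2) (α : ℝ) : E3 := !₂[g α 0, g α 1, 1]

/-- `u₂(α) = (g'(α), 0)`. -/
def u₂ (I : Set ℝ) (g : ℝ → E2) (α : ℝ) : E3 :=
  !₂[curveDeriv I g 1 α 0, curveDeriv I g 1 α 1, 0]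

/-- `u₃(α) = u₁(α) × u₂(α)`. -/
def u₃ (I : Set ℝ) (g : ℝ → E2) (α : ℝ) : E3 :=
  WithLp.toLp 2 (crossProduct (WithLp.ofLp (u₁ g α)) (WithLp.ofLp (u₂ I g α)))

/-- The `(δ, lam)`-plate at `α` associated to the curve `g : I → ℝ²`. -/
def plate (I : Set ℝ) (g : ℝ → E2) (δ lam α : ℝ) : Set E3 :=
  {ξ | lam / 2 ≤ |inner ℝ (u₁ g α) ξ| ∧ |inner ℝ (u₁ g α) ξ| ≤ 2 * lam ∧
       |inner ℝ (u₂ I g α) (ξ - ξ 2 • u₁ g α)| ≤ lam * δ ^ (1 / 2 : ℝ) ∧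
       |inner ℝ (u₃ I g α) ξ| ≤ lam * δ}

/-- The directional derivative `⟨u, ∇⟩ φ`. -/
def dirDeriv (u : E3) (φ : E3 → ℂ) : E3 → ℂ := fun ξ => fderiv ℝ φ ξ u

/-- `φ` is an admissible bump function associated to the `(δ, lam)`-plate at `α`. -/
structure IsAdmissibleBump (I : Set ℝ) (g : ℝ → E2) (δ lam α : ℝ) (φ : E3 → ℂ) : Prop where
  contDiff : ContDiff ℝ ∞ φ
  tsupport_subset : tsupport φ ⊆ plate I g δ lam α
  deriv_le : ∀ n₁ n₂ n₃ : ℕ, n₁ + n₂ + n₃ ≤ 4 → ∀ ξ : E3,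
    ‖((dirDeriv (u₁ g α))^[n₁] ((dirDeriv (u₂ I g α))^[n₂] ((dirDeriv (u₃ I g α))^[n₃] φ))) ξ‖
      ≤ lam ^ (-(n₁ : ℝ) - n₂ - n₃) * δ ^ (-(n₂ : ℝ) / 2) * δ ^ (-(n₃ : ℝ))

/-- The plates at the parameters `α₁, …, α_N ∈ I` (for any curve defined on `I`) form a
`(δ, lam, θ)`-plate family with separation `σ`. -/
structure IsPlateFamily (I : Set ℝ) (δ lam θ σ : ℝ) {N : ℕ} (α : Fin N → ℝ) : Prop where
  one_le_lam : 1 ≤ lam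
  delta_pos : 0 < δ
  sqrt_delta_le : δ ^ (1 / 2 : ℝ) ≤ θ
  sigma_pos : 0 < σ
  sigma_le : σ ≤ δ ^ (1 / 2 : ℝ)
  mem : ∀ ν, α ν ∈ I
  separated : ∀ ν ν', ν ≠ ν' → σ ≤ |α ν - α ν'|
  spread_le : ∀ ν ν', α ν - α ν' ≤ θ

/-- The inequality
`‖∑_ν 𝓕⁻¹[φ_ν 𝓕 f_ν]‖_p ≤ K (∑_ν ‖f_ν‖_p ^ p)^(1/p)` for all `f_ν ∈ L^p(ℝ³)`.
Here `𝓕⁻¹[φ_ν 𝓕 f_ν]` is formed in the space of tempered distributions, and it is part of the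
claim that the sum is (given by) an `L^p` function. -/
def DecompositionInequality (p : ℝ) [Fact (1 ≤ ENNReal.ofReal p)] {N : ℕ}
    (φ : Fin N → E3 → ℂ) (K : ℝ) : Prop :=
  ∀ f : Fin N → Lp ℂ (ENNReal.ofReal p) (volume : Measure E3),
    ∃ F : Lp ℂ (ENNReal.ofReal p) (volume : Measure E3),
      (F : 𝓢'(E3, ℂ)) =
        ∑ ν, TemperedDistribution.fourierMultiplierCLM ℂ (φ ν) (f ν : 𝓢'(E3, ℂ)) ∧
      ‖F‖ ≤ K * (∑ ν, ‖f ν‖ ^ p) ^ (1 / p)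

/-- The parameter interval `[-1/2, 1/2]` of the unit circle. -/
def circleInterval : Set ℝ := Set.Icc (-1 / 2) (1 / 2)

/-- The unit circle `α ↦ (cos 2πα, sin 2πα)`, which generates the light cone. -/
def circleCurve : ℝ → E2 :=
  fun α => !₂[Real.cos (2 * Real.pi * α), Real.sin (2 * Real.pi * α)]

/-- Wolff's inequality for the light cone: for every `ε > 0` there is a constant `A(ε)` such that
the decomposition inequality holds with constant `A(ε) δ ^ (2/p - 1/2 - ε)` for all
`(δ, lam, 1)`-plate families with separation `√δ` associated to the unit circle. -/
def WolffInequality (p : ℝ) [Fact (1 ≤ ENNReal.ofReal p)] : Prop :=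
  ∀ ε : ℝ, 0 < ε → ∃ A : ℝ,
    ∀ (δ lam : ℝ) (N : ℕ) (α : Fin N → ℝ) (φ : Fin N → E3 → ℂ),
      IsPlateFamily circleInterval δ lam 1 (δ ^ (1 / 2 : ℝ)) α →
      (∀ ν, IsAdmissibleBump circleInterval circleCurve δ lam (α ν) (φ ν)) →
      DecompositionInequality p φ (A * δ ^ (2 / p - 1 / 2 - ε))

end ConePlates

end

/-!
The circular cone is extended to cones over arbitrary curves by an induction on scales.

Write `r = δ ^ (1/2)`. A plate at `α` is, up to bounded factors, the image of a fixed region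
`{‖x‖ ≤ R, |x 0| ≥ 1 / R}` under the matrix `F(α) diag(1, r, r²)`, where `F(α)` is the moving frame
`(u₁, u₁', u₁'')`. This description (`DerivBound`, `SuppIn`, `shell`) is stable under linear changes
of variables and under multiplication of the frame by matrices with bounded entries, and the
inequality is invariant under linear changes of the frequency variable
(`SchwartzDecomposition.comp_linear`). All estimates are made for Schwartz functions; density and
the continuity of multipliers on tempered distributions transfer them to `L^p`.

* A `C³` curve agrees with its second-order Taylor polynomial on an arc of length `θ` up to
  `O(θ³)`. If `θ³ ≤ 2 r²`, this error is invisible at the scale of the plates. After rescaling by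
  `diag(1, θ, θ²)` the arc is a piece of a parabola, and the cone over a parabola is linearly
  equivalent to the circular cone. So one linear map takes the plates on the arc to circular plates
  of width `r / θ` (`exists_circle_transfer`), and the hypothesis gives the bound
  `O((θ / r) ^ E)` for such arcs, where `E = 2 (1/2 - 2/p + ε)` (`WolffInequality.short_arc`).
* For a general arc of length `θ`, put `θ' = r (θ / r) ^ (1/3)`, so that `θ'³ = r² θ`. The plates of
  width `r` on an arc of length `θ'` lie in one plate of width `θ'`
  (`CurveAssumption.frame_eq_mul`). A bound `O((θ / r) ^ s)` for all families, applied to the larger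
  plates, and the previous bound, applied within them, multiply (`SchwartzDecomposition.comp`) to
  `O((θ / r) ^ ((2 s + E) / 3))`. The triangle inequality provides the start `s = 1`, and the
  iteration converges to `E`; a small change of `ε` makes finitely many steps suffice
  (`WolffInequality.adaptedBound`).
* A `σ`-separated family splits into `O(r / σ)` families that are `r`-separated, which accounts for
  the factor `δ ^ (1/2) σ⁻¹` (`WolffInequality.plateFamily`).

The hypothesis is also used at a single plate: it shows that bump functions are bounded multipliers
(`WolffInequality.single`) and that the exponent `2/p - 1/2 - ε` cannot be positive
(`WolffInequality.exponent_nonpos`).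
-/

noncomputable section

namespace ConePlates

section

open Filter Topology FourierTransform

/-! ### The decomposition inequality on Schwartz functions -/

/-- The Fourier multiplier operator `f ↦ 𝓕⁻¹[φ 𝓕 f]` on Schwartz functions. -/
abbrev mult (φ : E3 → ℂ) : 𝓢(E3, ℂ) →L[ℂ] 𝓢(E3, ℂ) := SchwartzMap.fourierMultiplierCLM ℂ φ

/-- The `L^p` norm of a Schwartz function. -/
def snorm (p : ℝ) [Fact (1 ≤ ENNReal.ofReal p)] (f : 𝓢(E3, ℂ)) : ℝ :=
  ‖f.toLp (ENNReal.ofReal p) (volume : Measure E3)‖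

/-- The decomposition inequality with constant `K`, tested on Schwartz functions only and for a
family indexed by an arbitrary finite type. -/
def SchwartzDecomposition (p : ℝ) [Fact (1 ≤ ENNReal.ofReal p)] {ι : Type} [Fintype ι]
    (φ : ι → E3 → ℂ) (K : ℝ) : Prop :=
  ∀ f : ι → 𝓢(E3, ℂ),
    snorm p (∑ i, mult (φ i) (f i)) ≤ K * (∑ i, snorm p (f i) ^ p) ^ (1 / p)

lemma one_le_exponent {p : ℝ} [hp : Fact (1 ≤ ENNReal.ofReal p)] : 1 ≤ p := by
  have := hp.out
  rwa [ENNReal.one_le_ofReal] at this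

lemma exponent_pos {p : ℝ} [Fact (1 ≤ ENNReal.ofReal p)] : 0 < p :=
  zero_lt_one.trans_le one_le_exponent

variable {p : ℝ} [Fact (1 ≤ ENNReal.ofReal p)]

lemma snorm_eq (f : 𝓢(E3, ℂ)) :
    snorm p f = ‖SchwartzMap.toLpCLM ℂ ℂ (ENNReal.ofReal p) (volume : Measure E3) f‖ := rfl

lemma snorm_nonneg (f : 𝓢(E3, ℂ)) : 0 ≤ snorm p f := norm_nonneg _

lemma snorm_sum_le {κ : Type} (s : Finset κ) (f : κ → 𝓢(E3, ℂ)) :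
    snorm p (∑ k ∈ s, f k) ≤ ∑ k ∈ s, snorm p (f k) := by
  simp only [snorm_eq, map_sum]
  exact norm_sum_le _ _

lemma snorm_smul (c : ℂ) (f : 𝓢(E3, ℂ)) : snorm p (c • f) = ‖c‖ * snorm p f := by
  simp only [snorm_eq, map_smul, norm_smul]

lemma snorm_eq_zero {f : 𝓢(E3, ℂ)} (h : snorm p f = 0) : f = 0 := by
  have h1 : f.toLp (ENNReal.ofReal p) (volume : Measure E3) = 0 := norm_eq_zero.mp h
  apply SchwartzMap.injective_toLp (ENNReal.ofReal p) (volume : Measure E3)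
  have h2 : SchwartzMap.toLpCLM ℂ ℂ (ENNReal.ofReal p) (volume : Measure E3) 0 = 0 := map_zero _
  exact h1.trans h2.symm

lemma lpSum_nonneg {ι : Type} [Fintype ι] (f : ι → 𝓢(E3, ℂ)) :
    0 ≤ (∑ i, snorm p (f i) ^ p) ^ (1 / p) :=
  Real.rpow_nonneg (Finset.sum_nonneg fun _ _ => Real.rpow_nonneg (snorm_nonneg _) _) _

lemma SchwartzDecomposition.mono {ι : Type} [Fintype ι] {φ : ι → E3 → ℂ} {K K' : ℝ}
    (h : SchwartzDecomposition p φ K) (hK : K ≤ K') : SchwartzDecomposition p φ K' :=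
  fun f => (h f).trans (mul_le_mul_of_nonneg_right hK (lpSum_nonneg f))

lemma SchwartzDecomposition.reindex {ι κ : Type} [Fintype ι] [Fintype κ] (e : κ ≃ ι)
    {φ : ι → E3 → ℂ} {K : ℝ} (h : SchwartzDecomposition p (fun k => φ (e k)) K) :
    SchwartzDecomposition p φ K := by
  intro f
  have := h (fun k => f (e k))
  rwa [Equiv.sum_comp e (fun i => mult (φ i) (f i)),
    Equiv.sum_comp e (fun i => snorm p (f i) ^ p)] at this

/-- By density of Schwartz functions in `L^p` and continuity of multipliers on tempered
distributions, it suffices to test the inequality on Schwartz functions. -/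
theorem SchwartzDecomposition.decompositionInequality {N : ℕ} {φ : Fin N → E3 → ℂ} {K : ℝ}
    (hφ : ∀ ν, (φ ν).HasTemperateGrowth) (h : SchwartzDecomposition p φ K) :
    DecompositionInequality p φ K := by
  intro f
  set L := SchwartzMap.toLpCLM ℂ ℂ (ENNReal.ofReal p) (volume : Measure E3) with hL
  have hdense : DenseRange L :=
    SchwartzMap.denseRange_toLpCLM (F := ℂ) (ENNReal.ofReal_ne_top)
  have happ : ∀ ν, ∃ u : ℕ → 𝓢(E3, ℂ), Tendsto (fun n => L (u n)) atTop (𝓝 (f ν)) := by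
    intro ν
    obtain ⟨x, hx, hlim⟩ := mem_closure_iff_seq_limit.mp (hdense (f ν))
    choose u hu using hx
    exact ⟨u, by simpa only [hu] using hlim⟩
  choose u hu using happ
  set G : ℕ → Lp ℂ (ENNReal.ofReal p) (volume : Measure E3) :=
    fun n => L (∑ ν, mult (φ ν) (u ν n)) with hG
  have hp0 : 0 < p := exponent_pos (p := p)
  -- the right-hand side as a continuous function of the vector of `L^p` norms
  set Φ : (Fin N → ℝ) → ℝ := fun x => K * (∑ ν, x ν ^ p) ^ (1 / p) with hΦ
  have hΦc : Continuous Φ := by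
    refine continuous_const.mul ((Real.continuous_rpow_const (by positivity)).comp ?_)
    exact continuous_finsetSum _ fun ν _ =>
      (Real.continuous_rpow_const hp0.le).comp (continuous_apply ν)
  have hΦ0 : Φ 0 = 0 := by
    simp [hΦ, Real.zero_rpow hp0.ne', Real.zero_rpow (inv_pos.mpr hp0).ne']
  have hcauchy : CauchySeq G := by
    rw [cauchySeq_iff_tendsto_dist_atTop_0]
    have h1 : Tendsto (fun n : ℕ × ℕ => Φ fun ν => dist (L (u ν n.1)) (L (u ν n.2)))
        atTop (𝓝 (Φ 0)) := by
      refine (hΦc.tendsto 0).comp ?_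
      rw [tendsto_pi_nhds]
      intro ν
      exact cauchySeq_iff_tendsto_dist_atTop_0.mp (hu ν).cauchySeq
    rw [hΦ0] at h1
    refine squeeze_zero (fun _ => dist_nonneg) (fun n => ?_) h1
    have := h (fun ν => u ν n.1 - u ν n.2)
    simpa only [hΦ, hG, dist_eq_norm, ← map_sub, ← Finset.sum_sub_distrib, snorm_eq] using this
  obtain ⟨F, hF⟩ := cauchySeq_tendsto_of_complete hcauchy
  refine ⟨F, ?_, ?_⟩
  · set T := Lp.toTemperedDistributionCLM ℂ (volume : Measure E3) (ENNReal.ofReal p) with hT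
    have h1 : Tendsto (fun n => T (G n)) atTop (𝓝 (T F)) := (T.continuous.tendsto _).comp hF
    have h2 : Tendsto (fun n => ∑ ν, TemperedDistribution.fourierMultiplierCLM ℂ (φ ν)
        (T (L (u ν n)))) atTop
        (𝓝 (∑ ν, TemperedDistribution.fourierMultiplierCLM ℂ (φ ν) (T (f ν)))) := by
      refine tendsto_finsetSum _ fun ν _ => ?_
      exact (((TemperedDistribution.fourierMultiplierCLM ℂ (φ ν)).continuous.comp
        T.continuous).tendsto _).comp (hu ν)
    have h3 : (fun n => T (G n)) = fun n => ∑ ν,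
        TemperedDistribution.fourierMultiplierCLM ℂ (φ ν) (T (L (u ν n))) := by
      funext n
      have hTL : ∀ g : 𝓢(E3, ℂ), T (L g) = (g : 𝓢'(E3, ℂ)) := fun g =>
        Lp.toTemperedDistribution_toLp_eq g
      simp only [hG]
      rw [hTL, map_sum]
      refine Finset.sum_congr rfl fun ν _ => ?_
      rw [hTL]
      exact (TemperedDistribution.fourierMultiplierCLM_toTemperedDistributionCLM_eq
        (hφ ν) (u ν n)).symm
    rw [h3] at h1
    exact tendsto_nhds_unique h1 h2
  · have h1 : Tendsto (fun n => Φ fun ν => ‖L (u ν n)‖) atTop (𝓝 (Φ fun ν => ‖f ν‖)) := by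
      refine (hΦc.tendsto _).comp ?_
      rw [tendsto_pi_nhds]
      exact fun ν => (hu ν).norm
    exact le_of_tendsto_of_tendsto' hF.norm h1 fun n => h fun ν => u ν n

/-- On Schwartz functions the distribution of the decomposition inequality is a Schwartz function,
and it determines its `L^p` representative. -/
theorem SchwartzDecomposition.of_decompositionInequality {N : ℕ} {φ : Fin N → E3 → ℂ} {K : ℝ}
    (hφ : ∀ ν, (φ ν).HasTemperateGrowth) (h : DecompositionInequality p φ K) :
    SchwartzDecomposition p φ K := by
  intro f
  obtain ⟨F, hF, hK⟩ := h fun ν => (f ν).toLp (ENNReal.ofReal p) (volume : Measure E3)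
  set T := Lp.toTemperedDistributionCLM ℂ (volume : Measure E3) (ENNReal.ofReal p) with hT
  have hinj : Function.Injective T := LinearMap.ker_eq_bot.mp
    (Lp.ker_toTemperedDistributionCLM_eq_bot (F := ℂ) (μ := (volume : Measure E3))
      (p := ENNReal.ofReal p))
  have hTL : ∀ g : 𝓢(E3, ℂ), T (g.toLp (ENNReal.ofReal p) (volume : Measure E3))
      = (g : 𝓢'(E3, ℂ)) := fun g => Lp.toTemperedDistribution_toLp_eq g
  have hFe : F = (∑ ν, mult (φ ν) (f ν)).toLp (ENNReal.ofReal p) (volume : Measure E3) := by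
    apply hinj
    rw [hTL, map_sum]
    refine hF.trans (Finset.sum_congr rfl fun ν _ => ?_)
    refine Eq.trans ?_ (TemperedDistribution.fourierMultiplierCLM_toTemperedDistributionCLM_eq
        (hφ ν) (f ν))
    exact congrArg _ (hTL (f ν))
  rw [hFe] at hK
  exact hK

/-! ### Sums, subfamilies and compositions of multipliers -/

lemma SchwartzDecomposition.sum {ι κ : Type} [Fintype ι] {s : Finset κ} {φ : κ → ι → E3 → ℂ}
    {ψ : ι → E3 → ℂ} {K : κ → ℝ} (hφ : ∀ k ∈ s, ∀ i, (φ k i).HasTemperateGrowth)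
    (hψ : ∀ i, ψ i = fun ξ => ∑ k ∈ s, φ k i ξ)
    (h : ∀ k ∈ s, SchwartzDecomposition p (φ k) (K k)) :
    SchwartzDecomposition p ψ (∑ k ∈ s, K k) := by
  intro f
  have h1 : ∑ i, mult (ψ i) (f i) = ∑ k ∈ s, ∑ i, mult (φ k i) (f i) := by
    rw [Finset.sum_comm]
    refine Finset.sum_congr rfl fun i _ => ?_
    rw [hψ i, mult, SchwartzMap.fourierMultiplierCLM_sum ℂ (fun k hk => hφ k hk i)]
    simp
  rw [h1, Finset.sum_mul]
  exact (snorm_sum_le _ _).trans (Finset.sum_le_sum fun k hk => h k hk f)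

lemma SchwartzDecomposition.smul {ι : Type} [Fintype ι] {φ : ι → E3 → ℂ} {K : ℝ} (c : ℂ)
    (hφ : ∀ i, (φ i).HasTemperateGrowth) (h : SchwartzDecomposition p φ K) :
    SchwartzDecomposition p (fun i => c • φ i) (‖c‖ * K) := by
  intro f
  have h1 : ∑ i, mult (c • φ i) (f i) = c • ∑ i, mult (φ i) (f i) := by
    rw [Finset.smul_sum]
    refine Finset.sum_congr rfl fun i _ => ?_
    rw [mult, SchwartzMap.fourierMultiplierCLM_smul (hφ i)]
    rfl
  rw [h1, snorm_smul, mul_assoc]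
  exact mul_le_mul_of_nonneg_left (h f) (norm_nonneg _)

lemma sum_eq_sum_fibers {ι κ M : Type} [Fintype ι] [Fintype κ] [DecidableEq κ] [AddCommMonoid M]
    (cls : ι → κ) (F : ι → M) : ∑ i, F i = ∑ k, ∑ i : {i // cls i = k}, F i := by
  rw [← Finset.sum_fiberwise Finset.univ cls F]
  refine Finset.sum_congr rfl fun k _ => ?_
  exact (Finset.sum_subtype _ (by simp) F)

/-- A family that is divided into classes satisfies the inequality with the sum of the constants
of its classes. -/
lemma SchwartzDecomposition.of_classes {ι κ : Type} [Fintype ι] [Fintype κ] [DecidableEq κ]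
    (cls : ι → κ) {φ : ι → E3 → ℂ} {K : ℝ} (hK : 0 ≤ K)
    (h : ∀ k, SchwartzDecomposition p (fun i : {i // cls i = k} => φ i) K) :
    SchwartzDecomposition p φ (Fintype.card κ * K) := by
  intro f
  have hp0 : 0 < p := exponent_pos (p := p)
  rw [sum_eq_sum_fibers cls]
  refine (snorm_sum_le _ _).trans ?_
  have hle : ∀ k ∈ Finset.univ, snorm p (∑ i : {i // cls i = k}, mult (φ i) (f i)) ≤
      K * (∑ i, snorm p (f i) ^ p) ^ (1 / p) := by
    intro k _
    refine (h k fun i => f i).trans (mul_le_mul_of_nonneg_left ?_ hK)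
    refine Real.rpow_le_rpow ?_ ?_ (by positivity)
    · exact Finset.sum_nonneg fun _ _ => Real.rpow_nonneg (snorm_nonneg _) _
    · rw [sum_eq_sum_fibers cls (fun i => snorm p (f i) ^ p)]
      exact Finset.single_le_sum (f := fun k => ∑ i : {i // cls i = k}, snorm p (f i) ^ p)
        (fun k _ => Finset.sum_nonneg fun _ _ => Real.rpow_nonneg (snorm_nonneg _) _)
        (Finset.mem_univ k)
  refine (Finset.sum_le_sum hle).trans ?_
  simp [mul_assoc]

/-- If the members of each class of a family are localized by a common multiplier `Ψ`, then the
inequality for the family `Ψ` and the inequalities within the classes multiply. -/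
lemma SchwartzDecomposition.comp {ι κ : Type} [Fintype ι] [Fintype κ] [DecidableEq κ]
    (cls : ι → κ) {φ : ι → E3 → ℂ} {Ψ : κ → E3 → ℂ} {K₁ K₂ : ℝ} (hK₁ : 0 ≤ K₁) (hK₂ : 0 ≤ K₂)
    (hφ : ∀ i, (φ i).HasTemperateGrowth) (hΨ : ∀ k, (Ψ k).HasTemperateGrowth)
    (hmul : ∀ i, Ψ (cls i) * φ i = φ i)
    (h₁ : SchwartzDecomposition p Ψ K₁)
    (h₂ : ∀ k, SchwartzDecomposition p (fun i : {i // cls i = k} => φ i) K₂) :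
    SchwartzDecomposition p φ (K₁ * K₂) := by
  intro f
  have hp0 : 0 < p := exponent_pos (p := p)
  set F : κ → 𝓢(E3, ℂ) := fun k => ∑ i : {i // cls i = k}, mult (φ i) (f i) with hF
  have h3 : ∑ i, mult (φ i) (f i) = ∑ k, mult (Ψ k) (F k) := by
    rw [sum_eq_sum_fibers cls]
    refine Finset.sum_congr rfl fun k _ => ?_
    simp only [hF, map_sum]
    refine Finset.sum_congr rfl fun i _ => ?_
    rw [mult, mult, SchwartzMap.fourierMultiplierCLM_fourierMultiplierCLM_apply (hΨ k) (hφ i)]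
    have := hmul i
    rw [i.2] at this
    rw [this]
  rw [h3]
  refine (h₁ F).trans ?_
  rw [mul_assoc]
  refine mul_le_mul_of_nonneg_left ?_ hK₁
  have h4 : ∀ k, snorm p (F k) ^ p ≤ K₂ ^ p * ∑ i : {i // cls i = k}, snorm p (f i) ^ p := by
    intro k
    have h5 := Real.rpow_le_rpow (snorm_nonneg _) (h₂ k fun i => f i) hp0.le
    have h6 : 0 ≤ ∑ i : {i // cls i = k}, snorm p (f i) ^ p :=
      Finset.sum_nonneg fun _ _ => Real.rpow_nonneg (snorm_nonneg _) _
    rwa [Real.mul_rpow hK₂ (Real.rpow_nonneg h6 _), ← Real.rpow_mul h6, one_div,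
      inv_mul_cancel₀ hp0.ne', Real.rpow_one] at h5
  have h7 : ∑ k, snorm p (F k) ^ p ≤ K₂ ^ p * ∑ i, snorm p (f i) ^ p := by
    rw [sum_eq_sum_fibers cls (fun i => snorm p (f i) ^ p), Finset.mul_sum]
    exact Finset.sum_le_sum fun k _ => h4 k
  have h8 : 0 ≤ ∑ i, snorm p (f i) ^ p :=
    Finset.sum_nonneg fun _ _ => Real.rpow_nonneg (snorm_nonneg _) _
  refine (Real.rpow_le_rpow (Finset.sum_nonneg fun _ _ =>
    Real.rpow_nonneg (snorm_nonneg _) _) h7 (by positivity)).trans ?_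
  rw [Real.mul_rpow (Real.rpow_nonneg hK₂ _) h8, ← Real.rpow_mul hK₂, mul_one_div_cancel hp0.ne',
    Real.rpow_one]

/-- The triangle inequality: uniformly bounded multipliers satisfy the inequality with the number
of members as constant. -/
lemma SchwartzDecomposition.of_single {ι : Type} [Fintype ι] [DecidableEq ι] {φ : ι → E3 → ℂ}
    {K : ℝ} (hK : 0 ≤ K) (h : ∀ i, SchwartzDecomposition p (fun _ : Unit => φ i) K) :
    SchwartzDecomposition p φ (Fintype.card ι * K) := by
  refine SchwartzDecomposition.of_classes id hK fun k => ?_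
  let e : Unit ≃ {i : ι // id i = k} :=
    ⟨fun _ => ⟨k, rfl⟩, fun _ => (), fun _ => rfl, fun x => Subtype.ext x.2.symm⟩
  exact SchwartzDecomposition.reindex e (h k)

/-! ### Linear changes of variables -/

/-- `(Aᵀ)⁻¹` for an invertible linear map `A`. -/
def invAdjoint (A : E3 ≃L[ℝ] E3) : E3 ≃L[ℝ] E3 :=
  ContinuousLinearEquiv.equivOfInverse
    (ContinuousLinearMap.adjoint (A.symm : E3 →L[ℝ] E3))
    (ContinuousLinearMap.adjoint (A : E3 →L[ℝ] E3))
    (fun x => by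
      rw [← ContinuousLinearMap.comp_apply, ← ContinuousLinearMap.adjoint_comp]
      simp [ContinuousLinearMap.adjoint_id])
    (fun x => by
      rw [← ContinuousLinearMap.comp_apply, ← ContinuousLinearMap.adjoint_comp]
      simp [ContinuousLinearMap.adjoint_id])

lemma inner_invAdjoint (A : E3 ≃L[ℝ] E3) (x ξ : E3) :
    inner ℝ (invAdjoint A x) (A ξ) = inner ℝ x ξ := by
  change inner ℝ ((ContinuousLinearMap.adjoint (A.symm : E3 →L[ℝ] E3)) x) (A ξ) = _
  rw [ContinuousLinearMap.adjoint_inner_left]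
  simp

lemma map_volume_linearEquiv (B : E3 ≃L[ℝ] E3) :
    ∃ c : ℝ, 0 < c ∧ (volume : Measure E3).map B = ENNReal.ofReal c • volume := by
  have hdet : LinearMap.det ((B : E3 ≃ₗ[ℝ] E3) : E3 →ₗ[ℝ] E3) ≠ 0 :=
    (LinearEquiv.isUnit_det' (B : E3 ≃ₗ[ℝ] E3)).ne_zero
  refine ⟨_, ?_, Measure.map_linearMap_addHaar_eq_smul_addHaar (volume : Measure E3) hdet⟩
  exact abs_pos.mpr (inv_ne_zero hdet)

/-- Composition of Schwartz functions with an invertible linear map. -/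
abbrev dil (B : E3 ≃L[ℝ] E3) : 𝓢(E3, ℂ) →L[ℂ] 𝓢(E3, ℂ) :=
  SchwartzMap.compCLMOfContinuousLinearEquiv ℂ B

lemma dil_apply (B : E3 ≃L[ℝ] E3) (f : 𝓢(E3, ℂ)) (x : E3) : dil B f x = f (B x) := rfl

lemma snorm_dil (B : E3 ≃L[ℝ] E3) : ∃ c : ℝ, 0 < c ∧ ∀ f : 𝓢(E3, ℂ),
    snorm p (dil B f) = c * snorm p f := by
  obtain ⟨c, hc, hmap⟩ := map_volume_linearEquiv B
  have hp0 : 0 < p := exponent_pos (p := p)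
  refine ⟨(ENNReal.ofReal c ^ (1 / p)).toReal, ?_, fun f => ?_⟩
  · rw [← ENNReal.toReal_rpow, ENNReal.toReal_ofReal hc.le]
    positivity
  · unfold snorm
    rw [SchwartzMap.norm_toLp, SchwartzMap.norm_toLp, ← ENNReal.toReal_mul]
    congr 1
    have h1 : eLpNorm f (ENNReal.ofReal p) ((volume : Measure E3).map B) =
        eLpNorm (f ∘ B) (ENNReal.ofReal p) volume :=
      eLpNorm_map_measure f.continuous.aestronglyMeasurable B.continuous.aemeasurable
    rw [hmap, eLpNorm_smul_measure_of_ne_top ENNReal.ofReal_ne_top] at h1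
    rw [ENNReal.toReal_div, ENNReal.toReal_one, ENNReal.toReal_ofReal hp0.le] at h1
    simpa using h1.symm

lemma fourier_dil (A : E3 ≃L[ℝ] E3) : ∃ c : ℂ, ∀ f : 𝓢(E3, ℂ), ∀ ξ : E3,
    (𝓕 (dil (invAdjoint A) f)) ξ = c * (𝓕 f) (A ξ) := by
  obtain ⟨c, hc, hmap⟩ := map_volume_linearEquiv (invAdjoint A)
  refine ⟨c, fun f ξ => ?_⟩
  rw [SchwartzMap.fourier_coe, SchwartzMap.fourier_coe, Real.fourier_eq, Real.fourier_eq]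
  have h1 : ∫ v : E3, Real.fourierChar (-inner ℝ v ξ) • (dil (invAdjoint A) f) v =
      ∫ v : E3, (fun w => Real.fourierChar (-inner ℝ w (A ξ)) • f w) (invAdjoint A v) := by
    refine integral_congr_ae (Eventually.of_forall fun v => ?_)
    simp only [dil_apply, inner_invAdjoint]
  rw [h1]
  have h2 := (invAdjoint A).toHomeomorph.measurableEmbedding.integral_map
    (μ := (volume : Measure E3)) (fun w => Real.fourierChar (-inner ℝ w (A ξ)) • f w)
  have h3 : ∀ v, (invAdjoint A).toHomeomorph v = invAdjoint A v := fun _ => rfl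
  have h4 : ((invAdjoint A).toHomeomorph : E3 → E3) = invAdjoint A := rfl
  rw [h4, hmap, integral_smul_measure, ENNReal.toReal_ofReal hc.le] at h2
  rw [← h2]
  simp

lemma mult_comp_dil (A : E3 ≃L[ℝ] E3) {φ : E3 → ℂ} (hφ : φ.HasTemperateGrowth)
    (h : 𝓢(E3, ℂ)) :
    mult (φ ∘ A) (dil (invAdjoint A) h) = dil (invAdjoint A) (mult φ h) := by
  obtain ⟨c, hc⟩ := fourier_dil A
  have hφA : (φ ∘ A).HasTemperateGrowth := hφ.comp A.hasTemperateGrowth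
  have h1 : 𝓕 (mult (φ ∘ A) (dil (invAdjoint A) h)) = 𝓕 (dil (invAdjoint A) (mult φ h)) := by
    ext ξ
    rw [hc, SchwartzMap.fourierMultiplierCLM_apply, SchwartzMap.fourierMultiplierCLM_apply,
      FourierTransform.fourier_fourierInv_eq, FourierTransform.fourier_fourierInv_eq,
      SchwartzMap.smulLeftCLM_apply_apply hφA, SchwartzMap.smulLeftCLM_apply_apply hφ, hc]
    simp only [Function.comp_apply, smul_eq_mul]
    ring
  have h2 := congrArg (fun g => 𝓕⁻ g) h1
  simpa using h2

/-- The decomposition inequality is invariant under linear changes of the frequency variable. -/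
theorem SchwartzDecomposition.comp_linear {ι : Type} [Fintype ι] {φ : ι → E3 → ℂ} {K : ℝ}
    (hφ : ∀ i, (φ i).HasTemperateGrowth) (A : E3 ≃L[ℝ] E3) (h : SchwartzDecomposition p φ K) :
    SchwartzDecomposition p (fun i => φ i ∘ A) K := by
  intro f
  have hp0 : 0 < p := exponent_pos (p := p)
  obtain ⟨c, hc, hcn⟩ := snorm_dil (p := p) (invAdjoint A)
  set g : ι → 𝓢(E3, ℂ) := fun i => dil (invAdjoint A).symm (f i) with hg
  have hfg : ∀ i, f i = dil (invAdjoint A) (g i) := by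
    intro i
    ext x
    simp [hg]
  have h1 : ∑ i, mult (φ i ∘ A) (f i) = dil (invAdjoint A) (∑ i, mult (φ i) (g i)) := by
    rw [map_sum]
    refine Finset.sum_congr rfl fun i _ => ?_
    rw [hfg i, mult_comp_dil A (hφ i)]
  have h2 : ∑ i, snorm p (f i) ^ p = c ^ p * ∑ i, snorm p (g i) ^ p := by
    rw [Finset.mul_sum]
    refine Finset.sum_congr rfl fun i _ => ?_
    rw [hfg i, hcn, Real.mul_rpow hc.le (snorm_nonneg _)]
  have h3 : 0 ≤ ∑ i, snorm p (g i) ^ p :=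
    Finset.sum_nonneg fun _ _ => Real.rpow_nonneg (snorm_nonneg _) _
  rw [h1, h2, hcn, Real.mul_rpow (Real.rpow_nonneg hc.le _) h3, ← Real.rpow_mul hc.le,
    mul_one_div_cancel hp0.ne', Real.rpow_one]
  calc c * snorm p (∑ i, mult (φ i) (g i))
      ≤ c * (K * (∑ i, snorm p (g i) ^ p) ^ (1 / p)) := mul_le_mul_of_nonneg_left (h g) hc.le
    _ = _ := by ring

end

section

/-! ### Matrices with bounded entries -/

/-- The linear map of Euclidean three-space with matrix `A`. -/
def mlin (A : Matrix (Fin 3) (Fin 3) ℝ) : E3 →L[ℝ] E3 := Matrix.toEuclideanCLM (𝕜 := ℝ) A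

lemma mlin_apply (A : Matrix (Fin 3) (Fin 3) ℝ) (x : E3) (i : Fin 3) :
    mlin A x i = A i 0 * x 0 + A i 1 * x 1 + A i 2 * x 2 := by
  have h : mlin A x i = (A.mulVec (WithLp.ofLp x)) i := rfl
  rw [h, Matrix.mulVec, dotProduct, Fin.sum_univ_three]

lemma mlin_mul (A B : Matrix (Fin 3) (Fin 3) ℝ) (x : E3) :
    mlin (A * B) x = mlin A (mlin B x) := by
  simp [mlin]

lemma mlin_one (x : E3) : mlin 1 x = x := by
  simp [mlin]

lemma mlin_inv_mlin {A : Matrix (Fin 3) (Fin 3) ℝ} (hA : A.det ≠ 0) (x : E3) :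
    mlin A⁻¹ (mlin A x) = x := by
  rw [← mlin_mul, Matrix.nonsing_inv_mul _ hA.isUnit, mlin_one]

lemma mlin_mlin_inv {A : Matrix (Fin 3) (Fin 3) ℝ} (hA : A.det ≠ 0) (x : E3) :
    mlin A (mlin A⁻¹ x) = x := by
  rw [← mlin_mul, Matrix.mul_nonsing_inv _ hA.isUnit, mlin_one]

/-- The linear automorphism of Euclidean three-space given by an invertible matrix. -/
def mequiv (A : Matrix (Fin 3) (Fin 3) ℝ) (hA : A.det ≠ 0) : E3 ≃L[ℝ] E3 :=
  ContinuousLinearEquiv.equivOfInverse (mlin A) (mlin A⁻¹) (mlin_inv_mlin hA) (mlin_mlin_inv hA)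

lemma mequiv_apply {A : Matrix (Fin 3) (Fin 3) ℝ} (hA : A.det ≠ 0) (x : E3) :
    mequiv A hA x = mlin A x := rfl

/-- All entries of the matrix `A` are at most `C` in absolute value. -/
def EntryBound (A : Matrix (Fin 3) (Fin 3) ℝ) (C : ℝ) : Prop := ∀ i j, |A i j| ≤ C

lemma EntryBound.nonneg {A : Matrix (Fin 3) (Fin 3) ℝ} {C : ℝ} (h : EntryBound A C) : 0 ≤ C :=
  (abs_nonneg _).trans (h 0 0)

lemma EntryBound.mono {A : Matrix (Fin 3) (Fin 3) ℝ} {C C' : ℝ} (h : EntryBound A C)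
    (hC : C ≤ C') : EntryBound A C' := fun i j => (h i j).trans hC

lemma EntryBound.mul {A B : Matrix (Fin 3) (Fin 3) ℝ} {C D : ℝ} (hA : EntryBound A C)
    (hB : EntryBound B D) : EntryBound (A * B) (3 * C * D) := by
  intro i j
  rw [Matrix.mul_apply]
  refine (Finset.abs_sum_le_sum_abs _ _).trans ?_
  have : ∀ k ∈ Finset.univ, |A i k * B k j| ≤ C * D := fun k _ => by
    rw [abs_mul]
    exact mul_le_mul (hA i k) (hB k j) (abs_nonneg _) hA.nonneg
  refine (Finset.sum_le_sum this).trans ?_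
  simp [mul_assoc]

lemma abs_coord_le_norm (x : E3) (i : Fin 3) : |x i| ≤ ‖x‖ := PiLp.norm_apply_le x i

lemma norm_le_of_coord {x : E3} {C : ℝ} (h : ∀ i, |x i| ≤ C) : ‖x‖ ≤ 2 * C := by
  have hC : 0 ≤ C := (abs_nonneg _).trans (h 0)
  rw [EuclideanSpace.norm_eq, Fin.sum_univ_three]
  apply Real.sqrt_le_iff.mpr ⟨by positivity, ?_⟩
  have h0 : ∀ i, ‖x i‖ ^ 2 ≤ C ^ 2 := fun i =>
    pow_le_pow_left₀ (norm_nonneg _) (h i) 2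
  nlinarith [h0 0, h0 1, h0 2]

lemma EntryBound.norm_mlin_le {A : Matrix (Fin 3) (Fin 3) ℝ} {C : ℝ} (hA : EntryBound A C)
    (x : E3) : ‖mlin A x‖ ≤ 6 * C * ‖x‖ := by
  have hC := hA.nonneg
  have : ∀ i, |mlin A x i| ≤ 3 * C * ‖x‖ := by
    intro i
    rw [mlin_apply]
    have h : ∀ j, |A i j * x j| ≤ C * ‖x‖ := fun j => by
      rw [abs_mul]
      exact mul_le_mul (hA i j) (abs_coord_le_norm x j) (abs_nonneg _) hC
    refine (abs_add_three _ _ _).trans ?_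
    linarith [h 0, h 1, h 2]
  exact (norm_le_of_coord this).trans_eq (by ring)

lemma EntryBound.opNorm_le {A : Matrix (Fin 3) (Fin 3) ℝ} {C : ℝ} (hA : EntryBound A C) :
    ‖mlin A‖ ≤ 6 * C :=
  ContinuousLinearMap.opNorm_le_bound _ (by linarith [hA.nonneg]) hA.norm_mlin_le

/-- Cramer's rule bounds the inverse of a matrix by its entries and its determinant. -/
lemma EntryBound.inv {A : Matrix (Fin 3) (Fin 3) ℝ} {C c : ℝ} (hA : EntryBound A C) (hc : 0 < c)
    (hdet : c ≤ |A.det|) : EntryBound A⁻¹ (2 * C ^ 2 / c) := by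
  have hC := hA.nonneg
  have h2 : ∀ i j k l : Fin 3 × Fin 3, |A i.1 i.2 * A j.1 j.2| ≤ C ^ 2 := fun i j _ _ => by
    rw [abs_mul, sq]
    exact mul_le_mul (hA _ _) (hA _ _) (abs_nonneg _) hC
  have h1 : ∀ a b c' d e f g h : Fin 3, |A a b * A c' d - A e f * A g h| ≤ 2 * C ^ 2 := by
    intro a b c' d e f g h
    refine (abs_sub _ _).trans ?_
    have := h2 (a, b) (c', d) 0 0
    have := h2 (e, f) (g, h) 0 0
    simp only at *
    linarith
  have h3 : ∀ a b c' d e f g h : Fin 3, |-(A a b * A c' d) + A e f * A g h| ≤ 2 * C ^ 2 := by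
    intro a b c' d e f g h
    rw [neg_add_eq_sub]
    exact h1 _ _ _ _ _ _ _ _
  have hadj : EntryBound A.adjugate (2 * C ^ 2) := by
    intro i j
    rw [Matrix.adjugate_fin_three]
    fin_cases i <;> fin_cases j <;> simp [h1, h3]
  intro i j
  rw [Matrix.inv_def, Matrix.smul_apply, smul_eq_mul, Ring.inverse_eq_inv', abs_mul, abs_inv,
    div_eq_inv_mul]
  exact mul_le_mul (inv_anti₀ hc hdet) (hadj i j) (abs_nonneg _) (by positivity)

/-- The matrix with the given columns. -/
def cols (a b c : E3) : Matrix (Fin 3) (Fin 3) ℝ :=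
  !![a 0, b 0, c 0; a 1, b 1, c 1; a 2, b 2, c 2]

/-- The parabolic dilation `diag(1, r, r²)`. -/
def pdil (r : ℝ) : Matrix (Fin 3) (Fin 3) ℝ := Matrix.diagonal ![1, r, r ^ 2]

lemma det_pdil (r : ℝ) : (pdil r).det = r ^ 3 := by
  simp [pdil, Matrix.det_diagonal, Fin.prod_univ_three]; ring

lemma pdil_mul (r s : ℝ) : pdil r * pdil s = pdil (r * s) := by
  simp only [pdil, Matrix.diagonal_mul_diagonal]
  congr 1
  funext i
  fin_cases i <;> simp [mul_pow]

lemma pdil_one : pdil 1 = 1 := by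
  simp only [pdil]
  rw [← Matrix.diagonal_one]
  congr 1
  funext i
  fin_cases i <;> simp

/-! ### Iterated directional derivatives -/

/-- Successive directional derivatives in the directions of a list. -/
def dirs (l : List E3) (φ : E3 → ℂ) : E3 → ℂ := l.foldr dirDeriv φ

lemma dirs_nil (φ : E3 → ℂ) : dirs [] φ = φ := rfl

lemma dirs_cons (u : E3) (l : List E3) (φ : E3 → ℂ) :
    dirs (u :: l) φ = dirDeriv u (dirs l φ) := rfl

lemma dirs_append (l l' : List E3) (φ : E3 → ℂ) : dirs (l ++ l') φ = dirs l (dirs l' φ) := by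
  simp [dirs]

lemma dirs_replicate (n : ℕ) (u : E3) (φ : E3 → ℂ) :
    dirs (List.replicate n u) φ = (dirDeriv u)^[n] φ := by
  induction n with
  | zero => rfl
  | succ n ih => rw [List.replicate_succ, dirs_cons, ih, Function.iterate_succ_apply']

lemma contDiff_dirDeriv {φ : E3 → ℂ} (hφ : ContDiff ℝ ∞ φ) (u : E3) :
    ContDiff ℝ ∞ (dirDeriv u φ) :=
  (hφ.fderiv_right (m := ∞) (by simp)).clm_apply contDiff_const

lemma contDiff_dirs {φ : E3 → ℂ} (hφ : ContDiff ℝ ∞ φ) (l : List E3) :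
    ContDiff ℝ ∞ (dirs l φ) := by
  induction l with
  | nil => exact hφ
  | cons u l ih => exact contDiff_dirDeriv ih u

lemma dirDeriv_comm {φ : E3 → ℂ} (hφ : ContDiff ℝ ∞ φ) (u v : E3) :
    dirDeriv u (dirDeriv v φ) = dirDeriv v (dirDeriv u φ) := by
  funext x
  have hd : DifferentiableAt ℝ (fderiv ℝ φ) x :=
    (hφ.fderiv_right (m := ∞) (by simp)).differentiable (by simp) x
  have h : ∀ a b : E3, dirDeriv a (dirDeriv b φ) x = fderiv ℝ (fderiv ℝ φ) x a b := by
    intro a b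
    have h1 := hd.hasFDerivAt.clm_apply (hasFDerivAt_const b x)
    change fderiv ℝ (fun y => fderiv ℝ φ y b) x a = _
    rw [h1.fderiv]
    simp
  rw [h, h]
  have h2 : ContDiffAt ℝ 2 φ x := (contDiff_infty.mp hφ 2).contDiffAt
  exact (h2.isSymmSndFDerivAt (by simp)).eq u v

lemma dirs_perm {φ : E3 → ℂ} (hφ : ContDiff ℝ ∞ φ) {l l' : List E3} (h : l.Perm l') :
    dirs l φ = dirs l' φ := by
  induction h with
  | nil => rfl
  | cons u _ ih => rw [dirs_cons, dirs_cons, ih]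
  | swap u v l =>
    rw [dirs_cons, dirs_cons, dirs_cons, dirs_cons]
    exact dirDeriv_comm (contDiff_dirs hφ l) v u
  | trans _ _ ih₁ ih₂ => exact ih₁.trans ih₂

lemma dirs_ofFn {φ : E3 → ℂ} (hφ : ContDiff ℝ ∞ φ) {k : ℕ} (v : Fin k → E3) (x : E3) :
    dirs (List.ofFn v) φ x = iteratedFDeriv ℝ k φ x v := by
  induction k generalizing x with
  | zero => simp [dirs_nil]
  | succ k ih =>
    rw [List.ofFn_succ, dirs_cons, dirDeriv, funext (ih fun i => v i.succ)]
    have hd : DifferentiableAt ℝ (iteratedFDeriv ℝ k φ) x :=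
      (hφ.differentiable_iteratedFDeriv (m := k) (by exact_mod_cast WithTop.coe_lt_top _)) x
    have h1 := hd.hasFDerivAt.continuousMultilinear_apply_const fun i : Fin k => v i.succ
    rw [h1.fderiv]
    exact (iteratedFDeriv_succ_apply_left (n := k) (f := φ) (x := x) v).symm

lemma norm_dirs_le {φ : E3 → ℂ} (hφ : ContDiff ℝ ∞ φ) {l : List E3} (hl : ∀ u ∈ l, ‖u‖ ≤ 1)
    (x : E3) : ‖dirs l φ x‖ ≤ ‖iteratedFDeriv ℝ l.length φ x‖ := by
  have h := dirs_ofFn hφ l.get x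
  rw [List.ofFn_get] at h
  rw [h]
  refine (ContinuousMultilinearMap.le_opNorm _ _).trans ?_
  refine mul_le_of_le_one_right (norm_nonneg _) (Finset.prod_le_one (fun _ _ => norm_nonneg _) ?_)
  exact fun i _ => hl _ (List.get_mem _ _)

/-- The standard basis of Euclidean three-space. -/
def stdVec (i : Fin 3) : E3 := EuclideanSpace.single i 1

lemma norm_stdVec (i : Fin 3) : ‖stdVec i‖ = 1 := by simp [stdVec]

lemma sum_stdVec (x : E3) : ∑ i, x i • stdVec i = x := by
  ext j
  fin_cases j <;> simp [stdVec, Fin.sum_univ_three]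

/-- Bounds for the sorted iterated derivatives along the standard basis bound all derivatives. -/
lemma norm_iteratedFDeriv_le_of_dirs {φ : E3 → ℂ} (hφ : ContDiff ℝ ∞ φ) {C : ℝ} {k : ℕ} {x : E3}
    (h : ∀ n₀ n₁ n₂ : ℕ, n₀ + n₁ + n₂ = k → ‖dirs (List.replicate n₀ (stdVec 0) ++
      (List.replicate n₁ (stdVec 1) ++ List.replicate n₂ (stdVec 2))) φ x‖ ≤ C) :
    ‖iteratedFDeriv ℝ k φ x‖ ≤ 3 ^ k * C := by
  have hC : 0 ≤ C := (norm_nonneg _).trans (h k 0 0 (by simp))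
  have hw : ∀ w : Fin k → Fin 3, ‖iteratedFDeriv ℝ k φ x fun i => stdVec (w i)‖ ≤ C := by
    intro w
    set L := List.ofFn w with hL
    have hlen : L.length = k := by simp [hL]
    have hperm : L.Perm (List.replicate (L.count 0) 0 ++
        (List.replicate (L.count 1) 1 ++ List.replicate (L.count 2) 2)) := by
      rw [List.perm_iff_count]
      intro a
      fin_cases a <;> simp [List.count_replicate]
    have hsum : L.count 0 + L.count 1 + L.count 2 = k := by
      have := hperm.length_eq
      simp only [List.length_append, List.length_replicate] at this
      omega
    have h1 := h _ _ _ hsum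
    have h2 := hperm.map stdVec
    simp only [List.map_append, List.map_replicate] at h2
    rw [← dirs_perm hφ h2] at h1
    have h3 : L.map stdVec = List.ofFn fun i => stdVec (w i) := by
      simp [hL, List.map_ofFn, Function.comp_def]
    rwa [h3, dirs_ofFn hφ] at h1
  refine ContinuousMultilinearMap.opNorm_le_bound (by positivity) fun m => ?_
  have hm : m = fun i => ∑ j, m i j • stdVec j := by
    funext i
    exact (sum_stdVec (m i)).symm
  have h1 : iteratedFDeriv ℝ k φ x m = ∑ w : Fin k → Fin 3,
      (∏ i, m i (w i)) • iteratedFDeriv ℝ k φ x fun i => stdVec (w i) := by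
    conv_lhs => rw [hm]
    rw [ContinuousMultilinearMap.map_sum]
    exact Finset.sum_congr rfl fun w _ => ContinuousMultilinearMap.map_smul_univ _ _ _
  rw [h1]
  refine (norm_sum_le _ _).trans ?_
  have h2 : ∀ w ∈ (Finset.univ : Finset (Fin k → Fin 3)),
      ‖(∏ i, m i (w i)) • iteratedFDeriv ℝ k φ x fun i => stdVec (w i)‖ ≤
      C * ∏ i, ‖m i‖ := by
    intro w _
    rw [norm_smul, mul_comm, norm_prod]
    refine mul_le_mul (hw w) ?_ (Finset.prod_nonneg fun _ _ => norm_nonneg _) hC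
    exact Finset.prod_le_prod (fun _ _ => norm_nonneg _) fun i _ => abs_coord_le_norm _ _
  refine (Finset.sum_le_sum h2).trans ?_
  simp [mul_assoc]

lemma dirDeriv_smul (c : ℝ) (u : E3) {φ : E3 → ℂ} (hφ : ContDiff ℝ ∞ φ) (a : ℝ) :
    dirDeriv (c • u) (a • φ) = (c * a) • dirDeriv u φ := by
  funext x
  have : DifferentiableAt ℝ φ x := hφ.differentiable (by simp) x
  simp only [dirDeriv, Pi.smul_apply]
  rw [fderiv_const_smul this]
  simp [mul_smul]

lemma iterate_dirDeriv_smul (c : ℝ) (u : E3) {φ : E3 → ℂ} (hφ : ContDiff ℝ ∞ φ) (a : ℝ) (n : ℕ) :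
    (dirDeriv (c • u))^[n] (a • φ) = (c ^ n * a) • (dirDeriv u)^[n] φ := by
  induction n with
  | zero => simp
  | succ n ih =>
    rw [Function.iterate_succ_apply', Function.iterate_succ_apply', ih, ← dirs_replicate,
      dirDeriv_smul _ _ (contDiff_dirs hφ _)]
    congr 1
    ring

/-- The mixed directional derivatives that occur in the definition of an admissible bump function. -/
abbrev mixedDeriv (u v w : E3) (n₁ n₂ n₃ : ℕ) (φ : E3 → ℂ) : E3 → ℂ :=
  (dirDeriv u)^[n₁] ((dirDeriv v)^[n₂] ((dirDeriv w)^[n₃] φ))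

lemma mixedDeriv_eq_dirs (u v w : E3) (n₁ n₂ n₃ : ℕ) (φ : E3 → ℂ) :
    mixedDeriv u v w n₁ n₂ n₃ φ =
      dirs (List.replicate n₁ u ++ (List.replicate n₂ v ++ List.replicate n₃ w)) φ := by
  simp only [dirs_append, dirs_replicate]

lemma mixedDeriv_smul (a b c : ℝ) (u v w : E3) (n₁ n₂ n₃ : ℕ) {φ : E3 → ℂ}
    (hφ : ContDiff ℝ ∞ φ) :
    mixedDeriv (a • u) (b • v) (c • w) n₁ n₂ n₃ φ =
      (a ^ n₁ * (b ^ n₂ * c ^ n₃)) • mixedDeriv u v w n₁ n₂ n₃ φ := by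
  have h := iterate_dirDeriv_smul c w hφ 1 n₃
  rw [one_smul, mul_one] at h
  have h₂ : ContDiff ℝ ∞ ((dirDeriv w)^[n₃] φ) := by
    rw [← dirs_replicate]
    exact contDiff_dirs hφ _
  have h₁ : ContDiff ℝ ∞ ((dirDeriv v)^[n₂] ((dirDeriv w)^[n₃] φ)) := by
    rw [← dirs_replicate n₂]
    exact contDiff_dirs h₂ _
  simp only [mixedDeriv]
  rw [h, iterate_dirDeriv_smul b v h₂, iterate_dirDeriv_smul a u h₁]

lemma dirs_comp_mlin {φ : E3 → ℂ} (hφ : ContDiff ℝ ∞ φ) (F : Matrix (Fin 3) (Fin 3) ℝ)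
    (l : List E3) (x : E3) : dirs l (φ ∘ mlin F) x = dirs (l.map (mlin F)) φ (mlin F x) := by
  induction l generalizing x with
  | nil => rfl
  | cons u l ih =>
    rw [dirs_cons, List.map_cons, dirs_cons, dirDeriv, dirDeriv]
    have h1 : dirs l (φ ∘ mlin F) = dirs (l.map (mlin F)) φ ∘ mlin F := funext ih
    have hd : DifferentiableAt ℝ (dirs (l.map (mlin F)) φ) (mlin F x) :=
      (contDiff_dirs hφ _).differentiable (by simp) _
    rw [h1, fderiv_comp x hd (mlin F).differentiableAt, (mlin F).fderiv]
    rfl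

/-! ### Derivative bounds in a frame -/

/-- `φ` is smooth, and its derivatives of order at most four are bounded by `C` in the linear
coordinates given by the frame (matrix) `F`. -/
structure DerivBound (F : Matrix (Fin 3) (Fin 3) ℝ) (C : ℝ) (φ : E3 → ℂ) : Prop where
  smooth : ContDiff ℝ ∞ φ
  bound : ∀ k ≤ 4, ∀ x, ‖iteratedFDeriv ℝ k (φ ∘ mlin F) x‖ ≤ C

variable {F : Matrix (Fin 3) (Fin 3) ℝ} {C : ℝ} {φ : E3 → ℂ}

lemma DerivBound.nonneg (h : DerivBound F C φ) : 0 ≤ C :=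
  (norm_nonneg _).trans (h.bound 0 (by simp) 0)

lemma DerivBound.mul_right (h : DerivBound F C φ) {N : Matrix (Fin 3) (Fin 3) ℝ} {D : ℝ}
    (hN : EntryBound N D) (hD : 1 ≤ D) : DerivBound (F * N) (C * (6 * D) ^ 4) φ := by
  refine ⟨h.smooth, fun k hk x => ?_⟩
  have h1 : φ ∘ mlin (F * N) = (φ ∘ mlin F) ∘ mlin N := by
    funext y
    simp [mlin_mul]
  rw [h1, ContinuousLinearMap.iteratedFDeriv_comp_right (n := ∞) (mlin N)
    (h.smooth.comp (mlin F).contDiff) x (by exact_mod_cast le_top)]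
  refine (ContinuousMultilinearMap.norm_compContinuousLinearMap_le _ _).trans ?_
  refine mul_le_mul (h.bound k hk _) ?_ (Finset.prod_nonneg fun _ _ => norm_nonneg _) h.nonneg
  rw [Finset.prod_const, Finset.card_univ, Fintype.card_fin]
  exact (pow_le_pow_left₀ (norm_nonneg _) hN.opNorm_le k).trans
    (pow_le_pow_right₀ (by linarith) hk)

lemma DerivBound.comp_mlin {B : Matrix (Fin 3) (Fin 3) ℝ} (h : DerivBound (B * F) C φ) :
    DerivBound F C (φ ∘ mlin B) := by
  refine ⟨h.smooth.comp (mlin B).contDiff, fun k hk x => ?_⟩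
  have h1 : (φ ∘ mlin B) ∘ mlin F = φ ∘ mlin (B * F) := by
    funext y
    simp [mlin_mul]
  rw [h1]
  exact h.bound k hk x

lemma DerivBound.const_smul (h : DerivBound F C φ) (c : ℂ) :
    DerivBound F (‖c‖ * C) (c • φ) := by
  refine ⟨contDiff_const.smul h.smooth, fun k hk x => ?_⟩
  have h1 : (c • φ) ∘ mlin F = c • (φ ∘ mlin F) := rfl
  have h2 : ContDiff ℝ k (φ ∘ mlin F) :=
    (h.smooth.comp (mlin F).contDiff).of_le (by exact_mod_cast le_top)
  rw [h1, iteratedFDeriv_const_smul_apply h2.contDiffAt, norm_smul]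
  exact mul_le_mul_of_nonneg_left (h.bound k hk x) (norm_nonneg _)

/-- Multiplication by a fixed smooth function of the frame coordinates. -/
lemma DerivBound.cutoff (h : DerivBound F C φ) (hF : F.det ≠ 0) {χ : E3 → ℂ} {D : ℝ} (hχ : DerivBound 1 D χ) :
    DerivBound F (16 * C * D) (fun ξ => χ (mlin F⁻¹ ξ) * φ ξ) := by
  refine ⟨(hχ.smooth.comp (mlin F⁻¹).contDiff).mul h.smooth, fun k hk x => ?_⟩
  have h1 : (fun ξ => χ (mlin F⁻¹ ξ) * φ ξ) ∘ mlin F = fun x => χ x * (φ ∘ mlin F) x := by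
    funext y
    simp [mlin_inv_mlin hF]
  have h2 : χ ∘ mlin 1 = χ := by
    funext y
    simp [mlin_one]
  rw [h1]
  refine (norm_iteratedFDeriv_mul_le (N := ∞) hχ.smooth (h.smooth.comp (mlin F).contDiff) x
    (by exact_mod_cast le_top)).trans ?_
  have h3 : ∀ i ∈ Finset.range (k + 1), (k.choose i : ℝ) * ‖iteratedFDeriv ℝ i χ x‖ *
      ‖iteratedFDeriv ℝ (k - i) (φ ∘ mlin F) x‖ ≤ k.choose i * (D * C) := by
    intro i hi
    have hi' : i ≤ 4 := by
      have := Finset.mem_range.mp hi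
      omega
    have h4 := hχ.bound i hi' x
    rw [h2] at h4
    rw [mul_assoc]
    refine mul_le_mul_of_nonneg_left ?_ (by positivity)
    exact mul_le_mul h4 (h.bound _ (by omega) x) (norm_nonneg _) hχ.nonneg
  refine (Finset.sum_le_sum h3).trans ?_
  rw [← Finset.sum_mul]
  have h5 : (∑ i ∈ Finset.range (k + 1), (k.choose i : ℝ)) = 2 ^ k := by
    exact_mod_cast Nat.sum_range_choose k
  rw [h5]
  have h6 : (2 : ℝ) ^ k ≤ 2 ^ 4 := pow_le_pow_right₀ (by norm_num) hk
  nlinarith [mul_nonneg hχ.nonneg h.nonneg]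

lemma exists_derivBound {χ : E3 → ℂ} (hχ : ContDiff ℝ ∞ χ) (hc : HasCompactSupport χ) :
    ∃ D, DerivBound 1 D χ := by
  have h2 : χ ∘ mlin 1 = χ := by
    funext y
    simp [mlin_one]
  have h : ∀ k : ℕ, ∃ D, ∀ x, ‖iteratedFDeriv ℝ k χ x‖ ≤ D := fun k =>
    (hχ.continuous_iteratedFDeriv (m := k) (by exact_mod_cast le_top)).bounded_above_of_compact_support
      (hc.iteratedFDeriv k)
  choose D hD using h
  refine ⟨∑ k ∈ Finset.range 5, |D k|, hχ, fun k hk x => ?_⟩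
  rw [h2]
  refine ((hD k x).trans (le_abs_self _)).trans ?_
  exact Finset.single_le_sum (f := fun k => |D k|) (fun _ _ => abs_nonneg _)
    (Finset.mem_range.mpr (by omega))

lemma mlin_cols_stdVec (a b c : E3) :
    mlin (cols a b c) (stdVec 0) = a ∧ mlin (cols a b c) (stdVec 1) = b ∧
      mlin (cols a b c) (stdVec 2) = c := by
  refine ⟨?_, ?_, ?_⟩ <;> ext i <;> rw [mlin_apply] <;> fin_cases i <;> simp [cols, stdVec]

lemma DerivBound.of_mixedDeriv (hφ : ContDiff ℝ ∞ φ) {a b c : ℝ} (ha : 0 < a) (hb : 0 < b)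
    (hc : 0 < c) {u v w : E3} (h : ∀ n₁ n₂ n₃ : ℕ, n₁ + n₂ + n₃ ≤ 4 → ∀ ξ,
      ‖mixedDeriv u v w n₁ n₂ n₃ φ ξ‖ ≤ (a ^ n₁ * (b ^ n₂ * c ^ n₃))⁻¹) :
    DerivBound (cols (a • u) (b • v) (c • w)) 81 φ := by
  refine ⟨hφ, fun k hk x => ?_⟩
  have h1 := norm_iteratedFDeriv_le_of_dirs (C := 1) (k := k) (x := x)
    (hφ.comp (mlin (cols (a • u) (b • v) (c • w))).contDiff) (fun n₁ n₂ n₃ hn => by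
      obtain ⟨e0, e1, e2⟩ := mlin_cols_stdVec (a • u) (b • v) (c • w)
      rw [dirs_comp_mlin hφ]
      simp only [List.map_append, List.map_replicate, e0, e1, e2]
      rw [← mixedDeriv_eq_dirs, mixedDeriv_smul _ _ _ _ _ _ _ _ _ hφ, Pi.smul_apply, norm_smul,
        Real.norm_of_nonneg (by positivity)]
      have := h n₁ n₂ n₃ (by omega) (mlin (cols (a • u) (b • v) (c • w)) x)
      have hpos : 0 < a ^ n₁ * (b ^ n₂ * c ^ n₃) := by positivity
      calc _ ≤ (a ^ n₁ * (b ^ n₂ * c ^ n₃)) * (a ^ n₁ * (b ^ n₂ * c ^ n₃))⁻¹ :=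
            mul_le_mul_of_nonneg_left this hpos.le
        _ = 1 := mul_inv_cancel₀ hpos.ne')
  refine h1.trans ?_
  rw [mul_one]
  calc (3 : ℝ) ^ k ≤ 3 ^ 4 := pow_le_pow_right₀ (by norm_num) hk
    _ = 81 := by norm_num

lemma DerivBound.mixedDeriv_le {a b c : ℝ} (ha : 0 < a) (hb : 0 < b) (hc : 0 < c) {u v w : E3}
    (h : DerivBound (cols (a • u) (b • v) (c • w)) C φ)
    (hdet : (cols (a • u) (b • v) (c • w)).det ≠ 0) {n₁ n₂ n₃ : ℕ} (hn : n₁ + n₂ + n₃ ≤ 4)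
    (ξ : E3) : ‖mixedDeriv u v w n₁ n₂ n₃ φ ξ‖ ≤ C * (a ^ n₁ * (b ^ n₂ * c ^ n₃))⁻¹ := by
  set M := cols (a • u) (b • v) (c • w) with hM
  obtain ⟨e0, e1, e2⟩ := mlin_cols_stdVec (a • u) (b • v) (c • w)
  rw [← hM] at e0 e1 e2
  set l := List.replicate n₁ (stdVec 0) ++
      (List.replicate n₂ (stdVec 1) ++ List.replicate n₃ (stdVec 2)) with hl
  have h1 : ‖dirs l (φ ∘ mlin M) (mlin M⁻¹ ξ)‖ ≤ C := by
    refine (norm_dirs_le (h.smooth.comp (mlin M).contDiff) ?_ _).trans (h.bound _ ?_ _)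
    · intro y hy
      simp only [hl, List.mem_append, List.mem_replicate] at hy
      rcases hy with ⟨_, rfl⟩ | ⟨_, rfl⟩ | ⟨_, rfl⟩ <;> simp [norm_stdVec]
    · simp only [hl, List.length_append, List.length_replicate]
      omega
  rw [dirs_comp_mlin h.smooth, mlin_mlin_inv hdet] at h1
  simp only [hl, List.map_append, List.map_replicate, e0, e1, e2] at h1
  have hpos : 0 < a ^ n₁ * (b ^ n₂ * c ^ n₃) := by positivity
  rw [← mixedDeriv_eq_dirs, mixedDeriv_smul _ _ _ _ _ _ _ _ _ h.smooth, Pi.smul_apply, norm_smul,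
    Real.norm_of_nonneg hpos.le] at h1
  rw [← div_eq_mul_inv, le_div_iff₀ hpos]
  linarith

end

section

/-! ### Smooth cutoff functions -/

open scoped Manifold in
lemma exists_cutoff {K U : Set E3} (hK : IsClosed K) (hU : IsOpen U) (hKU : K ⊆ U) {ρ : ℝ}
    (hρ : ∀ x ∈ U, ‖x‖ ≤ ρ) : ∃ χ : E3 → ℂ, ContDiff ℝ ∞ χ ∧ HasCompactSupport χ ∧
      (∀ x ∈ K, χ x = 1) ∧ ∀ x, χ x ≠ 0 → x ∈ U := by
  obtain ⟨f, hf0, hf1, -⟩ := exists_contMDiffMap_zero_one_of_isClosed (n := ⊤) 𝓘(ℝ, E3)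
    hU.isClosed_compl hK (Set.disjoint_left.mpr fun x hx hxK => hx (hKU hxK))
  have hsupp : ∀ x, ((f x : ℝ) : ℂ) ≠ 0 → x ∈ U := by
    intro x hx
    by_contra hxU
    exact hx (by rw [hf0 hxU]; simp)
  refine ⟨fun x => (f x : ℂ), ?_, ?_, fun x hx => ?_, hsupp⟩
  · exact Complex.ofRealCLM.contDiff.comp f.contMDiff.contDiff
  · refine HasCompactSupport.intro (isCompact_closedBall (0 : E3) ρ) fun x hx => ?_
    by_contra h
    exact hx (by simpa using hρ x (hsupp x h))
  · simp [hf1 hx]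

/-- The smooth step in `|t|` that vanishes for `|t| ≤ 2 ^ j` and equals one for
`|t| ≥ 2 ^ (j + 1)`. -/
def dyadicStep (j : ℕ) (t : ℝ) : ℝ := Real.smoothTransition ((t ^ 2 / 4 ^ j - 1) / 3)

lemma contDiff_dyadicStep (j : ℕ) : ContDiff ℝ ∞ (dyadicStep j) := by
  have h : ContDiff ℝ ∞ fun t : ℝ => (t ^ 2 / 4 ^ j - 1) / 3 := by fun_prop
  exact Real.smoothTransition.contDiff.comp h

lemma two_pow_sq (j : ℕ) : ((2 : ℝ) ^ j) ^ 2 = 4 ^ j := by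
  rw [← pow_mul, mul_comm, pow_mul]; norm_num

lemma dyadicStep_eq_zero {j : ℕ} {t : ℝ} (h : |t| ≤ 2 ^ j) : dyadicStep j t = 0 := by
  apply Real.smoothTransition.zero_of_nonpos
  have h1 : t ^ 2 ≤ 4 ^ j := by
    rw [← two_pow_sq, ← sq_abs]
    exact pow_le_pow_left₀ (abs_nonneg _) h 2
  have h2 : t ^ 2 / 4 ^ j ≤ 1 := by
    rw [div_le_one (by positivity)]
    exact h1
  linarith

lemma dyadicStep_eq_one {j : ℕ} {t : ℝ} (h : 2 ^ (j + 1) ≤ |t|) : dyadicStep j t = 1 := by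
  apply Real.smoothTransition.one_of_one_le
  have h1 : 4 * 4 ^ j ≤ t ^ 2 := by
    rw [← pow_succ', ← two_pow_sq, ← sq_abs t]
    exact pow_le_pow_left₀ (by positivity) h 2
  have h2 : 4 ≤ t ^ 2 / 4 ^ j := by
    rw [le_div_iff₀ (by positivity)]
    exact h1
  linarith

/-! ### Supports in frame coordinates -/

/-- In the coordinates of the frame `F` the function `φ` vanishes outside `S`. -/
def SuppIn (F : Matrix (Fin 3) (Fin 3) ℝ) (S : Set E3) (φ : E3 → ℂ) : Prop :=
  ∀ x, φ (mlin F x) ≠ 0 → x ∈ S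

/-- The points of norm at most `R` whose first coordinate is at least `R⁻¹` in absolute value. -/
def shell (R : ℝ) : Set E3 := {x | ‖x‖ ≤ R ∧ R⁻¹ ≤ |x 0|}

/-- A region that is contained, in the frame coordinates of a circular plate, in a union of
boundedly many plates; the constant `1 / 80` accounts for the factor `8 π²` in
`inner_circleFrame`. -/
def flatBox (R : ℝ) : Set E3 := {x | 1 ≤ |x 0| ∧ |x 0| ≤ R ∧ |x 1| ≤ 1 / 80 ∧ |x 2| ≤ 1 / 80}

lemma norm_le_of_mem_flatBox {R : ℝ} {x : E3} (hx : x ∈ flatBox R) : ‖x‖ ≤ 2 * R := by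
  obtain ⟨h0, h1, h2, h3⟩ := hx
  refine norm_le_of_coord fun i => ?_
  fin_cases i
  · exact h1
  · exact h2.trans (by linarith)
  · exact h3.trans (by linarith)

lemma SuppIn.hasCompactSupport {F : Matrix (Fin 3) (Fin 3) ℝ} (hF : F.det ≠ 0) {S : Set E3}
    {φ : E3 → ℂ} (h : SuppIn F S φ) {ρ : ℝ} (hS : ∀ x ∈ S, ‖x‖ ≤ ρ) : HasCompactSupport φ := by
  refine HasCompactSupport.intro
    ((isCompact_closedBall (0 : E3) ρ).image (mlin F).continuous) fun ξ hξ => ?_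
  by_contra hne
  refine hξ ⟨mlin F⁻¹ ξ, ?_, mlin_mlin_inv hF ξ⟩
  rw [← mlin_mlin_inv hF ξ] at hne
  simpa using hS _ (h _ hne)

lemma DerivBound.hasTemperateGrowth {F : Matrix (Fin 3) (Fin 3) ℝ} (hF : F.det ≠ 0) {S : Set E3}
    {φ : E3 → ℂ} {C : ℝ} (hφ : DerivBound F C φ) (h : SuppIn F S φ) {ρ : ℝ}
    (hS : ∀ x ∈ S, ‖x‖ ≤ ρ) : φ.HasTemperateGrowth :=
  (h.hasCompactSupport hF hS).hasTemperateGrowth hφ.smooth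

lemma SuppIn.comp_mlin {B F : Matrix (Fin 3) (Fin 3) ℝ} {S : Set E3} {φ : E3 → ℂ}
    (h : SuppIn (B * F) S φ) : SuppIn F S (φ ∘ mlin B) := fun x hx =>
  h x (by simpa [mlin_mul] using hx)

lemma hasTemperateGrowth_comp_mlin {φ : E3 → ℂ} (hφ : φ.HasTemperateGrowth)
    (B : Matrix (Fin 3) (Fin 3) ℝ) : (φ ∘ mlin B).HasTemperateGrowth :=
  hφ.comp (mlin B).hasTemperateGrowth

variable {p : ℝ} [Fact (1 ≤ ENNReal.ofReal p)]

lemma SchwartzDecomposition.of_comp_mlin {ι : Type} [Fintype ι] {φ : ι → E3 → ℂ} {K : ℝ}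
    (hφ : ∀ i, (φ i).HasTemperateGrowth) {B : Matrix (Fin 3) (Fin 3) ℝ} (hB : B.det ≠ 0)
    (h : SchwartzDecomposition p (fun i => φ i ∘ mlin B) K) : SchwartzDecomposition p φ K := by
  have h1 := h.comp_linear (fun i => hasTemperateGrowth_comp_mlin (hφ i) B) (mequiv B hB).symm
  convert h1 using 2 with i
  funext ξ
  simp only [Function.comp_apply]
  rw [← mequiv_apply hB, ContinuousLinearEquiv.apply_symm_apply]

/-! ### Plates of the circular cone -/

/-- The generator `u₁` of the circular cone. -/
def cu₁ (s : ℝ) : E3 := !₂[Real.cos (2 * Real.pi * s), Real.sin (2 * Real.pi * s), 1]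

/-- The tangential vector `u₂` of the circular cone. -/
def cu₂ (s : ℝ) : E3 :=
  !₂[-(2 * Real.pi) * Real.sin (2 * Real.pi * s), 2 * Real.pi * Real.cos (2 * Real.pi * s), 0]

/-- The normal vector `u₃` of the circular cone. -/
def cu₃ (s : ℝ) : E3 :=
  !₂[-(2 * Real.pi) * Real.cos (2 * Real.pi * s), -(2 * Real.pi) * Real.sin (2 * Real.pi * s),
    2 * Real.pi]

lemma curveDeriv_circle {s : ℝ} (hs : s ∈ circleInterval) :
    curveDeriv circleInterval circleCurve 1 s =
      !₂[-(2 * Real.pi) * Real.sin (2 * Real.pi * s),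
        2 * Real.pi * Real.cos (2 * Real.pi * s)] := by
  rw [curveDeriv, iteratedDerivWithin_one]
  refine HasDerivWithinAt.derivWithin ?_ (uniqueDiffOn_Icc (by norm_num) s hs)
  refine HasDerivAt.hasDerivWithinAt ?_
  have h0 : HasDerivAt (fun a : ℝ => 2 * Real.pi * a) (2 * Real.pi) s := by
    simpa using (hasDerivAt_id s).const_mul (2 * Real.pi)
  have h1 : HasDerivAt (fun a : ℝ => ![Real.cos (2 * Real.pi * a), Real.sin (2 * Real.pi * a)])
      ![-(2 * Real.pi) * Real.sin (2 * Real.pi * s),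
        2 * Real.pi * Real.cos (2 * Real.pi * s)] s := by
    rw [hasDerivAt_pi]
    intro i
    fin_cases i
    · simpa [mul_comm] using h0.cos
    · simpa [mul_comm] using h0.sin
  exact (PiLp.hasFDerivAt_toLp (𝕜 := ℝ) 2
    (![Real.cos (2 * Real.pi * s), Real.sin (2 * Real.pi * s)] : Fin 2 → ℝ)).comp_hasDerivAt s h1

lemma u₁_circle (s : ℝ) : u₁ circleCurve s = cu₁ s := by
  ext i; fin_cases i <;> simp [u₁, cu₁, circleCurve]

lemma u₂_circle {s : ℝ} (hs : s ∈ circleInterval) :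
    u₂ circleInterval circleCurve s = cu₂ s := by
  ext i; fin_cases i <;> simp [u₂, cu₂, curveDeriv_circle hs]

lemma u₃_circle {s : ℝ} (hs : s ∈ circleInterval) :
    u₃ circleInterval circleCurve s = cu₃ s := by
  have h := Real.sin_sq_add_cos_sq (2 * Real.pi * s)
  rw [u₃, u₁_circle, u₂_circle hs]
  ext i
  fin_cases i
  · simp [cross_apply, cu₁, cu₂, cu₃]
  · simp [cross_apply, cu₁, cu₂, cu₃]
  · simp [cross_apply, cu₁, cu₂, cu₃]
    linear_combination (2 * Real.pi) * h

/-- The frame of the plate of width `q` (that is, `δ = q²`) at the parameter `s` of the circle. -/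
def circleFrame (s q : ℝ) : Matrix (Fin 3) (Fin 3) ℝ :=
  cols ((1 : ℝ) • cu₁ s) (q • cu₂ s) (q ^ 2 • cu₃ s)

lemma det_circleFrame (s q : ℝ) : (circleFrame s q).det = 8 * Real.pi ^ 2 * q ^ 3 := by
  have h := Real.sin_sq_add_cos_sq (2 * Real.pi * s)
  rw [Matrix.det_fin_three]
  simp [circleFrame, cols, cu₁, cu₂, cu₃]
  linear_combination (8 * Real.pi ^ 2 * q ^ 3) * h

lemma det_circleFrame_ne_zero (s : ℝ) {q : ℝ} (hq : 0 < q) : (circleFrame s q).det ≠ 0 := by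
  rw [det_circleFrame]
  positivity

lemma circleFrame_mul_pdil (s q k : ℝ) : circleFrame s q * pdil k = circleFrame s (q * k) := by
  ext i j
  rw [pdil, Matrix.mul_diagonal]
  fin_cases i <;> fin_cases j <;> simp [circleFrame, cols] <;> ring

lemma inner_E3 (x y : E3) : inner ℝ x y = x 0 * y 0 + x 1 * y 1 + x 2 * y 2 := by
  simp [PiLp.inner_apply, Fin.sum_univ_three, mul_comm]

/-- The three linear functionals that define a circular plate, in frame coordinates. -/
lemma inner_circleFrame (s q : ℝ) (x : E3) :
    inner ℝ (cu₁ s) (mlin (circleFrame s q) x) = 2 * x 0 ∧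
    inner ℝ (cu₂ s) (mlin (circleFrame s q) x - (mlin (circleFrame s q) x) 2 • cu₁ s) =
      4 * Real.pi ^ 2 * q * x 1 ∧
    inner ℝ (cu₃ s) (mlin (circleFrame s q) x) = 8 * Real.pi ^ 2 * q ^ 2 * x 2 := by
  have h := Real.sin_sq_add_cos_sq (2 * Real.pi * s)
  refine ⟨?_, ?_, ?_⟩
  · rw [inner_E3]
    simp only [mlin_apply]
    simp [circleFrame, cols, cu₁, cu₂, cu₃]
    linear_combination (x 0 - 2 * Real.pi * q ^ 2 * x 2) * h
  · rw [inner_E3]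
    simp only [PiLp.sub_apply, PiLp.smul_apply, mlin_apply]
    simp [circleFrame, cols, cu₁, cu₂, cu₃]
    linear_combination (4 * Real.pi ^ 2 * q * x 1) * h
  · rw [inner_E3]
    simp only [mlin_apply]
    simp [circleFrame, cols, cu₁, cu₂, cu₃]
    linear_combination (4 * Real.pi ^ 2 * q ^ 2 * x 2 - 2 * Real.pi * x 0) * h

lemma isClosed_plate (I : Set ℝ) (g : ℝ → E2) (δ lam α : ℝ) : IsClosed (plate I g δ lam α) := by
  have h2 : Continuous fun ξ : E3 => ξ 2 := by fun_prop
  simp only [plate, Set.ofPred_and]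
  refine IsClosed.inter (isClosed_le ?_ ?_) (IsClosed.inter (isClosed_le ?_ ?_)
    (IsClosed.inter (isClosed_le ?_ ?_) (isClosed_le ?_ ?_))) <;> fun_prop

lemma sq_rpow_half {q : ℝ} (hq : 0 ≤ q) : (q ^ 2) ^ (1 / 2 : ℝ) = q := by
  rw [← Real.sqrt_eq_rpow, Real.sqrt_sq hq]

lemma weight_eq {lam δ : ℝ} (hlam : 0 < lam) (hδ : 0 < δ) (n₁ n₂ n₃ : ℕ) :
    lam ^ (-(n₁ : ℝ) - n₂ - n₃) * δ ^ (-(n₂ : ℝ) / 2) * δ ^ (-(n₃ : ℝ)) =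
      (lam ^ n₁ * ((lam * δ ^ (1 / 2 : ℝ)) ^ n₂ *
        (lam * (δ ^ (1 / 2 : ℝ)) ^ 2) ^ n₃))⁻¹ := by
  have h1 : (δ ^ (1 / 2 : ℝ)) ^ 2 = δ := by
    rw [← Real.rpow_natCast, ← Real.rpow_mul hδ.le]
    norm_num
  have h2 : δ ^ (-(n₂ : ℝ) / 2) = ((δ ^ (1 / 2 : ℝ)) ^ n₂)⁻¹ := by
    rw [← Real.rpow_natCast, ← Real.rpow_mul hδ.le, ← Real.rpow_neg hδ.le]
    congr 1
    ring
  have h3 : lam ^ (-(n₁ : ℝ) - n₂ - n₃) = (lam ^ (n₁ + n₂ + n₃))⁻¹ := by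
    rw [← Real.rpow_natCast, ← Real.rpow_neg hlam.le]
    congr 1
    push_cast
    ring
  rw [h1, h2, h3, Real.rpow_neg hδ.le, Real.rpow_natCast, mul_pow, mul_pow, pow_add, pow_add,
    mul_inv, mul_inv, mul_inv, mul_inv, mul_inv, mul_inv]
  ring

/-- A bump function in the frame of a circular plate is, after normalization, admissible. -/
lemma isAdmissibleBump_circle {s q lam C : ℝ} (hs : s ∈ circleInterval) (hq : 0 < q)
    (hlam : 1 ≤ lam) {φ : E3 → ℂ} (hφ : DerivBound (circleFrame s q) C φ)
    (hC : C * lam ^ 4 ≤ 1)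
    (hsupp : SuppIn (circleFrame s q)
      {x | lam / 2 ≤ |2 * x 0| ∧ |2 * x 0| ≤ 2 * lam ∧ |x 1| ≤ 1 / 80 ∧ |x 2| ≤ 1 / 80} φ) :
    IsAdmissibleBump circleInterval circleCurve (q ^ 2) lam s φ := by
  have hdet := det_circleFrame_ne_zero s hq
  have hlam0 : 0 < lam := by linarith
  refine ⟨hφ.smooth, ?_, fun n₁ n₂ n₃ hn ξ => ?_⟩
  · refine closure_minimal (fun ξ hξ => ?_) (isClosed_plate _ _ _ _ _)
    have hξ' : φ (mlin (circleFrame s q) (mlin (circleFrame s q)⁻¹ ξ)) ≠ 0 := by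
      rwa [mlin_mlin_inv hdet]
    obtain ⟨h1, h2, h3, h4⟩ := hsupp _ hξ'
    obtain ⟨e1, e2, e3⟩ := inner_circleFrame s q (mlin (circleFrame s q)⁻¹ ξ)
    rw [mlin_mlin_inv hdet] at e1 e2 e3
    have hpi : Real.pi ^ 2 ≤ 10 := by nlinarith [Real.pi_lt_d2, Real.pi_pos]
    change _ ∧ _ ∧ _ ∧ _
    rw [u₁_circle, u₂_circle hs, u₃_circle hs, sq_rpow_half hq.le, e1, e2, e3]
    refine ⟨h1, h2, ?_, ?_⟩
    · rw [abs_mul, abs_of_pos (by positivity)]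
      nlinarith [mul_le_mul hpi h3 (abs_nonneg _) (by norm_num)]
    · rw [abs_mul, abs_of_pos (by positivity)]
      have : Real.pi ^ 2 * |(mlin (circleFrame s q)⁻¹ ξ) 2| ≤ 10 * (1 / 80) :=
        mul_le_mul hpi h4 (abs_nonneg _) (by norm_num)
      have hq2 : 0 < q ^ 2 := by positivity
      nlinarith
  · have h1 := hφ.mixedDeriv_le one_pos hq (by positivity : 0 < q ^ 2) hdet hn ξ
    rw [weight_eq hlam0 (by positivity), sq_rpow_half hq.le, u₁_circle, u₂_circle hs,
      u₃_circle hs]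
    refine h1.trans ?_
    have h2 : lam ^ (n₁ + n₂ + n₃) ≤ lam ^ 4 := pow_le_pow_right₀ hlam hn
    have h3 : C ≤ (lam ^ (n₁ + n₂ + n₃))⁻¹ := by
      rw [← one_div, le_div_iff₀ (by positivity)]
      exact (mul_le_mul_of_nonneg_left h2 hφ.nonneg).trans hC
    have h4 : 0 < (1 : ℝ) ^ n₁ * (q ^ n₂ * (q ^ 2) ^ n₃) := by positivity
    refine (mul_le_mul_of_nonneg_right h3 (inv_nonneg.mpr h4.le)).trans_eq ?_
    rw [← mul_inv]
    congr 1
    rw [mul_pow, mul_pow, one_pow, pow_add, pow_add]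
    ring

lemma sum_range_dyadicStep {J : ℕ} {t : ℝ} (h2 : 2 ≤ |t|) (hJ : |t| ≤ 2 ^ J) :
    ∑ j ∈ Finset.range J, (dyadicStep j t - dyadicStep (j + 1) t) = 1 := by
  rw [Finset.sum_range_sub', dyadicStep_eq_one (by simpa using h2), dyadicStep_eq_zero hJ, sub_zero]

lemma dyadicStep_sub_ne_zero {j : ℕ} {t : ℝ} (h : dyadicStep j t - dyadicStep (j + 1) t ≠ 0) :
    2 ^ j ≤ |t| ∧ |t| ≤ 2 ^ (j + 2) := by
  constructor
  · by_contra! hlt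
    refine h ?_
    rw [dyadicStep_eq_zero hlt.le, dyadicStep_eq_zero (hlt.le.trans
      (pow_le_pow_right₀ (by norm_num) (Nat.le_succ j))), sub_zero]
  · by_contra! hlt
    refine h ?_
    rw [dyadicStep_eq_one hlt.le, dyadicStep_eq_one (le_trans
      (pow_le_pow_right₀ (by norm_num) (Nat.le_succ (j + 1))) hlt.le), sub_self]

/-- Wolff's inequality for smooth bump functions on slightly larger regions: a dyadic
decomposition in the radial direction reduces it to admissible bump functions. -/
theorem WolffInequality.flatBox (hW : WolffInequality p) {ε : ℝ} (hε : 0 < ε) (C R : ℝ)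
    (hC : 0 ≤ C) : ∃ K : ℝ, 0 ≤ K ∧ ∀ q : ℝ, 0 < q → q ≤ 1 → ∀ (ι : Type) [Fintype ι]
      (s : ι → ℝ) (φ : ι → E3 → ℂ), (∀ i, s i ∈ circleInterval) →
      (∀ i j, i ≠ j → q ≤ |s i - s j|) → (∀ i, DerivBound (circleFrame (s i) q) C (φ i)) →
      (∀ i, SuppIn (circleFrame (s i) q) (flatBox R) (φ i)) →
      SchwartzDecomposition p φ (K * (q ^ 2) ^ (2 / p - 1 / 2 - ε)) := by
  obtain ⟨A, hA⟩ := hW ε hε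
  obtain ⟨J, hJ⟩ := pow_unbounded_of_one_lt (2 * R) (by norm_num : (1 : ℝ) < 2)
  obtain ⟨b, hb, hbc, hb1, -⟩ := exists_cutoff (K := Metric.closedBall 0 (2 * R))
    (U := Metric.ball 0 (2 * R + 1)) (ρ := 2 * R + 1) Metric.isClosed_closedBall Metric.isOpen_ball
    (Metric.closedBall_subset_ball (by linarith)) (fun x hx => by
      simpa using (Metric.mem_ball.mp hx).le)
  -- the dyadic pieces, as functions of the frame coordinates
  set χ : ℕ → E3 → ℂ := fun j x =>
    ((dyadicStep j (2 * x 0) - dyadicStep (j + 1) (2 * x 0) : ℝ) : ℂ) * b x with hχ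
  have hχd : ∀ j, ∃ D, DerivBound 1 D (χ j) := by
    intro j
    refine exists_derivBound ?_ hbc.mul_left
    have h0 : ContDiff ℝ ∞ fun x : E3 => 2 * x 0 := by fun_prop
    exact (Complex.ofRealCLM.contDiff.comp (((contDiff_dyadicStep j).comp h0).sub
      ((contDiff_dyadicStep (j + 1)).comp h0))).mul hb
  choose D hD using hχd
  set c : ℕ → ℝ := fun j => (16 * C * D j + 1) * (2 ^ (j + 1)) ^ 4 with hc
  have hcpos : ∀ j, 0 < c j := fun j => by
    have := (hD j).nonneg
    positivity
  refine ⟨∑ j ∈ Finset.range J, c j * |A|, Finset.sum_nonneg fun j _ => by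
    have := hcpos j; positivity, ?_⟩
  intro q hq hq1 ι _ s φ hs hsep hφ hsupp
  have hdet : ∀ i, (circleFrame (s i) q).det ≠ 0 := fun i => det_circleFrame_ne_zero _ hq
  set Φ : ℕ → ι → E3 → ℂ := fun j i ξ => χ j (mlin (circleFrame (s i) q)⁻¹ ξ) * φ i ξ with hΦ
  have hΦd : ∀ j i, DerivBound (circleFrame (s i) q) (16 * C * D j) (Φ j i) := fun j i =>
    (hφ i).cutoff (hdet i) (hD j)
  have hΦs : ∀ j i, SuppIn (circleFrame (s i) q) (ConePlates.flatBox R) (Φ j i) := fun j i x hx =>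
    hsupp i x (right_ne_zero_of_mul hx)
  have hΦt : ∀ j i, (Φ j i).HasTemperateGrowth := fun j i =>
    (hΦd j i).hasTemperateGrowth (hdet i) (hΦs j i) fun x hx => norm_le_of_mem_flatBox hx
  rw [Finset.sum_mul]
  refine SchwartzDecomposition.sum (φ := Φ) (fun j _ i => hΦt j i) (fun i => ?_) fun j _ => ?_
  · funext ξ
    simp only [hΦ]
    rw [← Finset.sum_mul]
    by_cases h0 : φ i ξ = 0
    · simp [h0]
    · set x := mlin (circleFrame (s i) q)⁻¹ ξ with hx
      have hmem : x ∈ ConePlates.flatBox R := hsupp i x (by rwa [hx, mlin_mlin_inv (hdet i)])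
      have hbx : b x = 1 := hb1 x (by simpa using norm_le_of_mem_flatBox hmem)
      obtain ⟨h1, h2, -, -⟩ := hmem
      have hs1 := sum_range_dyadicStep (J := J) (t := 2 * x 0)
        (by rw [abs_mul, abs_two]; linarith) (by rw [abs_mul, abs_two]; linarith)
      simp only [hχ, hbx, mul_one]
      rw [← Complex.ofReal_sum, hs1]
      simp
  · -- the normalized piece is admissible for the plates with `lam = 2 ^ (j + 1)`
    set ψ : ι → E3 → ℂ := fun i => (((c j)⁻¹ : ℝ) : ℂ) • Φ j i with hψ
    have hnorm : ‖(((c j)⁻¹ : ℝ) : ℂ)‖ = (c j)⁻¹ := by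
      rw [Complex.norm_real, Real.norm_of_nonneg (inv_nonneg.mpr (hcpos j).le)]
    have hadm : ∀ i, IsAdmissibleBump circleInterval circleCurve (q ^ 2) (2 ^ (j + 1)) (s i)
        (ψ i) := by
      intro i
      refine isAdmissibleBump_circle (hs i) hq (one_le_pow₀ (by norm_num))
        ((hΦd j i).const_smul _) ?_ ?_
      · rw [hnorm, mul_assoc, inv_mul_le_iff₀ (hcpos j), mul_one]
        exact mul_le_mul_of_nonneg_right (by linarith) (by positivity)
      · intro x hx
        have hx' : Φ j i (mlin (circleFrame (s i) q) x) ≠ 0 := right_ne_zero_of_mul hx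
        obtain ⟨-, -, h3, h4⟩ := hΦs j i x hx'
        simp only [hΦ, hχ, mlin_inv_mlin (hdet i)] at hx'
        have h5 := left_ne_zero_of_mul (left_ne_zero_of_mul hx')
        obtain ⟨h6, h7⟩ := dyadicStep_sub_ne_zero (Complex.ofReal_ne_zero.mp h5)
        refine ⟨?_, ?_, h3, h4⟩
        · rw [pow_succ]
          linarith
        · rw [pow_succ] at h7
          linarith
    have hψt : ∀ i, (ψ i).HasTemperateGrowth := fun i =>
      (Function.HasTemperateGrowth.const _).smul (hΦt j i)
    set e := Fintype.equivFin ι with he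
    have hdec := hA (q ^ 2) (2 ^ (j + 1)) (Fintype.card ι) (fun ν => s (e.symm ν))
      (fun ν => ψ (e.symm ν))
      { one_le_lam := one_le_pow₀ (by norm_num)
        delta_pos := by positivity
        sqrt_delta_le := by rwa [sq_rpow_half hq.le]
        sigma_pos := by rwa [sq_rpow_half hq.le]
        sigma_le := le_rfl
        mem := fun ν => hs _
        separated := fun ν ν' hne => by
          rw [sq_rpow_half hq.le]
          exact hsep _ _ (e.symm.injective.ne hne)
        spread_le := fun ν ν' => by
          have h1 := hs (e.symm ν)
          have h2 := hs (e.symm ν')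
          simp only [circleInterval, Set.mem_Icc] at h1 h2
          linarith [h1.2, h2.1] }
      fun ν => hadm _
    have h1 : SchwartzDecomposition p ψ (|A| * (q ^ 2) ^ (2 / p - 1 / 2 - ε)) :=
      SchwartzDecomposition.reindex e.symm
        ((SchwartzDecomposition.of_decompositionInequality (fun ν => hψt _) hdec).mono
          (mul_le_mul_of_nonneg_right (le_abs_self A) (by positivity)))
    have h2 := h1.smul (c j : ℂ) hψt
    rw [Complex.norm_real, Real.norm_of_nonneg (hcpos j).le, ← mul_assoc] at h2
    convert h2 using 2 with i
    simp only [hψ, smul_smul]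
    rw [← Complex.ofReal_mul, mul_inv_cancel₀ (hcpos j).ne']
    simp

/-! ### Consequences of the hypothesis: larger supports, single multipliers, the exponent -/

/-- The anisotropic dilation that maps `flatBox (R ^ 2)` onto a neighbourhood of `shell R`. -/
def flatten (R : ℝ) : Matrix (Fin 3) (Fin 3) ℝ := R⁻¹ • pdil (80 * R ^ 2)

lemma mlin_flatten (R : ℝ) (y : E3) : mlin (flatten R) y 0 = R⁻¹ * y 0 ∧
    mlin (flatten R) y 1 = R⁻¹ * (80 * R ^ 2) * y 1 ∧
    mlin (flatten R) y 2 = R⁻¹ * (80 * R ^ 2) ^ 2 * y 2 := by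
  refine ⟨?_, ?_, ?_⟩ <;> rw [mlin_apply] <;> simp [flatten, pdil]

lemma entryBound_flatten {R : ℝ} (hR : 1 ≤ R) : EntryBound (flatten R) (6400 * R ^ 4) := by
  have h1 : R⁻¹ ≤ 1 := inv_le_one_of_one_le₀ hR
  have h0 : 0 < R⁻¹ := by positivity
  have hR4 : 1 ≤ R ^ 4 := one_le_pow₀ hR
  have hR2 : R ^ 2 ≤ R ^ 4 := pow_le_pow_right₀ hR (by norm_num)
  have key : ∀ t : ℝ, 0 ≤ t → t ≤ 6400 * R ^ 4 → |R⁻¹ * t| ≤ 6400 * R ^ 4 := fun t ht h => by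
    rw [abs_of_nonneg (by positivity)]
    nlinarith
  intro i j
  by_cases hij : i = j
  · subst hij
    fin_cases i <;> simp only [flatten, pdil, Matrix.smul_apply, Matrix.diagonal_apply_eq,
      smul_eq_mul]
    · exact key _ (by simp) (by simp; linarith)
    · exact key _ (by simp; positivity) (by simp; linarith)
    · exact key _ (by simp; positivity) (by simp; nlinarith)
  · simp only [flatten, pdil, Matrix.smul_apply, Matrix.diagonal_apply_ne _ hij, smul_zero, abs_zero]
    positivity

lemma det_flatten_ne_zero {R : ℝ} (hR : 1 ≤ R) : (flatten R).det ≠ 0 := by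
  have : 0 < R := by linarith
  rw [flatten, Matrix.det_smul, det_pdil]
  positivity

lemma SuppIn.flatten {F : Matrix (Fin 3) (Fin 3) ℝ} {R : ℝ} (hR : 1 ≤ R) {φ : E3 → ℂ}
    (h : SuppIn F (shell R) φ) : SuppIn (F * ConePlates.flatten R) (flatBox (R ^ 2)) φ := by
  intro y hy
  rw [mlin_mul] at hy
  obtain ⟨h1, h2⟩ := h _ hy
  obtain ⟨e0, e1, e2⟩ := mlin_flatten R y
  have hR0 : 0 < R := by linarith
  have hle : ∀ i, |mlin (ConePlates.flatten R) y i| ≤ R := fun i => (abs_coord_le_norm _ i).trans h1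
  have hl0 := hle 0
  have hl1 := hle 1
  have hl2 := hle 2
  rw [e0, abs_mul, abs_of_pos (inv_pos.mpr hR0)] at h2 hl0
  rw [e1, abs_mul, abs_of_pos (by positivity)] at hl1
  rw [e2, abs_mul, abs_of_pos (by positivity)] at hl2
  refine ⟨?_, ?_, ?_, ?_⟩
  · exact (le_mul_iff_one_le_right (inv_pos.mpr hR0)).mp h2
  · rw [inv_mul_le_iff₀ hR0] at hl0
    rwa [sq]
  · have h3 : R⁻¹ * (80 * R ^ 2) = 80 * R := by field_simp
    rw [h3] at hl1
    nlinarith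
  · have h3 : R⁻¹ * (80 * R ^ 2) ^ 2 = R * (6400 * R ^ 2) := by field_simp; norm_num
    rw [h3, mul_assoc] at hl2
    have h4 : 6400 * R ^ 2 * |y 2| ≤ 1 := by
      by_contra! hlt
      nlinarith
    nlinarith [abs_nonneg (y 2), one_le_pow₀ hR (n := 2)]

lemma norm_le_of_mem_shell {R : ℝ} {x : E3} (hx : x ∈ shell R) : ‖x‖ ≤ R := hx.1

/-- Every multiplier that is a normalized bump function in some linear frame is bounded on `L^p`;
this is the hypothesis for one plate at scale one, transported by a linear map. -/
theorem WolffInequality.single (hW : WolffInequality p) (C R : ℝ) (hC : 0 ≤ C) (hR : 1 ≤ R) :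
    ∃ K : ℝ, 0 ≤ K ∧ ∀ (F : Matrix (Fin 3) (Fin 3) ℝ) (φ : E3 → ℂ), F.det ≠ 0 →
      DerivBound F C φ → SuppIn F (shell R) φ →
      SchwartzDecomposition p (fun _ : Unit => φ) K := by
  obtain ⟨K, hK, h⟩ := hW.flatBox one_pos (C * (6 * (6400 * R ^ 4)) ^ 4) (R ^ 2) (by positivity)
  refine ⟨K, hK, fun F φ hF hφ hsupp => ?_⟩
  have hM := det_circleFrame_ne_zero 0 one_pos
  have hR4 : 1 ≤ R ^ 4 := one_le_pow₀ hR
  set B := F * flatten R * (circleFrame 0 1)⁻¹ with hB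
  have hBM : B * circleFrame 0 1 = F * flatten R := by
    rw [hB, Matrix.mul_assoc _ _ (circleFrame 0 1), Matrix.nonsing_inv_mul _ hM.isUnit,
      Matrix.mul_one]
  have hBdet : B.det ≠ 0 := by
    intro h0
    have := congrArg Matrix.det hBM
    rw [Matrix.det_mul B, Matrix.det_mul F, h0, zero_mul] at this
    exact mul_ne_zero hF (det_flatten_ne_zero hR) this.symm
  have h1 := h 1 one_pos le_rfl Unit (fun _ => 0) (fun _ => φ ∘ mlin B)
    (fun _ => by simp [circleInterval]; norm_num) (fun i j hij => (hij rfl).elim)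
    (fun _ => DerivBound.comp_mlin (by
      rw [hBM]
      exact hφ.mul_right (entryBound_flatten hR) (by linarith)))
    (fun _ => SuppIn.comp_mlin (by
      rw [hBM]
      exact hsupp.flatten hR))
  simp only [one_pow, Real.one_rpow, mul_one] at h1
  exact SchwartzDecomposition.of_comp_mlin
    (fun _ => hφ.hasTemperateGrowth hF hsupp fun x hx => norm_le_of_mem_shell hx) hBdet h1

/-- Wolff's inequality for bump functions that are adapted to circular plates up to constants. -/
theorem WolffInequality.shell (hW : WolffInequality p) {ε : ℝ} (hε : 0 < ε) (C R : ℝ)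
    (hC : 0 ≤ C) (hR : 1 ≤ R) : ∃ K : ℝ, 0 ≤ K ∧ ∀ q : ℝ, 0 < q → q * (80 * R ^ 2) ≤ 1 →
      ∀ (ι : Type) [Fintype ι] (s : ι → ℝ) (φ : ι → E3 → ℂ), (∀ i, s i ∈ circleInterval) →
      (∀ i j, i ≠ j → q * (80 * R ^ 2) ≤ |s i - s j|) →
      (∀ i, DerivBound (circleFrame (s i) q) C (φ i)) →
      (∀ i, SuppIn (circleFrame (s i) q) (ConePlates.shell R) (φ i)) →
      SchwartzDecomposition p φ (K * (q ^ 2) ^ (2 / p - 1 / 2 - ε)) := by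
  obtain ⟨K, hK, h⟩ := hW.flatBox hε (C * (6 * (6400 * R ^ 4)) ^ 4) (R ^ 2) (by positivity)
  refine ⟨K * ((80 * R ^ 2) ^ 2) ^ (2 / p - 1 / 2 - ε), by positivity, ?_⟩
  intro q hq hq1 ι _ s φ hs hsep hφ hsupp
  have hR0 : 0 < R := by linarith
  have hR4 : 1 ≤ R ^ 4 := one_le_pow₀ hR
  set B : Matrix (Fin 3) (Fin 3) ℝ := R⁻¹ • 1 with hB
  have hBdet : B.det ≠ 0 := by
    rw [hB, Matrix.det_smul, Matrix.det_one]
    positivity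
  have hBM : ∀ i, B * circleFrame (s i) (q * (80 * R ^ 2)) =
      circleFrame (s i) q * flatten R := fun i => by
    rw [hB, flatten, Matrix.mul_smul, circleFrame_mul_pdil, Matrix.smul_mul, Matrix.one_mul]
  have h1 := h (q * (80 * R ^ 2)) (by positivity) hq1 ι s (fun i => φ i ∘ mlin B) hs hsep
    (fun i => DerivBound.comp_mlin (by
      rw [hBM]
      exact (hφ i).mul_right (entryBound_flatten hR) (by linarith)))
    (fun i => SuppIn.comp_mlin (by
      rw [hBM]
      exact (hsupp i).flatten hR))
  rw [mul_pow q, Real.mul_rpow (by positivity) (by positivity)] at h1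
  refine (SchwartzDecomposition.of_comp_mlin (fun i => (hφ i).hasTemperateGrowth
    (det_circleFrame_ne_zero _ hq) (hsupp i) fun x hx => norm_le_of_mem_shell hx) hBdet h1).mono ?_
  exact le_of_eq (by ring)

/-- The exponent in Wolff's inequality is never positive: one single plate has a multiplier norm
that does not depend on `δ`. -/
theorem WolffInequality.exponent_nonpos (hW : WolffInequality p) {ε : ℝ} (hε : 0 < ε) :
    2 / p - 1 / 2 - ε ≤ 0 := by
  by_contra! he
  set x₀ : E3 := !₂[3 / 2, 0, 0] with hx₀
  obtain ⟨b, hb, hbc, hb1, hbs⟩ := exists_cutoff (K := {x₀})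
    (U := Metric.ball x₀ (1 / 80)) (ρ := ‖x₀‖ + 1 / 80) isClosed_singleton Metric.isOpen_ball
    (by simp) (fun x hx => by
      have h1 := (mem_ball_iff_norm.mp hx).le
      have h2 := norm_le_insert' x x₀
      linarith)
  obtain ⟨D, hD⟩ := exists_derivBound hb hbc
  have hbt : b.HasTemperateGrowth := hbc.hasTemperateGrowth hb
  obtain ⟨K, hK, h⟩ := hW.flatBox hε D 2 hD.nonneg
  have hbox : ∀ x, b x ≠ 0 → x ∈ ConePlates.flatBox 2 := by
    intro x hx
    have h1 := (mem_ball_iff_norm.mp (hbs x hx)).le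
    have h2 : ∀ i, |x i - x₀ i| ≤ 1 / 80 := fun i => (abs_coord_le_norm (x - x₀) i).trans h1
    have h3 := h2 0
    have h4 := h2 1
    have h5 := h2 2
    simp only [hx₀, PiLp.toLp_apply, Matrix.cons_val_zero, Matrix.cons_val_one,
      Matrix.cons_val] at h3 h4 h5
    rw [sub_zero] at h4 h5
    rw [abs_le] at h3
    have h6 : |x 0| = x 0 := abs_of_pos (by linarith)
    exact ⟨by linarith, by linarith, h4, h5⟩
  -- in frame coordinates the multiplier is `b`, for every value of `q`
  have hSD : ∀ q : ℝ, 0 < q → q ≤ 1 → SchwartzDecomposition p (fun _ : Unit => b)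
      (K * (q ^ 2) ^ (2 / p - 1 / 2 - ε)) := by
    intro q hq hq1
    have hdet := det_circleFrame_ne_zero 0 hq
    have hcomp : (b ∘ mlin (circleFrame 0 q)⁻¹) ∘ mlin (circleFrame 0 q) = b := by
      funext x
      simp [mlin_inv_mlin hdet]
    have h1 := h q hq hq1 Unit (fun _ => 0) (fun _ => b ∘ mlin (circleFrame 0 q)⁻¹)
      (fun _ => by simp [circleInterval]; norm_num) (fun i j hij => (hij rfl).elim)
      (fun _ => DerivBound.comp_mlin (by
        rw [Matrix.nonsing_inv_mul _ hdet.isUnit]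
        exact hD))
      (fun _ => SuppIn.comp_mlin (by
        rw [Matrix.nonsing_inv_mul _ hdet.isUnit]
        intro x hx
        exact hbox x (by simpa [mlin_one] using hx)))
    have h2 := h1.comp_linear (fun _ => hasTemperateGrowth_comp_mlin hbt _) (mequiv _ hdet)
    have h3 : (b ∘ mlin (circleFrame 0 q)⁻¹) ∘ (mequiv _ hdet) = b := hcomp
    simpa only [h3] using h2
  -- test on the function whose Fourier transform is `b`
  set bS : 𝓢(E3, ℂ) := hbc.toSchwartzMap hb with hbS
  set f : 𝓢(E3, ℂ) := FourierTransform.fourierInv bS with hf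
  have hle : ∀ q : ℝ, 0 < q → q ≤ 1 →
      snorm p (mult b f) ≤ K * (q ^ 2) ^ (2 / p - 1 / 2 - ε) * snorm p f := by
    intro q hq hq1
    have h1 := hSD q hq hq1 fun _ => f
    have hp0 : p ≠ 0 := (exponent_pos (p := p)).ne'
    simpa [← Real.rpow_mul (snorm_nonneg f), mul_inv_cancel₀ hp0] using h1
  have hzero : snorm p (mult b f) = 0 := by
    refine le_antisymm ?_ (snorm_nonneg _)
    have h1 : Filter.Tendsto (fun q : ℝ => K * (q ^ 2) ^ (2 / p - 1 / 2 - ε) * snorm p f)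
        (nhdsWithin 0 (Set.Ioi 0)) (nhds (K * ((0 : ℝ) ^ 2) ^ (2 / p - 1 / 2 - ε) * snorm p f)) := by
      have hcont : Continuous fun q : ℝ => K * (q ^ 2) ^ (2 / p - 1 / 2 - ε) * snorm p f :=
        (continuous_const.mul ((Real.continuous_rpow_const he.le).comp
          (continuous_pow 2))).mul continuous_const
      exact (hcont.tendsto 0).mono_left nhdsWithin_le_nhds
    have h2 : K * ((0 : ℝ) ^ 2) ^ (2 / p - 1 / 2 - ε) * snorm p f = 0 := by
      rw [zero_pow two_ne_zero, Real.zero_rpow he.ne', mul_zero, zero_mul]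
    rw [h2] at h1
    refine ge_of_tendsto h1 ?_
    filter_upwards [Ioc_mem_nhdsGT (zero_lt_one' ℝ)] with q hq
    exact hle q hq.1 hq.2
  have h1 := congrArg (fun g => FourierTransform.fourier g) (snorm_eq_zero hzero)
  simp only [hf, SchwartzMap.fourierMultiplierCLM_apply,
    FourierTransform.fourier_fourierInv_eq] at h1
  have h2 := congrArg (fun g : 𝓢(E3, ℂ) => g x₀) h1
  have h3 : bS x₀ = 1 := hb1 x₀ rfl
  simp [FourierTransform.fourier_zero, SchwartzMap.smulLeftCLM_apply_apply hbt, h3, hb1 x₀ rfl] at h2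

end

/-! ### The moving frame of the cone and its Taylor expansion -/

/-- The frame `(u₁, u₁', u₁'')` of the cone over the curve `g`. -/
def curveFrame (I : Set ℝ) (g : ℝ → E2) (α : ℝ) : Matrix (Fin 3) (Fin 3) ℝ :=
  !![g α 0, curveDeriv I g 1 α 0, curveDeriv I g 2 α 0;
     g α 1, curveDeriv I g 1 α 1, curveDeriv I g 2 α 1;
     1, 0, 0]

/-- The matrix by which a parameter shift `h` acts on the `2`-jet of a curve. -/
def shiftMatrix (h : ℝ) : Matrix (Fin 3) (Fin 3) ℝ := !![1, 0, 0; h, 1, 0; h ^ 2 / 2, h, 1]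

lemma shiftMatrix_neg_mul (h : ℝ) : shiftMatrix (-h) * shiftMatrix h = 1 := by
  ext i j
  fin_cases i <;> fin_cases j <;> simp [shiftMatrix, Matrix.mul_apply, Fin.sum_univ_three]
  ring

lemma shiftMatrix_mul_neg (h : ℝ) : shiftMatrix h * shiftMatrix (-h) = 1 := by
  simpa using shiftMatrix_neg_mul (-h)

lemma det_shiftMatrix (h : ℝ) : (shiftMatrix h).det = 1 := by
  rw [Matrix.det_fin_three]
  simp [shiftMatrix]

lemma shiftMatrix_mul_pdil (θ t : ℝ) :
    shiftMatrix (θ * t) * pdil θ = pdil θ * shiftMatrix t := by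
  ext i j
  rw [pdil, Matrix.mul_diagonal, Matrix.diagonal_mul]
  fin_cases i <;> fin_cases j <;> simp [shiftMatrix] <;> ring

lemma pdil_mul_mul_pdil_apply (a b : ℝ) (X : Matrix (Fin 3) (Fin 3) ℝ) (i j : Fin 3) :
    (pdil a * X * pdil b) i j = a ^ (i : ℕ) * X i j * b ^ (j : ℕ) := by
  rw [pdil, pdil, Matrix.mul_diagonal, Matrix.diagonal_mul]
  fin_cases i <;> fin_cases j <;> simp

lemma abs_coord_le_norm_E2 (x : E2) (i : Fin 2) : |x i| ≤ ‖x‖ := PiLp.norm_apply_le x i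

section Curve

variable {I : Set ℝ} {g : ℝ → E2} {b₀ b₁ b₂ : ℝ}

lemma curveDeriv_zero (α : ℝ) : curveDeriv I g 0 α = g α := by
  simp [curveDeriv]

lemma CurveAssumption.hasDerivWithinAt (hI : IsClosedSubinterval I)
    (hg : CurveAssumption I g b₀ b₁ b₂) {k : ℕ} (hk : k < 3) {α : ℝ} (hα : α ∈ I) :
    HasDerivWithinAt (curveDeriv I g k) (curveDeriv I g (k + 1) α) I α := by
  obtain ⟨a, b, -, hab, -, rfl⟩ := hI
  have h1 := hg.contDiffOn.differentiableOn_iteratedDerivWithin (m := k)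
    (by exact_mod_cast hk) (uniqueDiffOn_Icc hab)
  have h2 := (h1 α hα).hasDerivWithinAt
  rw [← iteratedDerivWithin_succ] at h2
  exact h2

lemma uIcc_subset (hI : IsClosedSubinterval I) {α β : ℝ} (hα : α ∈ I) (hβ : β ∈ I) :
    Set.uIcc α β ⊆ I := by
  obtain ⟨a, b, -, -, -, rfl⟩ := hI
  exact Set.uIcc_subset_Icc hα hβ

lemma abs_sub_le_two (hI : IsClosedSubinterval I) {α β : ℝ} (hα : α ∈ I) (hβ : β ∈ I) :
    |β - α| ≤ 2 := by
  obtain ⟨a, b, ha, -, hb, rfl⟩ := hI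
  rw [abs_le]
  exact ⟨by linarith [hα.2, hβ.1], by linarith [hα.1, hβ.2]⟩

/-- Taylor's formula for the curve and its first two derivatives. -/
lemma CurveAssumption.taylor (hI : IsClosedSubinterval I) (hg : CurveAssumption I g b₀ b₁ b₂)
    {α β : ℝ} (hα : α ∈ I) (hβ : β ∈ I) :
    ‖g β - (g α + (β - α) • curveDeriv I g 1 α + ((β - α) ^ 2 / 2) • curveDeriv I g 2 α)‖ ≤
      b₀ * |β - α| ^ 3 ∧
    ‖curveDeriv I g 1 β - (curveDeriv I g 1 α + (β - α) • curveDeriv I g 2 α)‖ ≤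
      b₀ * |β - α| ^ 2 ∧
    ‖curveDeriv I g 2 β - curveDeriv I g 2 α‖ ≤ b₀ * |β - α| := by
  have hb₀ : 0 ≤ b₀ := (norm_nonneg _).trans (hg.norm_le 0 (by simp) α hα)
  have h2 : ∀ x ∈ Set.uIcc α β, ‖curveDeriv I g 2 x - curveDeriv I g 2 α‖ ≤ b₀ * |x - α| := by
    intro x hx
    have hx' := uIcc_subset hI hα hβ hx
    have hsub := uIcc_subset hI hα hx'
    exact Convex.norm_image_sub_le_of_norm_hasDerivWithin_le
      (fun y hy => (hg.hasDerivWithinAt hI (by norm_num : 2 < 3) (hsub hy)).mono hsub)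
      (fun y hy => hg.norm_le 3 le_rfl y (hsub hy)) (convex_uIcc _ _) Set.left_mem_uIcc
      Set.right_mem_uIcc
  have h1 : ∀ x ∈ Set.uIcc α β,
      ‖curveDeriv I g 1 x - (curveDeriv I g 1 α + (x - α) • curveDeriv I g 2 α)‖ ≤
        b₀ * |x - α| ^ 2 := by
    intro x hx
    have hx' := uIcc_subset hI hα hβ hx
    have hsub := uIcc_subset hI hα hx'
    have hsub' : Set.uIcc α x ⊆ Set.uIcc α β := Set.uIcc_subset_uIcc_left hx
    have := Convex.norm_image_sub_le_of_norm_hasDerivWithin_le (s := Set.uIcc α x)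
      (f := fun y => curveDeriv I g 1 y - (y - α) • curveDeriv I g 2 α)
      (f' := fun y => curveDeriv I g 2 y - (1 : ℝ) • curveDeriv I g 2 α)
      (C := b₀ * |x - α|)
      (fun y hy => ((hg.hasDerivWithinAt hI (by norm_num : 1 < 3) (hsub hy)).mono hsub).sub
        (((hasDerivWithinAt_id y _).sub_const α).smul_const _))
      (fun y hy => by
        rw [one_smul]
        exact (h2 y (hsub' hy)).trans (mul_le_mul_of_nonneg_left
          (Set.abs_sub_left_of_mem_uIcc hy) hb₀))
      (convex_uIcc _ _) Set.left_mem_uIcc Set.right_mem_uIcc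
    rw [Real.norm_eq_abs, mul_assoc, ← sq] at this
    refine le_trans (le_of_eq ?_) this
    congr 1
    simp only [sub_self, zero_smul]
    abel
  refine ⟨?_, h1 β Set.right_mem_uIcc, h2 β Set.right_mem_uIcc⟩
  have hsub := uIcc_subset hI hα hβ
  have := Convex.norm_image_sub_le_of_norm_hasDerivWithin_le (s := Set.uIcc α β)
    (f := fun y => curveDeriv I g 0 y - ((y - α) • curveDeriv I g 1 α +
      ((y - α) ^ 2 / 2) • curveDeriv I g 2 α))
    (f' := fun y => curveDeriv I g 1 y - (curveDeriv I g 1 α + (y - α) • curveDeriv I g 2 α))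
    (C := b₀ * |β - α| ^ 2)
    (fun y hy => by
      refine ((hg.hasDerivWithinAt hI (by norm_num : 0 < 3) (hsub hy)).mono hsub).sub
        (HasDerivWithinAt.add ?_ ?_)
      · simpa using ((hasDerivWithinAt_id y (Set.uIcc α β)).sub_const α).smul_const
          (curveDeriv I g 1 α)
      · have hd : HasDerivWithinAt (fun y : ℝ => (y - α) ^ 2 / 2) (y - α) (Set.uIcc α β) y := by
          have := ((((hasDerivAt_id y).sub_const α).pow 2).div_const 2).hasDerivWithinAt
            (s := Set.uIcc α β)
          simpa using this
        exact hd.smul_const _)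
    (fun y hy => (h1 y hy).trans (mul_le_mul_of_nonneg_left
      (pow_le_pow_left₀ (abs_nonneg _) (Set.abs_sub_left_of_mem_uIcc hy) 2) hb₀))
    (convex_uIcc _ _) Set.left_mem_uIcc Set.right_mem_uIcc
  rw [Real.norm_eq_abs, mul_assoc, ← pow_succ] at this
  refine le_trans (le_of_eq ?_) this
  congr 1
  simp only [sub_self, zero_smul, curveDeriv_zero, zero_pow two_ne_zero, zero_div, add_zero,
    sub_zero]
  abel

lemma det_curveFrame (α : ℝ) : (curveFrame I g α).det =
    curveDeriv I g 1 α 0 * curveDeriv I g 2 α 1 - curveDeriv I g 1 α 1 * curveDeriv I g 2 α 0 := by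
  rw [Matrix.det_fin_three]
  simp [curveFrame]
  ring

lemma CurveAssumption.abs_le (hg : CurveAssumption I g b₀ b₁ b₂) {α : ℝ} (hα : α ∈ I)
    (i : Fin 2) : |g α i| ≤ b₀ ∧ |curveDeriv I g 1 α i| ≤ b₀ ∧ |curveDeriv I g 2 α i| ≤ b₀ := by
  refine ⟨?_, ?_, ?_⟩
  · have := hg.norm_le 0 (by simp) α hα
    rw [curveDeriv_zero] at this
    exact (abs_coord_le_norm_E2 _ i).trans this
  · exact (abs_coord_le_norm_E2 _ i).trans (hg.norm_le 1 (by simp) α hα)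
  · exact (abs_coord_le_norm_E2 _ i).trans (hg.norm_le 2 (by simp) α hα)

lemma CurveAssumption.nonneg (hI : IsClosedSubinterval I) (hg : CurveAssumption I g b₀ b₁ b₂) :
    0 ≤ b₀ := by
  obtain ⟨a, b, -, hab, -, rfl⟩ := hI
  exact (norm_nonneg _).trans (hg.norm_le 0 (by simp) a ⟨le_rfl, hab.le⟩)

lemma CurveAssumption.entryBound_curveFrame (hg : CurveAssumption I g b₀ b₁ b₂)
    {α : ℝ} (hα : α ∈ I) : EntryBound (curveFrame I g α) (b₀ + 1) := by
  obtain ⟨h1, h2, h3⟩ := hg.abs_le hα 0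
  obtain ⟨h4, h5, h6⟩ := hg.abs_le hα 1
  have hb : 0 ≤ b₀ := (abs_nonneg _).trans h1
  intro i j
  fin_cases i <;> fin_cases j <;> simp [curveFrame] <;> linarith

lemma CurveAssumption.det_le (hg : CurveAssumption I g b₀ b₁ b₂) {α : ℝ} (hα : α ∈ I) :
    |(curveFrame I g α).det| ≤ 2 * b₀ ^ 2 := by
  obtain ⟨-, h2, h3⟩ := hg.abs_le hα 0
  obtain ⟨-, h5, h6⟩ := hg.abs_le hα 1
  have hb : 0 ≤ b₀ := (abs_nonneg _).trans h2
  rw [det_curveFrame]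
  refine (abs_sub _ _).trans ?_
  rw [abs_mul, abs_mul]
  have := mul_le_mul h2 h6 (abs_nonneg _) hb
  have := mul_le_mul h5 h3 (abs_nonneg _) hb
  linarith

lemma CurveAssumption.le_det (hg : CurveAssumption I g b₀ b₁ b₂) {α : ℝ} (hα : α ∈ I) :
    b₂ ≤ |(curveFrame I g α).det| := by
  rw [det_curveFrame]
  exact hg.curvature_ge α hα

lemma CurveAssumption.det_ne_zero (hb₂ : 0 < b₂) (hg : CurveAssumption I g b₀ b₁ b₂) {α : ℝ}
    (hα : α ∈ I) : (curveFrame I g α).det ≠ 0 :=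
  abs_pos.mp (hb₂.trans_le (hg.le_det hα))

/-- The frame at `β` in terms of the frame at `α`. The first row of the error vanishes since the
third coordinate of `u₁` is constant. -/
lemma CurveAssumption.taylor_frame (hb₂ : 0 < b₂) (hI : IsClosedSubinterval I)
    (hg : CurveAssumption I g b₀ b₁ b₂) {α β : ℝ} (hα : α ∈ I) (hβ : β ∈ I) :
    ∃ E : Matrix (Fin 3) (Fin 3) ℝ,
      curveFrame I g β = curveFrame I g α * (shiftMatrix (β - α) + E) ∧ (∀ j, E 0 j = 0) ∧
      ∀ i j, |E i j| ≤ 3 * (2 * (b₀ + 1) ^ 2 / b₂) * b₀ * |β - α| ^ (3 - (j : ℕ)) := by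
  have hb₀ := hg.nonneg hI
  have hdet := hg.det_ne_zero hb₂ hα
  have hinv := (hg.entryBound_curveFrame hα).inv hb₂ (hg.le_det hα)
  set A := curveFrame I g α with hA
  set Δ := curveFrame I g β - A * shiftMatrix (β - α) with hΔ
  have hAE : A * (A⁻¹ * Δ) = Δ := by
    rw [← Matrix.mul_assoc, Matrix.mul_nonsing_inv _ hdet.isUnit, Matrix.one_mul]
  obtain ⟨t0, t1, t2⟩ := hg.taylor hI hα hβ
  have hΔ2 : ∀ j, Δ 2 j = 0 := by
    intro j
    fin_cases j <;> simp [hΔ, hA, curveFrame, shiftMatrix]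
  have hΔb : ∀ k j, |Δ k j| ≤ b₀ * |β - α| ^ (3 - (j : ℕ)) := by
    have c0 := fun i => (abs_coord_le_norm_E2 _ i).trans t0
    have c1 := fun i => (abs_coord_le_norm_E2 _ i).trans t1
    have c2 := fun i => (abs_coord_le_norm_E2 _ i).trans t2
    intro k j
    have hk : ∀ i : Fin 3, i = 2 → |Δ i j| ≤ b₀ * |β - α| ^ (3 - (j : ℕ)) := by
      rintro i rfl
      rw [hΔ2, abs_zero]
      positivity
    have hval : ∀ (i : Fin 2) (i' : Fin 3), (i' = Fin.castSucc i) →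
        Δ i' 0 = (g β - (g α + (β - α) • curveDeriv I g 1 α +
          ((β - α) ^ 2 / 2) • curveDeriv I g 2 α)) i ∧
        Δ i' 1 = (curveDeriv I g 1 β - (curveDeriv I g 1 α + (β - α) • curveDeriv I g 2 α)) i ∧
        Δ i' 2 = (curveDeriv I g 2 β - curveDeriv I g 2 α) i := by
      rintro i i' rfl
      fin_cases i <;> refine ⟨?_, ?_, ?_⟩ <;>
        simp [hΔ, hA, curveFrame, shiftMatrix] <;> ring
    rcases Fin.eq_castSucc_or_eq_last k with ⟨i, hi⟩ | hlast
    · obtain ⟨e0, e1, e2⟩ := hval i k hi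
      fin_cases j
      · exact (congrArg abs e0).trans_le (c0 i)
      · exact (congrArg abs e1).trans_le (c1 i)
      · refine (congrArg abs e2).trans_le ((c2 i).trans_eq ?_)
        simp
    · exact hk k hlast
  refine ⟨A⁻¹ * Δ, ?_, fun j => ?_, fun i j => ?_⟩
  · rw [Matrix.mul_add, hAE, hΔ]
    abel
  · have h1 := congrFun (congrFun hAE 2) j
    rw [hΔ2, Matrix.mul_apply, Fin.sum_univ_three] at h1
    simpa [hA, curveFrame] using h1
  · rw [Matrix.mul_apply]
    refine (Finset.abs_sum_le_sum_abs _ _).trans ?_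
    have h1 : ∀ k ∈ Finset.univ, |A⁻¹ i k * Δ k j| ≤
        2 * (b₀ + 1) ^ 2 / b₂ * (b₀ * |β - α| ^ (3 - (j : ℕ))) := fun k _ => by
      rw [abs_mul]
      exact mul_le_mul (hinv i k) (hΔb k j) (abs_nonneg _) hinv.nonneg
    refine (Finset.sum_le_sum h1).trans_eq ?_
    simp
    ring

/-- The frame of a thin plate in terms of the frame of a nearby thicker plate. -/
lemma CurveAssumption.frame_eq_mul (hb₂ : 0 < b₂) (hI : IsClosedSubinterval I)
    (hg : CurveAssumption I g b₀ b₁ b₂) {α β r θ : ℝ} (hα : α ∈ I) (hβ : β ∈ I) (hr : 0 < r)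
    (hrθ : r ≤ θ) (hθ : θ ≤ 2) (hh : |β - α| ≤ θ) :
    ∃ Y : Matrix (Fin 3) (Fin 3) ℝ,
      curveFrame I g β * pdil r = curveFrame I g α * pdil θ * Y ∧
      EntryBound Y (1 + 8 * (3 * (2 * (b₀ + 1) ^ 2 / b₂) * b₀)) ∧ ∀ x, mlin Y x 0 = x 0 := by
  have hb₀ := hg.nonneg hI
  obtain ⟨E, hE, hE0, hEb⟩ := hg.taylor_frame hb₂ hI hα hβ
  set c := 3 * (2 * (b₀ + 1) ^ 2 / b₂) * b₀ with hc
  have hc0 : 0 ≤ c := by positivity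
  have hθ0 : 0 < θ := hr.trans_le hrθ
  set h := β - α with hh'
  refine ⟨pdil θ⁻¹ * (shiftMatrix h + E) * pdil r, ?_, fun i j => ?_, fun x => ?_⟩
  · rw [hE, Matrix.mul_assoc (pdil θ⁻¹), Matrix.mul_assoc (curveFrame I g α) (pdil θ),
      ← Matrix.mul_assoc (pdil θ), pdil_mul, mul_inv_cancel₀ hθ0.ne', pdil_one, Matrix.one_mul,
      Matrix.mul_assoc]
  · rw [pdil_mul_mul_pdil_apply, Matrix.add_apply, abs_mul, abs_mul,
      abs_of_nonneg (by positivity : 0 ≤ θ⁻¹ ^ (i : ℕ)), abs_of_nonneg (by positivity : 0 ≤ r ^ (j : ℕ))]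
    have hU : |shiftMatrix h i j| * θ ^ (j : ℕ) ≤ θ ^ (i : ℕ) := by
      have h0 := abs_nonneg h
      fin_cases i <;> fin_cases j <;> simp [shiftMatrix] <;> try positivity
      · exact hh
      · rw [abs_div, abs_of_nonneg (sq_nonneg h), ← sq_abs, abs_two]
        nlinarith
      · nlinarith
    have hE' : |E i j| * θ ^ (j : ℕ) ≤ (c * 8) * θ ^ (i : ℕ) := by
      by_cases hi : i = 0
      · subst hi
        rw [hE0]
        simp
        positivity
      · have h1 : |E i j| ≤ c * θ ^ (3 - (j : ℕ)) := (hEb i j).trans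
          (mul_le_mul_of_nonneg_left (pow_le_pow_left₀ (abs_nonneg _) hh _) hc0)
        have h2 : θ ^ (3 - (j : ℕ)) * θ ^ (j : ℕ) = θ ^ 3 := by
          rw [← pow_add]
          congr 1
          omega
        have hθ2 : θ ^ 2 ≤ 4 := by nlinarith
        have h3 : θ ^ 3 ≤ 8 * θ ^ (i : ℕ) := by
          have : i = 1 ∨ i = 2 := by omega
          rcases this with rfl | rfl
          · simp
            nlinarith
          · simp
            nlinarith [sq_nonneg θ]
        calc |E i j| * θ ^ (j : ℕ) ≤ c * θ ^ (3 - (j : ℕ)) * θ ^ (j : ℕ) :=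
              mul_le_mul_of_nonneg_right h1 (by positivity)
          _ = c * θ ^ 3 := by rw [mul_assoc, h2]
          _ ≤ _ := by nlinarith
    have h4 : |shiftMatrix h i j + E i j| * r ^ (j : ℕ) ≤ (1 + 8 * c) * θ ^ (i : ℕ) := by
      calc _ ≤ (|shiftMatrix h i j| + |E i j|) * θ ^ (j : ℕ) :=
            mul_le_mul (abs_add_le _ _) (pow_le_pow_left₀ hr.le hrθ _) (by positivity)
              (by positivity)
        _ ≤ _ := by linarith
    rw [mul_assoc, inv_pow, inv_mul_le_iff₀ (by positivity)]
    linarith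
  · rw [mlin_apply]
    simp only [pdil_mul_mul_pdil_apply, Matrix.add_apply, hE0]
    simp [shiftMatrix]

/-! ### From the curve to the circle -/

/-- The linear map that takes the cone over the parabola `(1, t, t² / 2)` to the circular cone. -/
def parabolaToCone : Matrix (Fin 3) (Fin 3) ℝ := !![1, 0, -1 / 2; 0, 1, 0; 1, 0, 1 / 2]

lemma det_parabolaToCone : parabolaToCone.det = 1 := by
  rw [Matrix.det_fin_three]
  simp [parabolaToCone]
  norm_num

/-- The parameter of the circle that corresponds to the point `t` of the parabola. -/
def coneParam (t : ℝ) : ℝ := Real.arctan (t / 2) / Real.pi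

lemma two_pi_coneParam (t : ℝ) : 2 * Real.pi * coneParam t = 2 * Real.arctan (t / 2) := by
  rw [coneParam]
  field_simp [Real.pi_ne_zero]

lemma cos_coneParam (t : ℝ) :
    Real.cos (2 * Real.pi * coneParam t) = (1 - t ^ 2 / 4) / (1 + t ^ 2 / 4) := by
  rw [two_pi_coneParam, Real.cos_two_mul, Real.cos_sq_arctan]
  have : (1 : ℝ) + t ^ 2 / 4 ≠ 0 := by positivity
  have : (1 : ℝ) + (t / 2) ^ 2 ≠ 0 := by positivity
  field_simp
  ring

lemma sin_coneParam (t : ℝ) : Real.sin (2 * Real.pi * coneParam t) = t / (1 + t ^ 2 / 4) := by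
  have h : Real.sin (Real.arctan (t / 2)) = t / 2 * Real.cos (Real.arctan (t / 2)) := by
    rw [Real.sin_arctan, Real.cos_arctan]
    ring
  rw [two_pi_coneParam, Real.sin_two_mul, h]
  have h2 : 2 * (t / 2 * Real.cos (Real.arctan (t / 2))) * Real.cos (Real.arctan (t / 2)) =
      t * Real.cos (Real.arctan (t / 2)) ^ 2 := by ring
  rw [h2, Real.cos_sq_arctan]
  have : (1 : ℝ) + t ^ 2 / 4 ≠ 0 := by positivity
  have : (1 : ℝ) + (t / 2) ^ 2 ≠ 0 := by positivity
  field_simp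
  ring

lemma coneParam_mem (t : ℝ) : coneParam t ∈ circleInterval := by
  have h1 := Real.neg_pi_div_two_lt_arctan (t / 2)
  have h2 := Real.arctan_lt_pi_div_two (t / 2)
  have hpi := Real.pi_pos
  constructor
  · rw [coneParam, le_div_iff₀ hpi]
    linarith
  · rw [coneParam, div_le_iff₀ hpi]
    linarith

lemma coneParam_separated {t t' : ℝ} (ht : |t| ≤ 1) (ht' : |t'| ≤ 1) :
    |t - t'| / 8 ≤ |coneParam t - coneParam t'| := by
  have key : ∀ x ∈ Set.Icc (-1 / 2 : ℝ) (1 / 2), ∀ y ∈ Set.Icc (-1 / 2 : ℝ) (1 / 2), x ≤ y →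
      4 / 5 * (y - x) ≤ Real.arctan y - Real.arctan x := by
    refine Convex.mul_sub_le_image_sub_of_le_deriv (convex_Icc _ _)
      Real.continuous_arctan.continuousOn Real.differentiable_arctan.differentiableOn ?_
    intro x hx
    rw [interior_Icc] at hx
    rw [Real.deriv_arctan, le_div_iff₀ (by positivity)]
    nlinarith [hx.1, hx.2]
  have main : ∀ t t' : ℝ, |t| ≤ 1 → |t'| ≤ 1 → t' ≤ t →
      |t - t'| / 8 ≤ |coneParam t - coneParam t'| := by
    intro t t' ht ht' hle
    rw [abs_le] at ht ht'
    have h1 := key (t' / 2) ⟨by linarith, by linarith⟩ (t / 2) ⟨by linarith, by linarith⟩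
      (by linarith)
    have h2 : (t - t') / 8 ≤ coneParam t - coneParam t' := by
      rw [coneParam, coneParam, ← sub_div, le_div_iff₀ Real.pi_pos]
      have := Real.pi_lt_d2
      nlinarith
    rw [abs_of_nonneg (by linarith : 0 ≤ t - t')]
    exact h2.trans (le_abs_self _)
  rcases le_total t' t with h | h
  · exact main t t' ht ht' h
  · rw [abs_sub_comm t, abs_sub_comm (coneParam t)]
    exact main t' t ht' ht h

/-- The transition matrix between the rescaled parabolic frame and the circular frame. -/
def transition (t q : ℝ) : Matrix (Fin 3) (Fin 3) ℝ :=
  !![1 + t ^ 2 / 4, q * (t / 2), q ^ 2 * ((t ^ 2 / 8) / (1 + t ^ 2 / 4));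
     0, 1 / (2 * Real.pi), q * (t / (4 * Real.pi * (1 + t ^ 2 / 4)));
     0, 0, 1 / (4 * Real.pi * (1 + t ^ 2 / 4))]

lemma parabolaToCone_mul (t q : ℝ) : parabolaToCone * shiftMatrix t * pdil q =
    circleFrame (coneParam t) q * transition t q := by
  have hρ : (1 : ℝ) + t ^ 2 / 4 ≠ 0 := by positivity
  have hρ' : (4 : ℝ) + t ^ 2 ≠ 0 := by positivity
  have hpi := Real.pi_ne_zero
  ext i j
  rw [pdil, Matrix.mul_diagonal]
  fin_cases i <;> fin_cases j <;>
    simp [parabolaToCone, shiftMatrix, circleFrame, cols, cu₁, cu₂, cu₃, transition,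
      Matrix.mul_apply, Fin.sum_univ_three, cos_coneParam, sin_coneParam] <;>
    field_simp <;> ring

lemma det_transition (t q : ℝ) : (transition t q).det = 1 / (8 * Real.pi ^ 2) := by
  have hρ : (1 : ℝ) + t ^ 2 / 4 ≠ 0 := by positivity
  have hpi := Real.pi_ne_zero
  rw [Matrix.det_fin_three]
  simp [transition]
  field_simp
  norm_num

lemma entryBound_transition {t q : ℝ} (ht : |t| ≤ 1) (hq : 0 < q) (hq1 : q ≤ 1) :
    EntryBound (transition t q) 2 := by
  have ht2 : t ^ 2 ≤ 1 := by rwa [sq_le_one_iff_abs_le_one]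
  have hpi := Real.pi_gt_three
  have hρ : (0 : ℝ) < 1 + t ^ 2 / 4 := by positivity
  have hρ1 : (1 : ℝ) ≤ 1 + t ^ 2 / 4 := by nlinarith [sq_nonneg t]
  have hqq : q ^ 2 ≤ 1 := pow_le_one₀ hq.le hq1
  have e1 : |t ^ 2 / 8 / (1 + t ^ 2 / 4)| ≤ 1 := by
    rw [abs_of_nonneg (by positivity), div_le_one hρ]
    nlinarith [sq_nonneg t]
  have e2 : |t / (4 * Real.pi * (1 + t ^ 2 / 4))| ≤ 1 := by
    rw [abs_div, abs_of_pos (by positivity : 0 < 4 * Real.pi * (1 + t ^ 2 / 4)),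
      div_le_one (by positivity)]
    nlinarith
  have e3 : |1 / (4 * Real.pi * (1 + t ^ 2 / 4))| ≤ 1 := by
    rw [abs_of_pos (by positivity), div_le_one (by positivity)]
    nlinarith
  have e4 : |1 / (2 * Real.pi)| ≤ 1 := by
    rw [abs_of_pos (by positivity), div_le_one (by positivity)]
    nlinarith
  have e5 : |t / 2| ≤ 1 := by rw [abs_div, abs_two]; linarith
  have m1 : ∀ x : ℝ, |x| ≤ 1 → |q * x| ≤ 2 := fun x hx => by
    rw [abs_mul, abs_of_pos hq]
    nlinarith [abs_nonneg x]
  have m2 : ∀ x : ℝ, |x| ≤ 1 → |q ^ 2 * x| ≤ 2 := fun x hx => by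
    rw [abs_mul, abs_of_nonneg (sq_nonneg q)]
    nlinarith [abs_nonneg x]
  intro i j
  fin_cases i <;> fin_cases j
  · change |1 + t ^ 2 / 4| ≤ 2
    rw [abs_of_pos hρ]
    linarith
  · exact m1 _ e5
  · exact m2 _ e1
  · simp [transition]
  · exact e4.trans (by norm_num)
  · exact m1 _ e2
  · simp [transition]
  · simp [transition]
  · exact e3.trans (by norm_num)

lemma le_abs_transition {t q : ℝ} (ht : |t| ≤ 1) (hq : 0 < q) (hq1 : q ≤ 1) (y : E3) :
    |y 0| - 2 * (q * ‖y‖) ≤ |mlin (transition t q) y 0| := by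
  have ht2 : t ^ 2 ≤ 1 := by rwa [sq_le_one_iff_abs_le_one]
  have h0 : |y 0| ≤ |(1 + t ^ 2 / 4) * y 0| := by
    rw [abs_mul, abs_of_pos (by positivity : 0 < 1 + t ^ 2 / 4)]
    exact le_mul_of_one_le_left (abs_nonneg _) (by linarith [sq_nonneg t])
  have h1 : |q * (t / 2) * y 1| ≤ q * ‖y‖ := by
    rw [abs_mul]
    refine mul_le_mul ?_ (abs_coord_le_norm y 1) (abs_nonneg _) hq.le
    rw [abs_mul, abs_of_pos hq, abs_div, abs_two]
    exact mul_le_of_le_one_right hq.le (by linarith)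
  have h2 : |q ^ 2 * ((t ^ 2 / 8) / (1 + t ^ 2 / 4)) * y 2| ≤ q * ‖y‖ := by
    rw [abs_mul]
    refine mul_le_mul ?_ (abs_coord_le_norm y 2) (abs_nonneg _) hq.le
    have h3 : (t ^ 2 / 8) / (1 + t ^ 2 / 4) ≤ 1 := by
      rw [div_le_one (by positivity)]
      linarith [sq_nonneg t]
    have h4 : 0 ≤ (t ^ 2 / 8) / (1 + t ^ 2 / 4) := by positivity
    rw [abs_of_nonneg (by positivity), sq, mul_assoc]
    exact mul_le_of_le_one_right hq.le (mul_le_one₀ hq1 h4 h3)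
  have h3 : mlin (transition t q) y 0 = (1 + t ^ 2 / 4) * y 0 -
      (-(q * (t / 2) * y 1 + q ^ 2 * ((t ^ 2 / 8) / (1 + t ^ 2 / 4)) * y 2)) := by
    rw [mlin_apply]
    simp [transition]
    ring
  have h4 := abs_sub_abs_le_abs_sub ((1 + t ^ 2 / 4) * y 0)
    (-(q * (t / 2) * y 1 + q ^ 2 * ((t ^ 2 / 8) / (1 + t ^ 2 / 4)) * y 2))
  have h5 := abs_add_le (q * (t / 2) * y 1) (q ^ 2 * ((t ^ 2 / 8) / (1 + t ^ 2 / 4)) * y 2)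
  rw [h3]
  rw [abs_neg] at h4
  linarith

/-- On an arc of length `θ` with `θ³ ≲ r²`, one linear map takes the frames of the plates of width
`r` to frames of circular plates of width `r / θ`, up to bounded factors. -/
theorem exists_circle_transfer (b₁ : ℝ) (hb₀ : 0 < b₀) (hb₂ : 0 < b₂) : ∃ D : ℝ, 1 ≤ D ∧
    ∀ (I : Set ℝ) (g : ℝ → E2), IsClosedSubinterval I → CurveAssumption I g b₀ b₁ b₂ →
    ∀ α ∈ I, ∀ r θ : ℝ, 0 < r → r ≤ θ → θ ≤ 2 → θ ^ 3 ≤ 2 * r ^ 2 →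
    ∃ B : Matrix (Fin 3) (Fin 3) ℝ, B.det ≠ 0 ∧ ∀ β ∈ I, |β - α| ≤ θ →
      ∃ N : Matrix (Fin 3) (Fin 3) ℝ,
        curveFrame I g β * pdil r = B * circleFrame (coneParam ((β - α) / θ)) (r / θ) * N ∧
        N.det ≠ 0 ∧ EntryBound N D ∧ EntryBound N⁻¹ D ∧
        ∀ x, |x 0| - D * (r / θ) * ‖x‖ ≤ |mlin N x 0| := by
  set c := 3 * (2 * (b₀ + 1) ^ 2 / b₂) * b₀ with hc
  have hc0 : 0 < c := by positivity
  set D₁ := 3 * 2 * (1 + 12 * c) with hD₁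
  set d := 1 / 80 * (b₂ / (2 * b₀ ^ 2)) with hd
  have hd0 : 0 < d := by positivity
  have hD₁0 : 0 < D₁ := by positivity
  have hD₂0 : 0 < 2 * D₁ ^ 2 / d := by positivity
  refine ⟨2 * D₁ + 2 * D₁ ^ 2 / d + 1, by linarith, ?_⟩
  intro I g hI hg α hα r θ hr hrθ hθ2 hθ3
  have hθ : 0 < θ := hr.trans_le hrθ
  have hFα := hg.det_ne_zero hb₂ hα
  have hJ := det_parabolaToCone
  have hJu : IsUnit parabolaToCone.det := by rw [hJ]; exact isUnit_one
  refine ⟨curveFrame I g α * pdil θ * parabolaToCone⁻¹, ?_, ?_⟩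
  · rw [Matrix.det_mul, Matrix.det_mul, det_pdil, Matrix.det_nonsing_inv, hJ]
    simp [hFα, hθ.ne']
  intro β hβ hh
  obtain ⟨E, hE, hE0, hEb⟩ := hg.taylor_frame hb₂ hI hα hβ
  set h := β - α with hh'
  set t := h / θ with ht
  set q := r / θ with hq
  have hq0 : 0 < q := by positivity
  have hq1 : q ≤ 1 := by rwa [hq, div_le_one hθ]
  have ht1 : |t| ≤ 1 := by rwa [ht, abs_div, abs_of_pos hθ, div_le_one hθ]
  have hθt : θ * t = h := by rw [ht]; field_simp
  have hθq : θ * q = r := by rw [hq]; field_simp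
  set X := shiftMatrix (-h) * E with hX
  have hX0 : ∀ j, X 0 j = 0 := fun j => by
    rw [hX, Matrix.mul_apply, Fin.sum_univ_three]
    simp [shiftMatrix, hE0]
  have hh2 : |h| ≤ 2 := hh.trans hθ2
  have hXb : ∀ i j, |X i j| ≤ 3 * (c * |h| ^ (3 - (j : ℕ))) := by
    intro i j
    have h1 := hEb 1 j
    have h2 := hEb 2 j
    rw [← hc] at h1 h2
    have h0 : 0 ≤ c * |h| ^ (3 - (j : ℕ)) := by positivity
    fin_cases i
    · change |X 0 j| ≤ _
      rw [hX0, abs_zero]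
      positivity
    · have : X 1 j = E 1 j := by
        rw [hX, Matrix.mul_apply, Fin.sum_univ_three]
        simp [shiftMatrix, hE0]
      change |X 1 j| ≤ _
      rw [this]
      linarith
    · have : X 2 j = -h * E 1 j + E 2 j := by
        rw [hX, Matrix.mul_apply, Fin.sum_univ_three]
        simp [shiftMatrix, hE0]
      change |X 2 j| ≤ _
      rw [this]
      refine (abs_add_le _ _).trans ?_
      rw [abs_mul, abs_neg]
      have := mul_le_mul hh2 h1 (abs_nonneg _) (by norm_num)
      linarith
  set G := 1 + pdil r⁻¹ * X * pdil r with hG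
  -- the error terms are controlled by `θ³ ≤ 2 r²`
  have hGb : EntryBound G (1 + 12 * c) := by
    intro i j
    have h1 : |(1 : Matrix (Fin 3) (Fin 3) ℝ) i j| ≤ 1 := by
      by_cases hij : i = j <;> simp [Matrix.one_apply, hij]
    have h2 : |(pdil r⁻¹ * X * pdil r) i j| ≤ 12 * c := by
      rw [pdil_mul_mul_pdil_apply, abs_mul, abs_mul,
        abs_of_nonneg (by positivity : 0 ≤ r⁻¹ ^ (i : ℕ)),
        abs_of_nonneg (by positivity : 0 ≤ r ^ (j : ℕ)), mul_assoc, inv_pow,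
        inv_mul_le_iff₀ (by positivity)]
      by_cases hi : i = 0
      · subst hi
        rw [hX0]
        simp
        positivity
      · have h3 : |X i j| * r ^ (j : ℕ) ≤ 3 * c * θ ^ 3 := by
          have h4 : |h| ^ (3 - (j : ℕ)) * r ^ (j : ℕ) ≤ θ ^ (3 - (j : ℕ)) * θ ^ (j : ℕ) :=
            mul_le_mul (pow_le_pow_left₀ (abs_nonneg _) hh _) (pow_le_pow_left₀ hr.le hrθ _)
              (by positivity) (by positivity)
          rw [← pow_add, Nat.sub_add_cancel (by omega : (j : ℕ) ≤ 3)] at h4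
          calc _ ≤ 3 * (c * |h| ^ (3 - (j : ℕ))) * r ^ (j : ℕ) :=
                mul_le_mul_of_nonneg_right (hXb i j) (by positivity)
            _ = 3 * c * (|h| ^ (3 - (j : ℕ)) * r ^ (j : ℕ)) := by ring
            _ ≤ _ := mul_le_mul_of_nonneg_left h4 (by positivity)
        have h5 : 2 * r ^ 2 ≤ 4 * r ^ (i : ℕ) := by
          have : i = 1 ∨ i = 2 := by omega
          rcases this with rfl | rfl
          · simp
            nlinarith
          · simp
            nlinarith [sq_nonneg r]
        calc _ ≤ 3 * c * θ ^ 3 := h3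
          _ ≤ 3 * c * (4 * r ^ (i : ℕ)) :=
              mul_le_mul_of_nonneg_left (hθ3.trans h5) (by positivity)
          _ = _ := by ring
    rw [hG, Matrix.add_apply]
    exact (abs_add_le _ _).trans (by linarith)
  have hG0 : ∀ x, mlin G x 0 = x 0 := by
    intro x
    rw [mlin_apply, hG]
    simp only [Matrix.add_apply, pdil_mul_mul_pdil_apply, hX0]
    simp
  have hFG : curveFrame I g β * pdil r =
      curveFrame I g α * pdil θ * shiftMatrix t * pdil q * G := by
    have h1 : curveFrame I g α * pdil θ * shiftMatrix t * pdil q =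
        curveFrame I g α * shiftMatrix h * pdil r := by
      rw [Matrix.mul_assoc (curveFrame I g α), ← shiftMatrix_mul_pdil, hθt,
        ← Matrix.mul_assoc, Matrix.mul_assoc _ (pdil θ), pdil_mul, hθq]
    have h2 : pdil r * (pdil r⁻¹ * X * pdil r) = X * pdil r := by
      rw [← Matrix.mul_assoc, ← Matrix.mul_assoc, pdil_mul, mul_inv_cancel₀ hr.ne', pdil_one,
        Matrix.one_mul]
    have h3 : shiftMatrix h * X = E := by
      rw [hX, ← Matrix.mul_assoc, shiftMatrix_mul_neg, Matrix.one_mul]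
    rw [h1, hE, hG, Matrix.mul_add (curveFrame I g α * shiftMatrix h * pdil r), Matrix.mul_one,
      Matrix.mul_assoc _ (pdil r), h2,
      ← Matrix.mul_assoc _ X, Matrix.mul_assoc _ (shiftMatrix h) X, h3, ← Matrix.add_mul,
      ← Matrix.mul_add]
  have hdetG : b₂ / (2 * b₀ ^ 2) ≤ |G.det| := by
    have h1 := congrArg Matrix.det hFG
    simp only [Matrix.det_mul, det_pdil, det_shiftMatrix, mul_one] at h1
    have h2 : (curveFrame I g β).det = (curveFrame I g α).det * G.det := by
      have h3 : θ ^ 3 * q ^ 3 = r ^ 3 := by rw [← mul_pow, hθq]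
      have h4 : (curveFrame I g β).det * r ^ 3 = (curveFrame I g α).det * G.det * r ^ 3 := by
        rw [h1, ← h3]
        ring
      exact mul_right_cancel₀ (by positivity) h4
    have h5 := hg.le_det hβ
    rw [h2, abs_mul] at h5
    rw [div_le_iff₀ (by positivity)]
    have := mul_le_mul_of_nonneg_right (hg.det_le hα) (abs_nonneg G.det)
    linarith
  have hTb := entryBound_transition ht1 hq0 hq1
  have hNb : EntryBound (transition t q * G) D₁ := hTb.mul hGb
  have hNdet : d ≤ |(transition t q * G).det| := by
    rw [Matrix.det_mul, abs_mul, det_transition, abs_of_pos (by positivity)]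
    refine mul_le_mul ?_ hdetG (by positivity) (by positivity)
    have : Real.pi ^ 2 ≤ 10 := by nlinarith [Real.pi_lt_d2, Real.pi_pos]
    exact one_div_le_one_div_of_le (by positivity) (by linarith)
  refine ⟨transition t q * G, ?_, abs_pos.mp (hd0.trans_le hNdet), hNb.mono (by linarith),
    (hNb.inv hd0 hNdet).mono (by linarith), fun x => ?_⟩
  · have h1 : curveFrame I g α * pdil θ * parabolaToCone⁻¹ * circleFrame (coneParam t) q *
        (transition t q * G) = curveFrame I g α * pdil θ * (parabolaToCone⁻¹ *
        (circleFrame (coneParam t) q * transition t q)) * G := by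
      simp only [Matrix.mul_assoc]
    have h2 : parabolaToCone⁻¹ * (parabolaToCone * shiftMatrix t * pdil q) =
        shiftMatrix t * pdil q := by
      rw [Matrix.mul_assoc, ← Matrix.mul_assoc parabolaToCone⁻¹, Matrix.nonsing_inv_mul _ hJu,
        Matrix.one_mul]
    rw [h1, ← parabolaToCone_mul, h2, hFG]
    simp only [Matrix.mul_assoc]
  · have h1 := le_abs_transition ht1 hq0 hq1 (mlin G x)
    rw [hG0] at h1
    rw [mlin_mul]
    have hyn : ‖mlin G x‖ ≤ D₁ * ‖x‖ := (hGb.norm_mlin_le x).trans_eq (by rw [hD₁]; ring)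
    have h6 : q * ‖mlin G x‖ ≤ q * (D₁ * ‖x‖) := mul_le_mul_of_nonneg_left hyn hq0.le
    have h7 : 0 ≤ (2 * D₁ ^ 2 / d + 1) * (q * ‖x‖) := by positivity
    linarith

/-! ### Admissible bump functions in the moving frame -/

/-- The linear functionals that define a plate, in the coordinates of the moving frame. -/
def plateMatrix (I : Set ℝ) (g : ℝ → E2) (α r : ℝ) : Matrix (Fin 3) (Fin 3) ℝ :=
  !![g α 0 ^ 2 + g α 1 ^ 2 + 1,
      r * (g α 0 * curveDeriv I g 1 α 0 + g α 1 * curveDeriv I g 1 α 1),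
      r ^ 2 * (g α 0 * curveDeriv I g 2 α 0 + g α 1 * curveDeriv I g 2 α 1);
    0, curveDeriv I g 1 α 0 ^ 2 + curveDeriv I g 1 α 1 ^ 2,
      r * (curveDeriv I g 1 α 0 * curveDeriv I g 2 α 0 +
        curveDeriv I g 1 α 1 * curveDeriv I g 2 α 1);
    0, 0, curveDeriv I g 1 α 0 * curveDeriv I g 2 α 1 -
      curveDeriv I g 1 α 1 * curveDeriv I g 2 α 0]

lemma u₃_apply (α : ℝ) : u₃ I g α 0 = -curveDeriv I g 1 α 1 ∧ u₃ I g α 1 = curveDeriv I g 1 α 0 ∧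
    u₃ I g α 2 = g α 0 * curveDeriv I g 1 α 1 - g α 1 * curveDeriv I g 1 α 0 := by
  refine ⟨?_, ?_, ?_⟩ <;> simp [u₃, u₁, u₂, cross_apply]

lemma inner_curveFrame (α r : ℝ) (x : E3) :
    inner ℝ (u₁ g α) (mlin (curveFrame I g α * pdil r) x) = mlin (plateMatrix I g α r) x 0 ∧
    inner ℝ (u₂ I g α) (mlin (curveFrame I g α * pdil r) x -
      (mlin (curveFrame I g α * pdil r) x) 2 • u₁ g α) = r * mlin (plateMatrix I g α r) x 1 ∧
    inner ℝ (u₃ I g α) (mlin (curveFrame I g α * pdil r) x) =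
      r ^ 2 * mlin (plateMatrix I g α r) x 2 := by
  obtain ⟨e0, e1, e2⟩ := u₃_apply (I := I) (g := g) α
  have hF : ∀ i j, (curveFrame I g α * pdil r) i j = curveFrame I g α i j * ![1, r, r ^ 2] j :=
    fun i j => by rw [pdil, Matrix.mul_diagonal]
  refine ⟨?_, ?_, ?_⟩
  · rw [inner_E3]
    simp only [mlin_apply, hF]
    simp [curveFrame, plateMatrix, u₁]
    ring
  · rw [inner_E3]
    simp only [PiLp.sub_apply, PiLp.smul_apply, mlin_apply, hF]
    simp [curveFrame, plateMatrix, u₁, u₂]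
    ring
  · rw [inner_E3, e0, e1, e2]
    simp only [mlin_apply, hF]
    simp [curveFrame, plateMatrix]
    ring

lemma CurveAssumption.le_speed_sq (hb₁ : 0 < b₁) (hg : CurveAssumption I g b₀ b₁ b₂) {α : ℝ}
    (hα : α ∈ I) : b₁ ^ 2 ≤ curveDeriv I g 1 α 0 ^ 2 + curveDeriv I g 1 α 1 ^ 2 := by
  have h := pow_le_pow_left₀ hb₁.le (hg.speed_ge α hα) 2
  rwa [EuclideanSpace.real_norm_sq_eq, Fin.sum_univ_two] at h

lemma CurveAssumption.le_det_plateMatrix (hb₁ : 0 < b₁) (hb₂ : 0 < b₂)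
    (hg : CurveAssumption I g b₀ b₁ b₂) {α : ℝ} (hα : α ∈ I) (r : ℝ) :
    b₁ ^ 2 * b₂ ≤ |(plateMatrix I g α r).det| := by
  have h1 := hg.le_speed_sq hb₁ hα
  have h2 := hg.curvature_ge α hα
  have h3 : (plateMatrix I g α r).det = (g α 0 ^ 2 + g α 1 ^ 2 + 1) *
      ((curveDeriv I g 1 α 0 ^ 2 + curveDeriv I g 1 α 1 ^ 2) *
      (curveDeriv I g 1 α 0 * curveDeriv I g 2 α 1 -
        curveDeriv I g 1 α 1 * curveDeriv I g 2 α 0)) := by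
    rw [Matrix.det_fin_three]
    simp [plateMatrix]
    ring
  rw [h3, abs_mul, abs_mul, abs_of_pos (by positivity : 0 < g α 0 ^ 2 + g α 1 ^ 2 + 1),
    abs_of_nonneg (by positivity : 0 ≤ curveDeriv I g 1 α 0 ^ 2 + curveDeriv I g 1 α 1 ^ 2)]
  have h4 := mul_le_mul h1 h2 hb₂.le (by positivity)
  nlinarith [sq_nonneg (g α 0), sq_nonneg (g α 1), mul_pos (pow_pos hb₁ 2) hb₂]

lemma CurveAssumption.entryBound_plateMatrix (hg : CurveAssumption I g b₀ b₁ b₂)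
    {α : ℝ} (hα : α ∈ I) {r : ℝ} (hr : 0 < r) (hr1 : r ≤ 1) :
    EntryBound (plateMatrix I g α r) (3 * (b₀ + 1) ^ 2) ∧
      |plateMatrix I g α r 0 1| ≤ r * (3 * (b₀ + 1) ^ 2) ∧
      |plateMatrix I g α r 0 2| ≤ r * (3 * (b₀ + 1) ^ 2) := by
  obtain ⟨h1, h2, h3⟩ := hg.abs_le hα 0
  obtain ⟨h4, h5, h6⟩ := hg.abs_le hα 1
  have hb : 0 ≤ b₀ := (abs_nonneg _).trans h1
  have hp : ∀ x y : ℝ, |x| ≤ b₀ → |y| ≤ b₀ → |x * y| ≤ b₀ ^ 2 := fun x y hx hy => by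
    rw [abs_mul, sq]
    exact mul_le_mul hx hy (abs_nonneg _) hb
  have hadd : ∀ x y z w : ℝ, |x| ≤ b₀ → |y| ≤ b₀ → |z| ≤ b₀ → |w| ≤ b₀ →
      |x * y + z * w| ≤ 2 * b₀ ^ 2 := fun x y z w hx hy hz hw =>
    (abs_add_le _ _).trans (by linarith [hp x y hx hy, hp z w hz hw])
  have hsub : ∀ x y z w : ℝ, |x| ≤ b₀ → |y| ≤ b₀ → |z| ≤ b₀ → |w| ≤ b₀ →
      |x * y - z * w| ≤ 2 * b₀ ^ 2 := fun x y z w hx hy hz hw =>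
    (abs_sub _ _).trans (by linarith [hp x y hx hy, hp z w hz hw])
  have hr2 : r ^ 2 ≤ r := by nlinarith
  have hrm : ∀ x : ℝ, |x| ≤ 2 * b₀ ^ 2 → |r * x| ≤ r * (3 * (b₀ + 1) ^ 2) := fun x hx => by
    rw [abs_mul, abs_of_pos hr]
    exact mul_le_mul_of_nonneg_left (by nlinarith) hr.le
  have hrm2 : ∀ x : ℝ, |x| ≤ 2 * b₀ ^ 2 → |r ^ 2 * x| ≤ r * (3 * (b₀ + 1) ^ 2) := fun x hx => by
    rw [abs_mul, abs_of_nonneg (sq_nonneg r)]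
    exact mul_le_mul hr2 (by nlinarith) (abs_nonneg _) hr.le
  have hrle : r * (3 * (b₀ + 1) ^ 2) ≤ 3 * (b₀ + 1) ^ 2 :=
    mul_le_of_le_one_left (by positivity) hr1
  have k1 := hrm _ (hadd _ _ _ _ h1 h2 h4 h5)
  have k2 := hrm2 _ (hadd _ _ _ _ h1 h3 h4 h6)
  have k3 := hrm _ (hadd _ _ _ _ h2 h3 h5 h6)
  refine ⟨fun i j => ?_, k1, k2⟩
  fin_cases i <;> fin_cases j
  · change |g α 0 ^ 2 + g α 1 ^ 2 + 1| ≤ _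
    have := hadd _ _ _ _ h1 h1 h4 h4
    rw [← sq, ← sq] at this
    refine (abs_add_le _ _).trans ?_
    rw [abs_one]
    nlinarith
  · exact k1.trans hrle
  · exact k2.trans hrle
  · simp [plateMatrix]; positivity
  · change |curveDeriv I g 1 α 0 ^ 2 + curveDeriv I g 1 α 1 ^ 2| ≤ _
    have := hadd _ _ _ _ h2 h2 h5 h5
    rw [← sq, ← sq] at this
    nlinarith
  · exact k3.trans hrle
  · simp [plateMatrix]; positivity
  · simp [plateMatrix]; positivity
  · have := hsub _ _ _ _ h2 h6 h5 h3
    change |curveDeriv I g 1 α 0 * curveDeriv I g 2 α 1 -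
      curveDeriv I g 1 α 1 * curveDeriv I g 2 α 0| ≤ _
    nlinarith

/-- The frame `(u₁, r u₂, r² u₃)` in terms of the frame `(u₁, r u₁', r² u₁'')`, where `w` are the
coordinates of `u₃` in the frame `(u₁, u₁', u₁'')`. -/
def normalMatrix (w : E3) (r : ℝ) : Matrix (Fin 3) (Fin 3) ℝ :=
  !![1, 0, r ^ 2 * w 0; 0, 1, r * w 1; 0, 0, w 2]

lemma det_normalMatrix (w : E3) (r : ℝ) : (normalMatrix w r).det = w 2 := by
  rw [Matrix.det_fin_three]
  simp [normalMatrix]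

lemma entryBound_normalMatrix {w : E3} {r n : ℝ} (hr : 0 < r) (hr1 : r ≤ 1)
    (hw : ∀ i, |w i| ≤ n) : EntryBound (normalMatrix w r) (1 + n) := by
  have hn : 0 ≤ n := (abs_nonneg _).trans (hw 0)
  have hm : ∀ s x : ℝ, 0 ≤ s → s ≤ 1 → |x| ≤ n → |s * x| ≤ 1 + n := fun s x hs hs1 hx => by
    rw [abs_mul, abs_of_nonneg hs]
    exact (mul_le_of_le_one_left (abs_nonneg _) hs1).trans (by linarith)
  intro i j
  fin_cases i <;> fin_cases j
  · simpa [normalMatrix] using hn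
  · simp [normalMatrix]; positivity
  · exact hm (r ^ 2) (w 0) (by positivity) (pow_le_one₀ hr.le hr1) (hw 0)
  · simp [normalMatrix]; positivity
  · simpa [normalMatrix] using hn
  · exact hm r (w 1) hr.le hr1 (hw 1)
  · simp [normalMatrix]; positivity
  · simp [normalMatrix]; positivity
  · exact (hw 2).trans (by linarith)

lemma curveFrame_mul_normalMatrix {α : ℝ} {w : E3}
    (hw : ∀ i, mlin (curveFrame I g α) w i = u₃ I g α i) (r lam : ℝ) :
    lam • (1 : Matrix (Fin 3) (Fin 3) ℝ) * (curveFrame I g α * pdil r) * normalMatrix w r =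
      cols (lam • u₁ g α) ((lam * r) • u₂ I g α) ((lam * r ^ 2) • u₃ I g α) := by
  have hFp : ∀ i j, (curveFrame I g α * pdil r) i j =
    curveFrame I g α i j * ![1, r, r ^ 2] j := fun i j => by rw [pdil, Matrix.mul_diagonal]
  rw [Matrix.smul_mul, Matrix.one_mul, Matrix.smul_mul]
  ext i j
  rw [Matrix.smul_apply, Matrix.mul_apply, Fin.sum_univ_three, hFp, hFp, hFp, smul_eq_mul]
  have hi := hw i
  rw [mlin_apply] at hi
  fin_cases j
  · fin_cases i <;> simp [cols, normalMatrix, curveFrame, u₁]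
  · fin_cases i <;> simp [cols, normalMatrix, curveFrame, u₂] <;> ring
  · have h1 : cols (lam • u₁ g α) ((lam * r) • u₂ I g α) ((lam * r ^ 2) • u₃ I g α) i 2 =
        lam * r ^ 2 * u₃ I g α i := by
      fin_cases i <;> simp [cols]
    change _ = cols (lam • u₁ g α) ((lam * r) • u₂ I g α) ((lam * r ^ 2) • u₃ I g α) i 2
    rw [h1, ← hi]
    simp [normalMatrix]
    ring

lemma CurveAssumption.abs_u₃_le (hg : CurveAssumption I g b₀ b₁ b₂) {α : ℝ} (hα : α ∈ I)
    (i : Fin 3) : |u₃ I g α i| ≤ 2 * (b₀ + 1) ^ 2 := by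
  obtain ⟨e0, e1, e2⟩ := u₃_apply (I := I) (g := g) α
  obtain ⟨h1, h2, -⟩ := hg.abs_le hα 0
  obtain ⟨h3, h4, -⟩ := hg.abs_le hα 1
  have hb₀ : 0 ≤ b₀ := (abs_nonneg _).trans h1
  have hlin : b₀ ≤ 2 * (b₀ + 1) ^ 2 := by nlinarith
  fin_cases i
  · change |u₃ I g α 0| ≤ _
    rw [e0, abs_neg]
    exact h4.trans hlin
  · change |u₃ I g α 1| ≤ _
    rw [e1]
    exact h2.trans hlin
  · change |u₃ I g α 2| ≤ _
    rw [e2]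
    refine (abs_sub _ _).trans ?_
    rw [abs_mul, abs_mul]
    have := mul_le_mul h1 h4 (abs_nonneg _) hb₀
    have := mul_le_mul h3 h2 (abs_nonneg _) hb₀
    nlinarith

/-- The `u₁''`-component of `u₃` is bounded below, since `⟨u₃, u₁''⟩` is the determinant of the
frame and `|u₃| ≥ |g'|`. -/
lemma CurveAssumption.le_normal_coord (hb₀ : 0 < b₀) (hb₁ : 0 < b₁)
    (hg : CurveAssumption I g b₀ b₁ b₂) {α : ℝ} (hα : α ∈ I) {w : E3}
    (hw : ∀ i, mlin (curveFrame I g α) w i = u₃ I g α i) : b₁ ^ 2 / (2 * b₀ ^ 2) ≤ |w 2| := by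
  obtain ⟨e0, e1, e2⟩ := u₃_apply (I := I) (g := g) α
  have h1 := congrArg Matrix.det (curveFrame_mul_normalMatrix hw 1 1)
  rw [Matrix.det_mul, Matrix.det_mul, Matrix.det_mul, det_normalMatrix, det_pdil, Matrix.det_smul,
    Matrix.det_one] at h1
  have h2 : (cols ((1 : ℝ) • u₁ g α) ((1 * 1 : ℝ) • u₂ I g α)
      ((1 * 1 ^ 2 : ℝ) • u₃ I g α)).det =
      curveDeriv I g 1 α 0 ^ 2 + curveDeriv I g 1 α 1 ^ 2 +
        (g α 0 * curveDeriv I g 1 α 1 - g α 1 * curveDeriv I g 1 α 0) ^ 2 := by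
    rw [Matrix.det_fin_three]
    simp [cols, u₁, u₂, e0, e1, e2]
    ring
  rw [h2] at h1
  simp only [one_pow, one_mul, mul_one] at h1
  have h4 := hg.le_speed_sq hb₁ hα
  have h5 := mul_le_mul_of_nonneg_right (hg.det_le hα) (abs_nonneg (w 2))
  rw [← abs_mul, h1] at h5
  rw [div_le_iff₀ (by positivity)]
  have h6 := le_abs_self (curveDeriv I g 1 α 0 ^ 2 + curveDeriv I g 1 α 1 ^ 2 +
        (g α 0 * curveDeriv I g 1 α 1 - g α 1 * curveDeriv I g 1 α 0) ^ 2)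
  linarith [sq_nonneg (g α 0 * curveDeriv I g 1 α 1 - g α 1 * curveDeriv I g 1 α 0)]

/-- Derivative bounds along `u₁, u₂, u₃` give derivative bounds in the moving frame. -/
lemma exists_derivBound_of_isAdmissibleBump (hb₀ : 0 < b₀) (hb₁ : 0 < b₁)
    (hb₂ : 0 < b₂) : ∃ D : ℝ, 0 ≤ D ∧ ∀ (I : Set ℝ) (g : ℝ → E2), CurveAssumption I g b₀ b₁ b₂ →
    ∀ α ∈ I, ∀ r lam : ℝ, 0 < r → r ≤ 1 → 0 < lam → ∀ φ : E3 → ℂ,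
      IsAdmissibleBump I g (r ^ 2) lam α φ →
      DerivBound (curveFrame I g α * pdil r) D (φ ∘ mlin (lam • 1)) := by
  set f := 2 * (b₀ + 1) ^ 2 / b₂ with hf
  set n := 3 * (f * (2 * (b₀ + 1) ^ 2)) with hn
  have hf0 : 0 < f := by positivity
  set e := b₁ ^ 2 / (2 * b₀ ^ 2) with he
  have he0 : 0 < e := by positivity
  have hpos : 0 ≤ 2 * (1 + n) ^ 2 / e := by positivity
  refine ⟨81 * (6 * (1 + 2 * (1 + n) ^ 2 / e)) ^ 4, by positivity, ?_⟩
  intro I g hg α hα r lam hr hr1 hlam φ hφ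
  have hdet := hg.det_ne_zero hb₂ hα
  have hinv := (hg.entryBound_curveFrame hα).inv hb₂ (hg.le_det hα)
  set w := mlin (curveFrame I g α)⁻¹ (u₃ I g α) with hw
  have hFw : ∀ i, mlin (curveFrame I g α) w i = u₃ I g α i := fun i => by
    rw [hw, mlin_mlin_inv hdet]
  have hwb : ∀ i, |w i| ≤ n := by
    intro i
    rw [hw, mlin_apply]
    refine (abs_add_three _ _ _).trans ?_
    have h1 : ∀ j, |(curveFrame I g α)⁻¹ i j * u₃ I g α j| ≤ f * (2 * (b₀ + 1) ^ 2) := fun j => by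
      rw [abs_mul]
      exact mul_le_mul (hinv i j) (hg.abs_u₃_le hα j) (abs_nonneg _) hf0.le
    rw [hn]
    linarith [h1 0, h1 1, h1 2]
  have hw2 := hg.le_normal_coord hb₀ hb₁ hα hFw
  have hDB : DerivBound (cols (lam • u₁ g α) ((lam * r) • u₂ I g α) ((lam * r ^ 2) • u₃ I g α))
      81 φ := by
    refine DerivBound.of_mixedDeriv hφ.contDiff hlam (by positivity) (by positivity) ?_
    intro n₁ n₂ n₃ hn ξ
    have h1 := hφ.deriv_le n₁ n₂ n₃ hn ξ
    rwa [weight_eq hlam (by positivity), sq_rpow_half hr.le] at h1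
  have hNu : IsUnit (normalMatrix w r).det := by
    rw [det_normalMatrix]
    exact (abs_pos.mp (he0.trans_le hw2)).isUnit
  have hNinv : EntryBound (normalMatrix w r)⁻¹ (1 + 2 * (1 + n) ^ 2 / e) :=
    ((entryBound_normalMatrix hr hr1 hwb).inv he0 (by rwa [det_normalMatrix])).mono (by linarith)
  have h1 := hDB.mul_right hNinv (by linarith)
  rw [← curveFrame_mul_normalMatrix hFw r lam, Matrix.mul_assoc, Matrix.mul_nonsing_inv _ hNu,
    Matrix.mul_one] at h1
  exact h1.comp_mlin

/-- The support of an admissible bump function, in the moving frame. -/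
lemma IsAdmissibleBump.plateMatrix_mem {α r lam : ℝ} (hr : 0 < r) (hlam : 0 < lam) {φ : E3 → ℂ}
    (hφ : IsAdmissibleBump I g (r ^ 2) lam α φ) (x : E3)
    (hx : (φ ∘ mlin (lam • 1)) (mlin (curveFrame I g α * pdil r) x) ≠ 0) :
    mlin (plateMatrix I g α r) x ∈ shell 4 := by
  have hsm : ∀ y : E3, mlin (lam • 1) y = lam • y := fun y => by
    ext i
    rw [mlin_apply]
    fin_cases i <;> simp
  obtain ⟨h1, h2, h3, h4⟩ := hφ.tsupport_subset (subset_tsupport _ hx)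
  obtain ⟨e1, e2, e3⟩ := inner_curveFrame (I := I) (g := g) α r x
  set η := mlin (curveFrame I g α * pdil r) x with hη
  set y := mlin (plateMatrix I g α r) x with hy
  have e4 : lam • η - (lam • η) 2 • u₁ g α = lam • (η - η 2 • u₁ g α) := by
    rw [smul_sub, PiLp.smul_apply, smul_smul, smul_eq_mul]
  rw [hsm, inner_smul_right, e1, abs_mul, abs_of_pos hlam] at h1 h2
  rw [hsm, e4, inner_smul_right, e2, sq_rpow_half hr.le, abs_mul, abs_of_pos hlam, abs_mul,
    abs_of_pos hr] at h3
  rw [hsm, inner_smul_right, e3, abs_mul, abs_of_pos hlam, abs_mul,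
    abs_of_pos (by positivity : 0 < r ^ 2)] at h4
  have k1 : 1 / 2 ≤ |y 0| := by nlinarith
  have k2 : |y 0| ≤ 2 := by nlinarith
  have k3 : |y 1| ≤ 1 := by
    have : lam * r * |y 1| ≤ lam * r * 1 := by linarith
    exact le_of_mul_le_mul_left this (by positivity)
  have k4 : |y 2| ≤ 1 := by
    have : lam * r ^ 2 * |y 2| ≤ lam * r ^ 2 * 1 := by linarith
    exact le_of_mul_le_mul_left this (by positivity)
  refine ⟨?_, by norm_num; linarith⟩
  refine (norm_le_of_coord (C := 2) fun i => ?_).trans (by norm_num)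
  fin_cases i
  · exact k2
  · exact k3.trans (by norm_num)
  · exact k4.trans (by norm_num)

end Curve

/-! ### Separated parameters -/

section Separated

variable {ι : Type} {x : ι → ℝ} {ρ θ : ℝ}

lemma floor_injective_of_separated (hρ : 0 < ρ) (h : ∀ i j, i ≠ j → ρ ≤ |x i - x j|) :
    Function.Injective fun i => ⌊x i / ρ⌋ := by
  intro i j hij
  by_contra hne
  have h1 := Int.abs_sub_lt_one_of_floor_eq_floor hij
  rw [← sub_div, abs_div, abs_of_pos hρ, div_lt_one hρ] at h1
  exact (h i j hne).not_gt h1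

lemma abs_sub_le_of_floor_eq (hρ : 0 < ρ) {a b : ℝ} (h : ⌊a / ρ⌋ = ⌊b / ρ⌋) : |a - b| ≤ ρ := by
  have h1 := Int.abs_sub_lt_one_of_floor_eq_floor h
  rw [← sub_div, abs_div, abs_of_pos hρ, div_lt_one hρ] at h1
  exact h1.le

lemma card_le_of_separated [Fintype ι] (hρ : 0 < ρ) (hθ : 0 ≤ θ)
    (h : ∀ i j, i ≠ j → ρ ≤ |x i - x j|) (hx : ∀ i j, x i - x j ≤ θ) :
    (Fintype.card ι : ℝ) ≤ θ / ρ + 1 := by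
  rcases isEmpty_or_nonempty ι with hι | hι
  · simp only [Fintype.card_eq_zero, Nat.cast_zero]
    positivity
  obtain ⟨m, -, hm⟩ := Finset.exists_min_image Finset.univ x Finset.univ_nonempty
  have hinj : Function.Injective fun i => ⌊(x i - x m) / ρ⌋ :=
    floor_injective_of_separated (x := fun i => x i - x m) hρ fun i j hij => by
      simpa using h i j hij
  have hmaps : ∀ i ∈ (Finset.univ : Finset ι), ⌊(x i - x m) / ρ⌋ ∈ Finset.Icc 0 ⌊θ / ρ⌋ := by
    intro i hi
    have h0 : 0 ≤ x i - x m := sub_nonneg.mpr (hm i hi)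
    exact Finset.mem_Icc.mpr ⟨Int.floor_nonneg.mpr (by positivity),
      Int.floor_le_floor (div_le_div_of_nonneg_right (hx i m) hρ.le)⟩
  have hc := Finset.card_le_card_of_injOn _ hmaps hinj.injOn
  rw [Int.card_Icc, Finset.card_univ] at hc
  have h0 : 0 ≤ ⌊θ / ρ⌋ := Int.floor_nonneg.mpr (by positivity)
  have h2 : (Fintype.card ι : ℤ) ≤ ⌊θ / ρ⌋ + 1 := by omega
  have h3 : (Fintype.card ι : ℝ) ≤ ⌊θ / ρ⌋ + 1 := by exact_mod_cast h2
  linarith [Int.floor_le (θ / ρ)]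

/-- Distinct cells of width `ρ` whose indices agree modulo `M` lie `(M - 1) ρ` apart. -/
lemma le_abs_sub_of_floor_modEq (hρ : 0 < ρ) {M : ℕ} {a b : ℝ} (hne : ⌊a / ρ⌋ ≠ ⌊b / ρ⌋)
    (h : ((⌊a / ρ⌋ : ℤ) : ZMod M) = (⌊b / ρ⌋ : ℤ)) : ((M : ℝ) - 1) * ρ ≤ |a - b| := by
  have hdvd : (M : ℤ) ∣ ⌊a / ρ⌋ - ⌊b / ρ⌋ := by
    rw [← ZMod.intCast_zmod_eq_zero_iff_dvd]
    push_cast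
    rw [h, sub_self]
  have h1 : (M : ℤ) ≤ |⌊a / ρ⌋ - ⌊b / ρ⌋| :=
    Int.le_of_dvd (abs_pos.mpr (sub_ne_zero.mpr hne)) ((dvd_abs _ _).mpr hdvd)
  have h2 : (M : ℝ) ≤ |(⌊a / ρ⌋ : ℝ) - ⌊b / ρ⌋| := by exact_mod_cast h1
  have h3 : |(⌊a / ρ⌋ : ℝ) - ⌊b / ρ⌋| ≤ |a / ρ - b / ρ| + 1 := by
    have e1 := Int.floor_le (a / ρ)
    have e2 := Int.lt_floor_add_one (a / ρ)
    have e3 := Int.floor_le (b / ρ)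
    have e4 := Int.lt_floor_add_one (b / ρ)
    have e5 := le_abs_self (a / ρ - b / ρ)
    have e6 := neg_abs_le (a / ρ - b / ρ)
    exact abs_le.mpr ⟨by linarith, by linarith⟩
  rw [← sub_div, abs_div, abs_of_pos hρ] at h3
  rw [← le_div_iff₀ hρ]
  linarith

end Separated

section Induction

variable {p : ℝ} [Fact (1 ≤ ENNReal.ofReal p)]

lemma SchwartzDecomposition.of_isEmpty {ι : Type} [Fintype ι] [IsEmpty ι] {φ : ι → E3 → ℂ} {K : ℝ}
    (hK : 0 ≤ K) : SchwartzDecomposition p φ K := by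
  classical
  exact (SchwartzDecomposition.of_single le_rfl fun i => isEmptyElim i).mono (by simpa using hK)

/-- A family with one member in each cell of width `ρ` splits into `M` families that are
`(M - 1) ρ`-separated. -/
lemma SchwartzDecomposition.of_separated_classes {ι : Type} [Fintype ι] {x : ι → ℝ} {ρ : ℝ}
    (hρ : 0 < ρ) (hinj : Function.Injective fun i => ⌊x i / ρ⌋) (M : ℕ) [NeZero M]
    {φ : ι → E3 → ℂ} {K : ℝ} (hK : 0 ≤ K)
    (h : ∀ (κ : Type) [Fintype κ] (f : κ → ι), Function.Injective f →
      (∀ i j, i ≠ j → ((M : ℝ) - 1) * ρ ≤ |x (f i) - x (f j)|) →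
      SchwartzDecomposition p (fun i => φ (f i)) K) :
    SchwartzDecomposition p φ (M * K) := by
  classical
  have h1 := SchwartzDecomposition.of_classes (p := p) (φ := φ)
    (fun i => ((⌊x i / ρ⌋ : ℤ) : ZMod M)) hK fun k =>
      h _ (fun i : {i // ((⌊x i / ρ⌋ : ℤ) : ZMod M) = k} => (i : ι)) Subtype.val_injective
        fun i j hij => le_abs_sub_of_floor_modEq hρ
          (fun hfl => hij (Subtype.ext (hinj hfl))) (i.2.trans j.2.symm)
  rwa [ZMod.card] at h1

/-! ### Families of bump functions adapted to a curve -/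

variable {I : Set ℝ} {g : ℝ → E2} {b₀ b₁ b₂ r θ C R : ℝ}

/-- The functions `φ i` are bump functions in the moving frame of the curve at the parameters
`α i`, scaled by `(1, r, r²)`; the parameters are `r`-separated and spread over at most `θ`. -/
structure IsAdapted (I : Set ℝ) (g : ℝ → E2) (r θ C R : ℝ) {ι : Type} (α : ι → ℝ)
    (φ : ι → E3 → ℂ) : Prop where
  mem : ∀ i, α i ∈ I
  separated : ∀ i j, i ≠ j → r ≤ |α i - α j|
  spread : ∀ i j, |α i - α j| ≤ θ
  deriv : ∀ i, DerivBound (curveFrame I g (α i) * pdil r) C (φ i)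
  supp : ∀ i, SuppIn (curveFrame I g (α i) * pdil r) (shell R) (φ i)

lemma IsAdapted.comp {ι κ : Type} {α : ι → ℝ} {φ : ι → E3 → ℂ}
    (h : IsAdapted I g r θ C R α φ) {f : κ → ι} (hf : Function.Injective f) :
    IsAdapted I g r θ C R (fun i => α (f i)) (fun i => φ (f i)) :=
  ⟨fun _ => h.mem _, fun _ _ hij => h.separated _ _ (hf.ne hij), fun _ _ => h.spread _ _,
    fun _ => h.deriv _, fun _ => h.supp _⟩

lemma CurveAssumption.det_frame_ne_zero (hb₂ : 0 < b₂) (hg : CurveAssumption I g b₀ b₁ b₂)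
    (hr : 0 < r) {a : ℝ} (ha : a ∈ I) : (curveFrame I g a * pdil r).det ≠ 0 := by
  rw [Matrix.det_mul, det_pdil]
  exact mul_ne_zero (hg.det_ne_zero hb₂ ha) (by positivity)

lemma IsAdapted.hasTemperateGrowth (hb₂ : 0 < b₂) (hg : CurveAssumption I g b₀ b₁ b₂)
    (hr : 0 < r) {ι : Type} {α : ι → ℝ} {φ : ι → E3 → ℂ} (h : IsAdapted I g r θ C R α φ) (i : ι) :
    (φ i).HasTemperateGrowth :=
  (h.deriv i).hasTemperateGrowth (hg.det_frame_ne_zero hb₂ hr (h.mem i)) (h.supp i)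
    fun _ hx => hx.1

/-- The decomposition inequality holds with constant `O((θ / r) ^ s)` for all families adapted to
curves with the bounds `b₀, b₁, b₂`. -/
def AdaptedBound (p : ℝ) [Fact (1 ≤ ENNReal.ofReal p)] (b₀ b₁ b₂ s : ℝ) : Prop :=
  ∀ C R : ℝ, 0 ≤ C → 1 ≤ R → ∃ K : ℝ, 0 ≤ K ∧ ∀ (I : Set ℝ) (g : ℝ → E2),
    IsClosedSubinterval I → CurveAssumption I g b₀ b₁ b₂ → ∀ r θ : ℝ, 0 < r → r ≤ θ → θ ≤ 2 →
    ∀ (ι : Type) [Fintype ι] (α : ι → ℝ) (φ : ι → E3 → ℂ), IsAdapted I g r θ C R α φ →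
      SchwartzDecomposition p φ (K * (θ / r) ^ s)

lemma WolffInequality.adaptedBound_one (hW : WolffInequality p) (b₀ b₁ : ℝ) (hb₂ : 0 < b₂) :
    AdaptedBound p b₀ b₁ b₂ 1 := by
  classical
  intro C R hC hR
  obtain ⟨K, hK, h⟩ := hW.single C R hC hR
  refine ⟨2 * K, by positivity, fun I g hI hg r θ hr hrθ hθ ι _ α φ hα => ?_⟩
  have h1 : SchwartzDecomposition p φ (Fintype.card ι * K) :=
    SchwartzDecomposition.of_single hK fun i =>
      h _ _ (hg.det_frame_ne_zero hb₂ hr (hα.mem i)) (hα.deriv i) (hα.supp i)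
  have h2 := card_le_of_separated hr (hr.le.trans hrθ) hα.separated
    fun i j => (le_abs_self _).trans (hα.spread i j)
  have h3 : 1 ≤ θ / r := (one_le_div hr).mpr hrθ
  refine h1.mono ?_
  rw [Real.rpow_one]
  nlinarith

/-- If `θ³ ≤ 2 r²`, the curve is approximated by a circle well enough for Wolff's inequality to
apply. -/
lemma WolffInequality.short_arc (hW : WolffInequality p) {ε : ℝ} (hε : 0 < ε) (b₁ : ℝ)
    (hb₀ : 0 < b₀) (hb₂ : 0 < b₂) (C R : ℝ) (hC : 0 ≤ C) (hR : 1 ≤ R) :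
    ∃ K : ℝ, 0 ≤ K ∧ ∀ (I : Set ℝ) (g : ℝ → E2),
    IsClosedSubinterval I → CurveAssumption I g b₀ b₁ b₂ → ∀ r θ : ℝ, 0 < r → r ≤ θ → θ ≤ 2 →
    θ ^ 3 ≤ 2 * r ^ 2 →
    ∀ (ι : Type) [Fintype ι] (α : ι → ℝ) (φ : ι → E3 → ℂ), IsAdapted I g r θ C R α φ →
      SchwartzDecomposition p φ (K * (θ / r) ^ (-2 * (2 / p - 1 / 2 - ε))) := by
  obtain ⟨D, hD, htr⟩ := exists_circle_transfer b₁ hb₀ hb₂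
  obtain ⟨K₁, hK₁, h₁⟩ := hW.adaptedBound_one b₀ b₁ hb₂ C R hC hR
  set R' := 6 * D * R with hR'
  have hRR' : 2 * R ≤ R' := by rw [hR']; nlinarith
  obtain ⟨K₂, hK₂, h₂⟩ := hW.shell hε (C * (6 * D) ^ 4) R' (by positivity) (by linarith)
  have hE := hW.exponent_nonpos hε
  set e := 2 / p - 1 / 2 - ε with he
  set M : ℕ := ⌈640 * R' ^ 2⌉₊ + 1 with hM
  have hM1 : 640 * R' ^ 2 ≤ (M : ℝ) - 1 := by
    rw [hM]; push_cast
    linarith [Nat.le_ceil (640 * R' ^ 2)]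
  set m := 80 * R' ^ 2 + 2 * D * R ^ 2 with hm
  have hm0 : 0 < m := by rw [hm]; nlinarith
  refine ⟨K₁ * m + M * K₂, by positivity, fun I g hI hg r θ hr hrθ hθ hθr ι _ α φ hα => ?_⟩
  have hθ0 : 0 < θ := hr.trans_le hrθ
  have hT1 : 1 ≤ θ / r := (one_le_div hr).mpr hrθ
  have hTE : 1 ≤ (θ / r) ^ (-2 * e) := Real.one_le_rpow hT1 (by linarith)
  by_cases hq : r / θ * m ≤ 1
  swap
  · refine (h₁ I g hI hg r θ hr hrθ hθ ι α φ hα).mono ?_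
    rw [Real.rpow_one]
    have h3 : θ / r ≤ m := by
      rw [not_le, div_mul_eq_mul_div, one_lt_div hθ0] at hq
      rw [div_le_iff₀ hr]
      linarith
    have h4 : K₁ * (θ / r) ≤ K₁ * m := mul_le_mul_of_nonneg_left h3 hK₁
    have h5 : 0 ≤ K₁ * m := by positivity
    have h6 : 0 ≤ M * K₂ := by positivity
    nlinarith
  rcases isEmpty_or_nonempty ι with hι | ⟨⟨i₀⟩⟩
  · exact SchwartzDecomposition.of_isEmpty (by positivity)
  set q := r / θ with hqd
  have hq0 : 0 < q := by positivity
  have hq1 : q * (80 * R' ^ 2) ≤ 1 := by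
    have : 0 ≤ q * (2 * D * R ^ 2) := by positivity
    rw [hm] at hq
    linarith
  have hq2 : q * (2 * D * R ^ 2) ≤ 1 := by
    have : 0 ≤ q * (80 * R' ^ 2) := by positivity
    rw [hm] at hq
    linarith
  obtain ⟨B, hB, hN⟩ := htr I g hI hg (α i₀) (hα.mem i₀) r θ hr hrθ hθ hθr
  have ht : ∀ i, |(α i - α i₀) / θ| ≤ 1 := fun i => by
    rw [abs_div, abs_of_pos hθ0, div_le_one hθ0]
    exact hα.spread i i₀
  have hqT : (q ^ 2) ^ e = (θ / r) ^ (-2 * e) := by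
    rw [← Real.rpow_natCast, ← Real.rpow_mul hq0.le, hqd, ← inv_div θ r,
      Real.inv_rpow (by positivity), ← Real.rpow_neg (by positivity)]
    congr 1
    push_cast
    ring
  have hsplit : SchwartzDecomposition p (fun i => φ i ∘ mlin B) (M * (K₂ * (q ^ 2) ^ e)) := by
    refine SchwartzDecomposition.of_separated_classes hr
      (floor_injective_of_separated hr hα.separated) M (by positivity) fun κ _ f _ hsep => ?_
    refine h₂ q hq0 hq1 κ (fun i => coneParam ((α (f i) - α i₀) / θ)) _
      (fun i => coneParam_mem _) (fun i j hij => ?_) (fun i => ?_) fun i y hy => ?_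
    · refine le_trans ?_ (coneParam_separated (ht (f i)) (ht (f j)))
      rw [← sub_div, sub_sub_sub_cancel_right, abs_div, abs_of_pos hθ0]
      have h3 := (mul_le_mul_of_nonneg_right hM1 hr.le).trans (hsep i j hij)
      rw [hqd, le_div_iff₀ (by norm_num), div_mul_eq_mul_div, div_mul_eq_mul_div]
      exact div_le_div_of_nonneg_right (by linarith) hθ0.le
    · obtain ⟨N, hN1, hN2, hN3, hN4, -⟩ := hN (α (f i)) (hα.mem _) (hα.spread _ _)
      have h3 := (hα.deriv (f i)).mul_right hN4 hD
      rw [hN1, Matrix.mul_assoc, Matrix.mul_nonsing_inv _ hN2.isUnit, Matrix.mul_one] at h3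
      exact h3.comp_mlin
    · obtain ⟨N, hN1, hN2, hN3, hN4, hN5⟩ := hN (α (f i)) (hα.mem _) (hα.spread _ _)
      have h3 := hα.supp (f i) (mlin N⁻¹ y) (by
        rw [hN1, mlin_mul, mlin_mlin_inv hN2, mlin_mul]
        exact hy)
      have h4 := hN3.norm_mlin_le (mlin N⁻¹ y)
      have h5 := hN5 (mlin N⁻¹ y)
      rw [mlin_mlin_inv hN2] at h4 h5
      refine ⟨h4.trans (mul_le_mul_of_nonneg_left h3.1 (by positivity)), ?_⟩
      have h6 : D * q * ‖mlin N⁻¹ y‖ ≤ D * q * R := mul_le_mul_of_nonneg_left h3.1 (by positivity)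
      have h7 : D * q * R ≤ (2 * R)⁻¹ := by
        rw [← one_div, le_div_iff₀ (by positivity)]
        linarith
      have h8 : R⁻¹ = (2 * R)⁻¹ + (2 * R)⁻¹ := by
        field_simp; norm_num
      have h9 : R'⁻¹ ≤ (2 * R)⁻¹ := inv_anti₀ (by positivity) hRR'
      have h10 := h3.2
      linarith
  have h3 := SchwartzDecomposition.of_comp_mlin
    (fun i => hα.hasTemperateGrowth hb₂ hg hr i) hB hsplit
  refine h3.mono ?_
  rw [hqT]
  have h6 : 0 ≤ K₁ * m * (θ / r) ^ (-2 * e) := by positivity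
  linarith

/-- One step of the induction on scales: the arc of length `θ` is cut into arcs of the
intermediate length `θ' = r (θ / r) ^ (1/3)`. Within each short arc the curve is close to a circle,
and the short arcs themselves are localized by bump functions adapted to the curve at scale
`θ'`. -/
lemma WolffInequality.adaptedBound_step (hW : WolffInequality p) {ε : ℝ} (hε : 0 < ε)
    (hb₀ : 0 < b₀) (hb₂ : 0 < b₂) {s : ℝ} (hs : AdaptedBound p b₀ b₁ b₂ s) :
    AdaptedBound p b₀ b₁ b₂ ((2 * s + -2 * (2 / p - 1 / 2 - ε)) / 3) := by
  classical
  intro C R hC hR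
  obtain ⟨K₂, hK₂, h₂⟩ := hW.short_arc hε b₁ hb₀ hb₂ C R hC hR
  set Y := 1 + 8 * (3 * (2 * (b₀ + 1) ^ 2 / b₂) * b₀) with hY
  have hY1 : 1 ≤ Y := by
    have : 0 ≤ 8 * (3 * (2 * (b₀ + 1) ^ 2 / b₂) * b₀) := by positivity
    linarith
  set ρ := 6 * Y * R with hρ
  have hRρ : R ≤ ρ := by rw [hρ]; nlinarith
  have hcoord : Continuous fun x : E3 => |x 0| := by fun_prop
  obtain ⟨χ, hχs, hχc, hχ1, hχU⟩ := exists_cutoff (K := {x : E3 | ‖x‖ ≤ ρ ∧ R⁻¹ ≤ |x 0|})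
    (U := {x : E3 | ‖x‖ < 2 * ρ ∧ (2 * R)⁻¹ < |x 0|}) (ρ := 2 * ρ)
    ((isClosed_le continuous_norm continuous_const).inter (isClosed_le continuous_const hcoord))
    ((isOpen_lt continuous_norm continuous_const).inter (isOpen_lt continuous_const hcoord))
    (fun x hx => ⟨by have := hx.1; linarith, (inv_strictAnti₀ (by positivity)
      (by linarith)).trans_le hx.2⟩) fun x hx => hx.1.le
  obtain ⟨Dχ, hDχ⟩ := exists_derivBound hχs hχc
  obtain ⟨K₁, hK₁, h₁⟩ := hs Dχ (2 * ρ) hDχ.nonneg (by linarith)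
  refine ⟨2 * K₁ * K₂, by positivity, fun I g hI hg r θ hr hrθ hθ ι _ α φ hα => ?_⟩
  have hθ0 : 0 < θ := hr.trans_le hrθ
  set T := θ / r with hT
  have hT1 : 1 ≤ T := (one_le_div hr).mpr hrθ
  have hT0 : 0 < T := by positivity
  have hθT : θ = r * T := by rw [hT]; field_simp
  set θ' := r * T ^ (1 / 3 : ℝ) with hθ'
  have hrθ' : r ≤ θ' := by
    have := Real.one_le_rpow hT1 (by norm_num : (0 : ℝ) ≤ 1 / 3)
    rw [hθ']; nlinarith
  have hθ'θ : θ' ≤ θ := by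
    have h3 : T ^ (1 / 3 : ℝ) ≤ T ^ (1 : ℝ) := Real.rpow_le_rpow_of_exponent_le hT1 (by norm_num)
    rw [Real.rpow_one] at h3
    rw [hθ', hθT]
    exact mul_le_mul_of_nonneg_left h3 hr.le
  have hθ'0 : 0 < θ' := hr.trans_le hrθ'
  have hcube : θ' ^ 3 ≤ 2 * r ^ 2 := by
    have h3 : (T ^ (1 / 3 : ℝ)) ^ 3 = T := by
      rw [← Real.rpow_natCast, ← Real.rpow_mul hT0.le]
      norm_num
    have h4 : θ' ^ 3 = r ^ 2 * θ := by
      rw [hθ', mul_pow, h3, hθT]; ring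
    rw [h4]
    nlinarith [sq_nonneg r]
  -- the short arcs, with a representative in each
  let κ := Set.range fun i => ⌊α i / θ'⌋
  let cls : ι → κ := fun i => ⟨⌊α i / θ'⌋, i, rfl⟩
  choose rep hrep using fun k : κ => k.2
  have hrep' : ∀ k : κ, ⌊α (rep k) / θ'⌋ = (k : ℤ) := hrep
  have hnear : ∀ i, |α i - α (rep (cls i))| ≤ θ' := fun i =>
    abs_sub_le_of_floor_eq hθ'0 (hrep' (cls i)).symm
  have hdet : ∀ k, (curveFrame I g (α (rep k)) * pdil θ').det ≠ 0 := fun k =>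
    hg.det_frame_ne_zero hb₂ hθ'0 (hα.mem _)
  set Ψ : κ → E3 → ℂ := fun k => χ ∘ mlin (curveFrame I g (α (rep k)) * pdil θ')⁻¹ with hΨ
  have hΨd : ∀ k, DerivBound (curveFrame I g (α (rep k)) * pdil θ') Dχ (Ψ k) := fun k => by
    refine DerivBound.comp_mlin ?_
    rwa [Matrix.nonsing_inv_mul _ (hdet k).isUnit]
  have hΨs : ∀ k, SuppIn (curveFrame I g (α (rep k)) * pdil θ') (ConePlates.shell (2 * ρ)) (Ψ k) := by
    intro k x hx
    simp only [hΨ, Function.comp_apply, mlin_inv_mlin (hdet k)] at hx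
    obtain ⟨h3, h4⟩ := hχU x hx
    exact ⟨h3.le, (inv_anti₀ (by positivity) (by linarith)).trans h4.le⟩
  have hmul : ∀ i, Ψ (cls i) * φ i = φ i := by
    intro i
    funext ξ
    rw [Pi.mul_apply]
    rcases eq_or_ne (φ i ξ) 0 with h0 | h0
    · rw [h0, mul_zero]
    have hd := hg.det_frame_ne_zero hb₂ hr (hα.mem i)
    have h3 := hα.supp i (mlin (curveFrame I g (α i) * pdil r)⁻¹ ξ)
      (by rwa [mlin_mlin_inv hd])
    obtain ⟨Z, hZ1, hZ2, hZ3⟩ := hg.frame_eq_mul hb₂ hI (hα.mem (rep (cls i))) (hα.mem i) hr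
      hrθ' (hθ'θ.trans hθ) (hnear i)
    set x := mlin (curveFrame I g (α i) * pdil r)⁻¹ ξ with hx
    have h4 : mlin (curveFrame I g (α (rep (cls i))) * pdil θ')⁻¹ ξ = mlin Z x := by
      rw [← mlin_mlin_inv hd ξ, ← hx, hZ1, mlin_mul, mlin_inv_mlin (hdet (cls i))]
    have h5 : Ψ (cls i) ξ = 1 := by
      simp only [hΨ, Function.comp_apply, h4]
      refine hχ1 _ ⟨(hZ2.norm_mlin_le x).trans ?_, ?_⟩
      · exact mul_le_mul_of_nonneg_left h3.1 (by positivity)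
      · rw [hZ3]
        exact h3.2
    rw [h5, one_mul]
  have hbetween : SchwartzDecomposition p Ψ ((2 : ℕ) * (K₁ * (θ / θ') ^ s)) := by
    refine SchwartzDecomposition.of_separated_classes (x := fun k => α (rep k)) hθ'0
      (fun k l hkl => ?_) 2 (by positivity) fun μ _ f _ hsep => ?_
    · exact Subtype.ext ((hrep' k).symm.trans (hkl.trans (hrep' l)))
    · refine h₁ I g hI hg θ' θ hθ'0 hθ'θ hθ μ (fun k => α (rep (f k))) _
        ⟨fun _ => hα.mem _, fun k l hkl => ?_, fun _ _ => hα.spread _ _,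
          fun _ => hΨd _, fun _ => hΨs _⟩
      have := hsep k l hkl
      norm_num at this
      exact this
  have hwithin : ∀ k, SchwartzDecomposition p (fun i : {i // cls i = k} => φ i)
      (K₂ * (θ' / r) ^ (-2 * (2 / p - 1 / 2 - ε))) := by
    intro k
    have h3 := hα.comp (f := fun i : {i // cls i = k} => (i : ι)) Subtype.val_injective
    refine h₂ I g hI hg r θ' hr hrθ' (hθ'θ.trans hθ) hcube _ _ _
      ⟨h3.mem, h3.separated, fun i j => ?_, h3.deriv, h3.supp⟩
    exact abs_sub_le_of_floor_eq hθ'0 (congrArg Subtype.val (i.2.trans j.2.symm))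
  have h3 := SchwartzDecomposition.comp (p := p) cls (by positivity) (by positivity)
    (fun i => hα.hasTemperateGrowth hb₂ hg hr i)
    (fun k => (hΨd k).hasTemperateGrowth (hdet k) (hΨs k) fun _ hx => hx.1) hmul hbetween hwithin
  refine h3.mono (le_of_eq ?_)
  set E := -2 * (2 / p - 1 / 2 - ε)
  have h4 : θ' / r = T ^ (1 / 3 : ℝ) := by rw [hθ']; field_simp
  have h5 : θ / θ' = T ^ (2 / 3 : ℝ) := by
    rw [div_eq_iff hθ'0.ne', hθ', mul_left_comm, ← Real.rpow_add hT0, hθT]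
    norm_num
  rw [h4, h5, ← Real.rpow_mul hT0.le, ← Real.rpow_mul hT0.le]
  have h6 : T ^ ((2 * s + E) / 3) = T ^ (2 / 3 * s) * T ^ (1 / 3 * E) := by
    rw [← Real.rpow_add hT0]
    congr 1
    ring
  rw [h6]
  push_cast
  ring

/-- Iterating the step moves the exponent geometrically from `1` towards the exponent of the
circle. -/
theorem WolffInequality.adaptedBound (hW : WolffInequality p) {ε : ℝ} (hε : 0 < ε) (b₁ : ℝ)
    (hb₀ : 0 < b₀) (hb₂ : 0 < b₂) : AdaptedBound p b₀ b₁ b₂ (-2 * (2 / p - 1 / 2 - ε)) := by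
  set E := -2 * (2 / p - 1 / 2 - ε / 2) with hE
  have hiter : ∀ n : ℕ, AdaptedBound p b₀ b₁ b₂ (E + (1 - E) * (2 / 3) ^ n) := by
    intro n
    induction n with
    | zero => simpa using hW.adaptedBound_one b₀ b₁ hb₂
    | succ n ih =>
      convert hW.adaptedBound_step (half_pos hε) hb₀ hb₂ ih using 1
      rw [← hE]
      ring
  obtain ⟨n, hn⟩ := exists_pow_lt_of_lt_one (by positivity : 0 < ε / (|1 - E| + 1))
    (by norm_num : (2 / 3 : ℝ) < 1)
  rw [lt_div_iff₀ (by positivity)] at hn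
  have hle : E + (1 - E) * (2 / 3) ^ n ≤ -2 * (2 / p - 1 / 2 - ε) := by
    have h1 : (1 - E) * (2 / 3) ^ n ≤ |1 - E| * (2 / 3) ^ n :=
      mul_le_mul_of_nonneg_right (le_abs_self _) (by positivity)
    have h2 : (0 : ℝ) < (2 / 3) ^ n := by positivity
    linarith
  intro C R hC hR
  obtain ⟨K, hK, h⟩ := hiter n C R hC hR
  refine ⟨K, hK, fun I g hI hg r θ hr hrθ hθ ι _ α φ hα => ?_⟩
  exact (h I g hI hg r θ hr hrθ hθ ι α φ hα).mono (mul_le_mul_of_nonneg_left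
    (Real.rpow_le_rpow_of_exponent_le ((one_le_div hr).mpr hrθ) hle) hK)

end Induction

/-! ### Plate families -/

section PlateFamily

variable {p : ℝ} [Fact (1 ≤ ENNReal.ofReal p)] {b₀ b₁ b₂ : ℝ}

lemma CurveAssumption.det_plateMatrix_ne_zero {I : Set ℝ} {g : ℝ → E2} (hb₁ : 0 < b₁)
    (hb₂ : 0 < b₂) (hg : CurveAssumption I g b₀ b₁ b₂) {α : ℝ} (hα : α ∈ I) (r : ℝ) :
    (plateMatrix I g α r).det ≠ 0 :=
  abs_pos.mp (lt_of_lt_of_le (by positivity) (hg.le_det_plateMatrix hb₁ hb₂ hα r))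

/-- For small `r` the plate is contained in a fixed shell in the coordinates of the moving frame:
the matrix that relates the two coordinate systems has a first row close to a multiple of
`(1, 0, 0)`. -/
lemma exists_suppIn_shell (hb₀ : 0 < b₀) (hb₁ : 0 < b₁) (hb₂ : 0 < b₂) :
    ∃ r₀ R : ℝ, 0 < r₀ ∧ 1 ≤ R ∧ ∀ (I : Set ℝ) (g : ℝ → E2), CurveAssumption I g b₀ b₁ b₂ →
    ∀ α ∈ I, ∀ r lam : ℝ, 0 < r → r ≤ 1 → r ≤ r₀ → 0 < lam → ∀ φ : E3 → ℂ,
      IsAdmissibleBump I g (r ^ 2) lam α φ →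
      SuppIn (curveFrame I g α * pdil r) (shell R) (φ ∘ mlin (lam • 1)) := by
  set L := 3 * (b₀ + 1) ^ 2 with hL
  set X := 6 * (2 * L ^ 2 / (b₁ ^ 2 * b₂)) * 4 with hX
  have hL0 : 0 < L := by positivity
  have hX0 : 0 < X := by positivity
  refine ⟨1 / (16 * L * X), X + 8 * L + 1, by positivity, by linarith, ?_⟩
  intro I g hg α hα r lam hr hr1 hr0 hlam φ hφ x hx
  have hy := hφ.plateMatrix_mem hr hlam x hx
  obtain ⟨hΛ, hΛ1, hΛ2⟩ := hg.entryBound_plateMatrix hα hr hr1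
  have hdet := hg.det_plateMatrix_ne_zero hb₁ hb₂ hα r
  have hinv := hΛ.inv (by positivity) (hg.le_det_plateMatrix hb₁ hb₂ hα r)
  have hxX : ‖x‖ ≤ X := by
    have h1 := hinv.norm_mlin_le (mlin (plateMatrix I g α r) x)
    rw [mlin_inv_mlin hdet] at h1
    exact h1.trans (mul_le_mul_of_nonneg_left hy.1 (by positivity))
  refine ⟨by linarith, ?_⟩
  have h1 := hy.2
  rw [mlin_apply] at h1
  have h2 := h1.trans (abs_add_three _ _ _)
  rw [abs_mul, abs_mul, abs_mul] at h2
  have h3 : |plateMatrix I g α r 0 0| * |x 0| ≤ L * |x 0| :=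
    mul_le_mul_of_nonneg_right (hΛ 0 0) (abs_nonneg _)
  have h4 : |plateMatrix I g α r 0 1| * |x 1| ≤ r * L * X :=
    mul_le_mul hΛ1 ((abs_coord_le_norm x 1).trans hxX) (abs_nonneg _) (by positivity)
  have h5 : |plateMatrix I g α r 0 2| * |x 2| ≤ r * L * X :=
    mul_le_mul hΛ2 ((abs_coord_le_norm x 2).trans hxX) (abs_nonneg _) (by positivity)
  rw [le_div_iff₀ (by positivity)] at hr0
  have h6 : 1 / 8 ≤ L * |x 0| := by linarith
  rw [inv_le_iff_one_le_mul₀ (by linarith)]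
  have h7 : 0 ≤ |x 0| * (X + 1) := by positivity
  linarith

/-- In the coordinates given by the functionals that define the plate, admissible bump functions
are adapted to a fixed shell, whatever the value of `r`. -/
lemma exists_derivBound_plateMatrix (hb₀ : 0 < b₀) (hb₁ : 0 < b₁) (hb₂ : 0 < b₂) :
    ∃ C : ℝ, 0 ≤ C ∧ ∀ (I : Set ℝ) (g : ℝ → E2), CurveAssumption I g b₀ b₁ b₂ →
    ∀ α ∈ I, ∀ r lam : ℝ, 0 < r → r ≤ 1 → 0 < lam → ∀ φ : E3 → ℂ,
      IsAdmissibleBump I g (r ^ 2) lam α φ → ∃ F : Matrix (Fin 3) (Fin 3) ℝ, F.det ≠ 0 ∧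
      DerivBound F C (φ ∘ mlin (lam • 1)) ∧ SuppIn F (shell 4) (φ ∘ mlin (lam • 1)) := by
  obtain ⟨D, hD, h⟩ := exists_derivBound_of_isAdmissibleBump hb₀ hb₁ hb₂
  refine ⟨D * (6 * (1 + 2 * (3 * (b₀ + 1) ^ 2) ^ 2 / (b₁ ^ 2 * b₂))) ^ 4, by positivity, ?_⟩
  intro I g hg α hα r lam hr hr1 hlam φ hφ
  have hdet := hg.det_plateMatrix_ne_zero hb₁ hb₂ hα r
  have hinv := (hg.entryBound_plateMatrix hα hr hr1).1.inv (by positivity)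
    (hg.le_det_plateMatrix hb₁ hb₂ hα r)
  have hpos : 0 ≤ 2 * (3 * (b₀ + 1) ^ 2) ^ 2 / (b₁ ^ 2 * b₂) := by positivity
  refine ⟨curveFrame I g α * pdil r * (plateMatrix I g α r)⁻¹, ?_, ?_, fun y hy => ?_⟩
  · rw [Matrix.det_mul, Matrix.det_nonsing_inv, Ring.inverse_eq_inv']
    exact mul_ne_zero (hg.det_frame_ne_zero hb₂ hr hα) (inv_ne_zero hdet)
  · exact (h I g hg α hα r lam hr hr1 hlam φ hφ).mul_right (hinv.mono (by linarith))
      (by linarith)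
  · rw [mlin_mul] at hy
    have h1 := hφ.plateMatrix_mem hr hlam _ hy
    rwa [mlin_mlin_inv hdet] at h1

/-- The decomposition inequality for plate families, with `r = δ ^ (1/2)` and with the frequency
variable normalized so that the plates have unit size. -/
lemma WolffInequality.plateFamily (hW : WolffInequality p) {ε : ℝ} (hε : 0 < ε)
    (hb₀ : 0 < b₀) (hb₁ : 0 < b₁) (hb₂ : 0 < b₂) : ∃ C : ℝ, ∀ (I : Set ℝ) (g : ℝ → E2),
      IsClosedSubinterval I → CurveAssumption I g b₀ b₁ b₂ →
      ∀ (r lam θ σ : ℝ) (ι : Type) [Fintype ι] (α : ι → ℝ) (φ : ι → E3 → ℂ),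
        0 < r → r ≤ 1 → 0 < lam → r ≤ θ → 0 < σ → σ ≤ r → (∀ i, α i ∈ I) →
        (∀ i j, i ≠ j → σ ≤ |α i - α j|) → (∀ i j, α i - α j ≤ θ) →
        (∀ i, IsAdmissibleBump I g (r ^ 2) lam (α i) (φ i)) →
        SchwartzDecomposition p (fun i => φ i ∘ mlin (lam • 1))
          (C * (r * σ⁻¹ * (θ / r) ^ (-2 * (2 / p - 1 / 2 - ε)))) := by
  classical
  have hE := hW.exponent_nonpos hε
  obtain ⟨r₀, R, hr₀, hR, hsupp⟩ := exists_suppIn_shell hb₀ hb₁ hb₂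
  obtain ⟨D, hD, hderiv⟩ := exists_derivBound_of_isAdmissibleBump hb₀ hb₁ hb₂
  obtain ⟨D', hD', hframe⟩ := exists_derivBound_plateMatrix hb₀ hb₁ hb₂
  obtain ⟨K, hK, hadapted⟩ := hW.adaptedBound hε b₁ hb₀ hb₂ D R hD hR
  obtain ⟨K', hK', hsingle⟩ := hW.single D' 4 hD' (by norm_num)
  set s := -2 * (2 / p - 1 / 2 - ε) with hs
  have hs0 : 0 ≤ s := by linarith
  refine ⟨3 * K + 3 * K' / r₀, fun I g hI hg r lam θ σ ι _ α φ hr hr1 hlam hrθ hσ hσr hmem hsep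
    hspread hφ => ?_⟩
  have hθ0 : 0 < θ := hr.trans_le hrθ
  have hmin : 0 < min θ 2 := lt_min hθ0 two_pos
  have hT1 : 1 ≤ (θ / r) ^ s := Real.one_le_rpow ((one_le_div hr).mpr hrθ) hs0
  have hrσ : 1 ≤ r * σ⁻¹ := by rwa [← div_eq_mul_inv, one_le_div hσ]
  have habs : ∀ i j, |α i - α j| ≤ 2 := fun i j => abs_sub_le_two hI (hmem j) (hmem i)
  rw [add_mul]
  have hA : 0 ≤ 3 * K * (r * σ⁻¹ * (θ / r) ^ s) := by positivity
  have hB : 0 ≤ 3 * K' / r₀ * (r * σ⁻¹ * (θ / r) ^ s) := by positivity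
  by_cases hrr : r ≤ r₀
  · -- `σ`-separated families split into `O(r / σ)` families that are `r`-separated
    set M : ℕ := ⌈r * σ⁻¹⌉₊ + 1 with hM
    have hM1 : r ≤ ((M : ℝ) - 1) * σ := by
      rw [hM]; push_cast
      rw [add_sub_cancel_right, ← div_le_iff₀ hσ, div_eq_mul_inv]
      exact Nat.le_ceil _
    have hM3 : (M : ℝ) ≤ 3 * (r * σ⁻¹) := by
      have := Nat.ceil_lt_add_one (zero_le_one.trans hrσ)
      rw [hM]; push_cast
      linarith
    have hrmin : r ≤ min θ 2 := le_min hrθ (hr1.trans (by norm_num))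
    have h1 : SchwartzDecomposition p (fun i => φ i ∘ mlin (lam • 1))
        (M * (K * (min θ 2 / r) ^ s)) := by
      refine SchwartzDecomposition.of_separated_classes hσ
        (floor_injective_of_separated hσ hsep) M (by positivity) fun κ _ f _ hf => ?_
      exact hadapted I g hI hg r (min θ 2) hr hrmin (min_le_right _ _) κ (fun i => α (f i)) _
        ⟨fun i => hmem _, fun i j hij => hM1.trans (hf i j hij),
          fun i j => le_min (abs_sub_le_iff.mpr ⟨hspread _ _, hspread _ _⟩) (habs _ _),
          fun i => hderiv I g hg _ (hmem _) r lam hr hr1 hlam _ (hφ _),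
          fun i => hsupp I g hg _ (hmem _) r lam hr hr1 hrr hlam _ (hφ _)⟩
    refine h1.mono (le_trans ?_ (le_add_of_nonneg_right hB))
    have h2 : (min θ 2 / r) ^ s ≤ (θ / r) ^ s := Real.rpow_le_rpow (by positivity)
      (div_le_div_of_nonneg_right (min_le_left _ _) hr.le) hs0
    calc (M : ℝ) * (K * (min θ 2 / r) ^ s) ≤ 3 * (r * σ⁻¹) * (K * (θ / r) ^ s) :=
          mul_le_mul hM3 (mul_le_mul_of_nonneg_left h2 hK) (by positivity) (by positivity)
      _ = _ := by ring
  · -- for `r` bounded below the triangle inequality suffices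
    have h1 : SchwartzDecomposition p (fun i => φ i ∘ mlin (lam • 1)) (Fintype.card ι * K') := by
      refine SchwartzDecomposition.of_single hK' fun i => ?_
      obtain ⟨F, hF, hF1, hF2⟩ := hframe I g hg _ (hmem i) r lam hr hr1 hlam _ (hφ i)
      exact hsingle F _ hF hF1 hF2
    refine h1.mono (le_trans ?_ (le_add_of_nonneg_left hA))
    have h2 := card_le_of_separated hσ (by norm_num : (0 : ℝ) ≤ 2) hsep
      fun i j => (le_abs_self _).trans (habs i j)
    have h3 : (Fintype.card ι : ℝ) ≤ 3 * σ⁻¹ := by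
      have : 1 ≤ σ⁻¹ := (one_le_inv₀ hσ).mpr (hσr.trans hr1)
      rw [div_eq_mul_inv] at h2
      linarith
    have h4 : 1 ≤ r / r₀ := (one_le_div hr₀).mpr (not_le.mp hrr).le
    calc (Fintype.card ι : ℝ) * K' ≤ 3 * σ⁻¹ * K' := mul_le_mul_of_nonneg_right h3 hK'
      _ ≤ 3 * σ⁻¹ * K' * (r / r₀ * (θ / r) ^ s) :=
          le_mul_of_one_le_right (by positivity) (one_le_mul_of_one_le_of_one_le h4 hT1)
      _ = _ := by ring

end PlateFamily

end ConePlates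

end

theorem mainTheorem5 (p : ℝ) [Fact (1 ≤ ENNReal.ofReal p)] (hp : 2 < p)
    (hWolff : ConePlates.WolffInequality p)
    (b₀ b₁ b₂ : ℝ) (hb₀ : 0 < b₀) (hb₁ : 0 < b₁) (hb₂ : 0 < b₂) (ε : ℝ) (hε : 0 < ε) :
    ∃ C : ℝ, ∀ (I : Set ℝ) (g : ℝ → ConePlates.E2),
      ConePlates.IsClosedSubinterval I → ConePlates.CurveAssumption I g b₀ b₁ b₂ →
      ∀ (δ lam θ σ : ℝ) (N : ℕ) (α : Fin N → ℝ) (φ : Fin N → ConePlates.E3 → ℂ),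
        δ ≤ 1 → ConePlates.IsPlateFamily I δ lam θ σ α →
        (∀ ν, ConePlates.IsAdmissibleBump I g δ lam (α ν) (φ ν)) →
        ConePlates.DecompositionInequality p φ
          (C * (δ ^ (1 / 2 : ℝ) * σ⁻¹ * (δ * (θ ^ 2)⁻¹) ^ (2 / p - 1 / 2 - ε))) := by
  obtain ⟨C, hC⟩ := hWolff.plateFamily hε hb₀ hb₁ hb₂
  obtain ⟨D, hD, hframe⟩ := ConePlates.exists_derivBound_plateMatrix hb₀ hb₁ hb₂
  refine ⟨C, fun I g hI hg δ lam θ σ N α φ hδ hα hφ => ?_⟩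
  obtain ⟨r, hr, rfl⟩ : ∃ r : ℝ, 0 < r ∧ δ = r ^ 2 :=
    ⟨√δ, Real.sqrt_pos.mpr hα.delta_pos, (Real.sq_sqrt hα.delta_pos.le).symm⟩
  have hrθ := hα.sqrt_delta_le
  have hσr := hα.sigma_le
  rw [ConePlates.sq_rpow_half hr.le] at hrθ hσr ⊢
  have hr1 : r ≤ 1 := (sq_le_one_iff₀ hr.le).mp hδ
  have hlam : 0 < lam := one_pos.trans_le hα.one_le_lam
  have hθ : 0 < θ := hr.trans_le hrθ
  have hdet : (lam • (1 : Matrix (Fin 3) (Fin 3) ℝ)).det ≠ 0 := by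
    rw [Matrix.det_smul, Matrix.det_one]
    positivity
  have htemp : ∀ ν, (φ ν).HasTemperateGrowth := by
    intro ν
    obtain ⟨F, hF, hF1, hF2⟩ := hframe I g hg _ (hα.mem ν) r lam hr hr1 hlam _ (hφ ν)
    have h1 := ConePlates.hasTemperateGrowth_comp_mlin
      (hF1.hasTemperateGrowth hF hF2 fun _ hx => hx.1) (lam • 1)⁻¹
    convert h1 using 1
    funext ξ
    simp [ConePlates.mlin_mlin_inv hdet]
  have h1 := hC I g hI hg r lam θ σ (Fin N) α φ hr hr1 hlam hrθ hα.sigma_pos hσr hα.mem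
    hα.separated hα.spread_le hφ
  have h2 : (r ^ 2 * (θ ^ 2)⁻¹) ^ (2 / p - 1 / 2 - ε) =
      (θ / r) ^ (-2 * (2 / p - 1 / 2 - ε)) := by
    rw [Real.rpow_mul (by positivity), ← div_eq_mul_inv, ← div_pow]
    congr 1
    rw [Real.rpow_neg (by positivity), ← Real.inv_rpow (by positivity), inv_div]
    norm_num
  rw [h2]
  exact (ConePlates.SchwartzDecomposition.of_comp_mlin htemp hdet h1).decompositionInequality htemp
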